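/- Fix $\ell,n,k\ge 1$, $\varepsilon>0$, $\beta,\delta\in(0,1)$. Let $X\subseteq\mathbb R^\ell$ be a non-empty set of Euclidean diameter at most $1$. A database is $D=(x_1,\dots,x_n)\in X^n$; two databases are adjacent if they differ in at most one entry. A query is a point $y\in X$ and its exact answer is $D(y)=\frac1n\sum_{i=1}^n\|x_i-y\|_2$. An interactive mechanism answers $k$ queries that arrive online, each chosen (measurably) by an analyst depending on the earlier answers. It is $(\varepsilon,\delta)$-differentially private if for every analyst, all adjacent $D,D'$ and every measurable set $S$ of transcripts of queries and answers, $\Pr[\text{transcript on }D\in S]\le e^\varepsilon\Pr[\text{transcript on }D'\in S]+\delta$. It is $(\alpha,\beta)$-accurate if for every database and analyst, with probability at least $1-\beta$ all $k$ answers have error at most $\alpha$. A non-interactive mechanism builds from $D$ a data structure (a finite array of reals) from which a deterministic algorithm answers every query $y\in X$ without access to $D$; privacy is required of the data structure, and $(\alpha,\beta)$-accuracy means that, for every $D$, with probability at least $1-\beta$ all queries $y\in X$ simultaneously are answered with error at most $\alpha$. $\varepsilon$-differential privacy means $(\varepsilon,0)$-differential privacy. Mechanisms are fixed programs for a randomized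 real RAM (unit-cost real arithmetic, comparison, $\exp$, $\log$, $\sqrt{\cdot}$, uniform and standard Gaussian samples; index arithmetic charged by bit length) that receive $n$, $\ell$, the real parameters $\varepsilon,\beta$ (and $\delta$ for $(\varepsilon,\delta)$-privacy, and $k$ in the interactive setting), one point of the public set $X$, and the data. Polynomial time means that, for some constant $c$, the preprocessing of the database and the treatment of each single query (interactive), respectively the construction of the data structure and each single query evaluation (non-interactive), take at most $c\,(n+\ell)^c$ steps in the worst case. All constants $c$ are absolute. **Theorem.** There are polynomial-time interactive and non-interactive mechanisms that, for all such $\ell,n,k,\varepsilon,\delta,\beta,X$, are $(\varepsilon,\delta)$-differentially private and $(\alpha_{\varepsilon,\delta},\beta)$-accurate with $$\alpha_{\varepsilon,\delta}=c\,L^c\,\frac{\ell^{9/23}}{n^{4/23}\varepsilon^{4/23}},$$ where $L=1+\log\ell+\log n+\log\frac1\beta+\log\frac1\delta$ in the non-interactive setting, with the additional summand $\log k$ in the interactive setting. There are also polynomial-time interactive and non-interactive mechanisms that, for all such $\ell,n,k,\varepsilon,\beta,X$, are $\varepsilon$-differentially private and $(\alpha_\varepsilon,\beta)$-accurate with $$\alpha_{\varepsilon}=c\,L^c\,\frac{\ell^{7/17}}{n^{2/17}\varepsilon^{2/17}},$$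 where $L=1+\log\ell+\log n+\log\frac1\beta$ in the non-interactive setting, with the additional summand $\log k$ in the interactive setting. -/

import Mathlib

open MeasureTheory ProbabilityTheory

/-! ### A randomized real RAM

A random access machine over the real numbers. It has natural-number index registers and
countably many arrays of reals. Programs are imperative programs with sequencing, conditionals and
bounded loops, so every program halts, and running time is measured by an explicit step count.

* Arithmetic on reals, the functions `exp`, `log`, `sqrt`, the comparison of two reals and the
  drawing of one random real take one step. There is no rounding, and a real cannot be converted to
  an index.
* Arithmetic on indices is charged by bit length, so large integers are not free.
* The available real constants are the rationals and `π`.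
* Randomness is a tape of independent entries; each draw reads a fresh entry. -/

namespace RealRAM

/-- A configuration of the machine: index registers, arrays of reals, and the number of entries of
the random tape that have been used. -/
structure State where
  /-- the index registers -/
  idx : ℕ → ℕ
  /-- `mem a i` is cell `i` of array `a` -/
  mem : ℕ → ℕ → ℝ
  /-- position on the random tape -/
  pos : ℕ

/-- Write an index register. -/
def State.setIdx (s : State) (i v : ℕ) : State :=
  { s with idx := Function.update s.idx i v }

/-- Write a whole array (used for input and output only). -/
def State.setArray (s : State) (a : ℕ) (v : ℕ → ℝ) : State :=
  { s with mem := Function.update s.mem a v }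

/-- Write one cell of an array. -/
def State.setCell (s : State) (a i : ℕ) (x : ℝ) : State :=
  s.setArray a (Function.update (s.mem a) i x)

/-- Expressions for indices; `sub` is truncated subtraction. -/
inductive IExp where
  | lit (c : ℕ)
  | reg (i : ℕ)
  | add (a b : IExp)
  | sub (a b : IExp)
  | mul (a b : IExp)

/-- The value of an index expression. -/
def IExp.eval (s : State) : IExp → ℕ
  | .lit c => c
  | .reg i => s.idx i
  | .add a b => a.eval s + b.eval s
  | .sub a b => a.eval s - b.eval s
  | .mul a b => a.eval s * b.eval s

/-- The cost of evaluating an index expression: every node is charged one plus the bit length of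
its value. -/
def IExp.cost (s : State) : IExp → ℕ
  | .lit c => 1 + Nat.size c
  | .reg i => 1 + Nat.size (s.idx i)
  | .add a b => a.cost s + b.cost s + 1 + Nat.size (a.eval s + b.eval s)
  | .sub a b => a.cost s + b.cost s + 1 + Nat.size (a.eval s - b.eval s)
  | .mul a b => a.cost s + b.cost s + 1 + Nat.size (a.eval s * b.eval s)

/-- Expressions for reals. -/
inductive RExp where
  | lit (q : ℚ)
  | pi
  | cell (a : ℕ) (i : IExp)
  | ofIdx (i : IExp)
  | add (a b : RExp)
  | sub (a b : RExp)
  | mul (a b : RExp)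
  | div (a b : RExp)
  | exp (a : RExp)
  | log (a : RExp)
  | sqrt (a : RExp)

/-- The value of a real expression. Outside their natural domains, division, logarithm and square
root have the library's default values. -/
noncomputable def RExp.eval (s : State) : RExp → ℝ
  | .lit q => (q : ℝ)
  | .pi => Real.pi
  | .cell a i => s.mem a (i.eval s)
  | .ofIdx i => (i.eval s : ℝ)
  | .add a b => a.eval s + b.eval s
  | .sub a b => a.eval s - b.eval s
  | .mul a b => a.eval s * b.eval s
  | .div a b => a.eval s / b.eval s
  | .exp a => Real.exp (a.eval s)
  | .log a => Real.log (a.eval s)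
  | .sqrt a => Real.sqrt (a.eval s)

/-- The cost of evaluating a real expression: one step for every node, and the cost of the index
expressions. -/
def RExp.cost (s : State) : RExp → ℕ
  | .lit _ => 1
  | .pi => 1
  | .cell _ i => 1 + i.cost s
  | .ofIdx i => 1 + i.cost s
  | .add a b => a.cost s + b.cost s + 1
  | .sub a b => a.cost s + b.cost s + 1
  | .mul a b => a.cost s + b.cost s + 1
  | .div a b => a.cost s + b.cost s + 1
  | .exp a => a.cost s + 1
  | .log a => a.cost s + 1
  | .sqrt a => a.cost s + 1

/-- Programs. -/
inductive Cmd where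
  /-- do nothing -/
  | skip
  /-- assign to index register `i` -/
  | setI (i : ℕ) (e : IExp)
  /-- assign to a cell of array `a` -/
  | setR (a : ℕ) (i : IExp) (e : RExp)
  /-- write a fresh sample of the uniform law on `[0,1]` to a cell of array `a` -/
  | uniform (a : ℕ) (i : IExp)
  /-- write a fresh sample of the standard Gaussian law to a cell of array `a` -/
  | gauss (a : ℕ) (i : IExp)
  /-- first `c`, then `d` -/
  | seq (c d : Cmd)
  /-- if `a < b` (indices) then `c` else `d` -/
  | ifI (a b : IExp) (c d : Cmd)
  /-- if `a < b` (reals) then `c` else `d` -/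
  | ifR (a b : RExp) (c d : Cmd)
  /-- for `i = 0, …, e - 1` do `c`; the bound `e` is evaluated once, on entry -/
  | loop (i : ℕ) (e : IExp) (c : Cmd)

/-- The random tape: entry `j` is a pair (uniform sample, Gaussian sample), of which a draw uses
one component. -/
abbrev Tape := ℕ → unitInterval × ℝ

/-- The law of the tape: all entries independent, uniform on `[0,1]` and standard Gaussian. -/
noncomputable def tapeLaw : Measure Tape :=
  Measure.infinitePi fun _ => (volume : Measure unitInterval).prod (gaussianReal 0 1)

/-- `N` passes of a loop with counter `i` and body `f`. -/
def iter (f : State → State) (i : ℕ) (s : State) : ℕ → State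
  | 0 => s
  | j + 1 => f ((iter f i s j).setIdx i j)

/-- The effect of a program. -/
noncomputable def Cmd.exec (ω : Tape) : Cmd → State → State
  | .skip, s => s
  | .setI i e, s => s.setIdx i (e.eval s)
  | .setR a i e, s => s.setCell a (i.eval s) (e.eval s)
  | .uniform a i, s => { s.setCell a (i.eval s) ((ω s.pos).1 : ℝ) with pos := s.pos + 1 }
  | .gauss a i, s => { s.setCell a (i.eval s) (ω s.pos).2 with pos := s.pos + 1 }
  | .seq c d, s => d.exec ω (c.exec ω s)
  | .ifI a b c d, s => if a.eval s < b.eval s then c.exec ω s else d.exec ω s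
  | .ifR a b c d, s =>
      open Classical in if a.eval s < b.eval s then c.exec ω s else d.exec ω s
  | .loop i e c, s => iter (c.exec ω) i s (e.eval s)

/-- The running time of a program. -/
noncomputable def Cmd.time (ω : Tape) : Cmd → State → ℕ
  | .skip, _ => 1
  | .setI _ e, s => 1 + e.cost s
  | .setR _ i e, s => 1 + i.cost s + e.cost s
  | .uniform _ i, s => 1 + i.cost s
  | .gauss _ i, s => 1 + i.cost s
  | .seq c d, s => c.time ω s + d.time ω (c.exec ω s)
  | .ifI a b c d, s =>
      1 + a.cost s + b.cost s + if a.eval s < b.eval s then c.time ω s else d.time ω s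
  | .ifR a b c d, s =>
      1 + a.cost s + b.cost s +
        open Classical in if a.eval s < b.eval s then c.time ω s else d.time ω s
  | .loop i e c, s =>
      1 + e.cost s + ∑ j ∈ Finset.range (e.eval s),
        (1 + Nat.size j + c.time ω ((iter (c.exec ω) i s j).setIdx i j))

/-- The program draws no randomness. -/
def Cmd.Deterministic : Cmd → Prop
  | .uniform _ _ => False
  | .gauss _ _ => False
  | .seq c d => c.Deterministic ∧ d.Deterministic
  | .ifI _ _ c d => c.Deterministic ∧ d.Deterministic
  | .ifR _ _ c d => c.Deterministic ∧ d.Deterministic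
  | .loop _ _ c => c.Deterministic
  | _ => True

end RealRAM

/-! ### Private release of Euclidean distance queries -/

namespace DistanceRelease

open RealRAM

/-- Euclidean space of dimension `ℓ`. -/
abbrev E (ℓ : ℕ) := EuclideanSpace ℝ (Fin ℓ)

/-- The exact answer to query `y`: the average distance from `y` to the `n` data points. -/
noncomputable def avgDist {ℓ n : ℕ} (D : Fin n → E ℓ) (y : E ℓ) : ℝ :=
  (∑ i, dist (D i) y) / n

/-- Databases at Hamming distance at most one. -/
def Adjacent {ℓ n : ℕ} (D D' : Fin n → E ℓ) : Prop :=
  {i | D i ≠ D' i}.ncard ≤ 1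

/-- `(ε, δ)`-differential privacy, for databases with points in `X`, of a randomized mechanism given
by its outcome `out D ω` on database `D` and random tape `ω`. -/
def DiffPrivate {ℓ n : ℕ} {T : Type*} [MeasurableSpace T] (X : Set (E ℓ))
    (out : (Fin n → E ℓ) → Tape → T) (ε δ : ℝ) : Prop :=
  ∀ D D' : Fin n → E ℓ, (∀ i, D i ∈ X) → (∀ i, D' i ∈ X) → Adjacent D D' →
    ∀ S : Set T, MeasurableSet S →
      tapeLaw {ω | out D ω ∈ S} ≤
        ENNReal.ofReal (Real.exp ε) * tapeLaw {ω | out D' ω ∈ S} + ENNReal.ofReal δ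

/-- Array holding the coordinates of a point. -/
noncomputable def pointArray {ℓ : ℕ} (x : E ℓ) : ℕ → ℝ :=
  fun j => if h : j < ℓ then x ⟨j, h⟩ else 0

/-- Array holding a database: coordinate `j` of point `i` is in cell `i * ℓ + j`. -/
noncomputable def dataArray {ℓ n : ℕ} (D : Fin n → E ℓ) : ℕ → ℝ :=
  fun p => if h : p < n * ℓ then
    D (finProdFinEquiv.symm ⟨p, h⟩).1 (finProdFinEquiv.symm ⟨p, h⟩).2 else 0

/-- The public input of a mechanism. Index registers `0` and `1` hold `n` and `ℓ`; array `0` holds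
the real parameters; array `1` holds some point `x₀` of the (public) metric space `X`, which
is all the machine is told about `X`. Everything else is zero. -/
noncomputable def publicState (n : ℕ) {ℓ : ℕ} (params : List ℝ) (x₀ : E ℓ) : State where
  idx := fun i => if i = 0 then n else if i = 1 then ℓ else 0
  mem := fun a => if a = 0 then fun i => params.getD i 0 else
    if a = 1 then pointArray x₀ else fun _ => 0
  pos := 0

/-- The public input together with the private database, which is in array `2`. -/
noncomputable def inputState {ℓ n : ℕ} (params : List ℝ) (x₀ : E ℓ) (D : Fin n → E ℓ) : State :=
  (publicState n params x₀).setArray 2 (dataArray D)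

/-! #### The interactive setting -/

/-- An interactive mechanism: a program that is run once on the database, and a program that is run
for every query. The second one finds the query in array `3`, leaves its answer in cell `0` of array
`4`, and keeps the memory for the following queries. -/
structure Interactive where
  /-- preprocessing of the database -/
  init : Cmd
  /-- treatment of one query -/
  answer : Cmd

/-- A data analyst, who chooses query number `t` depending on the earlier answers: `next t h` is the
query asked if the answers to queries `0, …, t - 1` were `h 0, …, h (t - 1)`; the other values of
`h` are zero. -/
structure Analyst (ℓ : ℕ) where
  /-- the next query -/
  next : ℕ → (ℕ → ℝ) → E ℓ
  measurable : ∀ t, Measurable (next t)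

namespace Interactive

/-- State of the mechanism and answers so far, after `t` queries of the analyst `A`. -/
noncomputable def session {ℓ : ℕ} (M : Interactive) (ω : Tape) (A : Analyst ℓ) (s₀ : State) :
    ℕ → State × (ℕ → ℝ)
  | 0 => (M.init.exec ω s₀, fun _ => 0)
  | t + 1 =>
      let p := session M ω A s₀ t
      let s := M.answer.exec ω (p.1.setArray 3 (pointArray (A.next t p.2)))
      (s, Function.update p.2 t (s.mem 4 0))

/-- Query number `t`. -/
noncomputable def query {ℓ : ℕ} (M : Interactive) (ω : Tape) (A : Analyst ℓ) (s₀ : State)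
    (t : ℕ) : E ℓ :=
  A.next t (M.session ω A s₀ t).2

/-- The answer to query number `t`. -/
noncomputable def reply {ℓ : ℕ} (M : Interactive) (ω : Tape) (A : Analyst ℓ) (s₀ : State)
    (t : ℕ) : ℝ :=
  (M.session ω A s₀ (t + 1)).2 t

/-- The transcript of `k` queries and their answers. -/
noncomputable def transcript {ℓ : ℕ} (M : Interactive) (k : ℕ) (ω : Tape) (A : Analyst ℓ)
    (s₀ : State) : Fin k → E ℓ × ℝ :=
  fun t => (M.query ω A s₀ t, M.reply ω A s₀ t)

/-- `(ε, δ)`-differential privacy: for every analyst with queries in `X`, the transcript is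
differentially private. -/
def Private {ℓ : ℕ} (M : Interactive) (n k : ℕ) (params : List ℝ) (X : Set (E ℓ)) (x₀ : E ℓ)
    (ε δ : ℝ) : Prop :=
  ∀ A : Analyst ℓ, (∀ t h, A.next t h ∈ X) →
    DiffPrivate X
      (fun (D : Fin n → E ℓ) ω => M.transcript k ω A (inputState params x₀ D)) ε δ

/-- `(α, β)`-accuracy: for every database and analyst, except with probability at most `β` all the
`k` answers are correct up to an additive error `α`. -/
def Accurate {ℓ : ℕ} (M : Interactive) (n k : ℕ) (params : List ℝ) (X : Set (E ℓ)) (x₀ : E ℓ)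
    (α β : ℝ) : Prop :=
  ∀ D : Fin n → E ℓ, (∀ i, D i ∈ X) → ∀ A : Analyst ℓ, (∀ t h, A.next t h ∈ X) →
    tapeLaw {ω | ¬ ∀ t < k, |M.reply ω A (inputState params x₀ D) t -
      avgDist D (M.query ω A (inputState params x₀ D) t)| ≤ α} ≤ ENNReal.ofReal β

/-- The preprocessing, and the treatment of each single query, take at most `B` steps, whatever the
data, the queries and the random choices. -/
def TimeBound {ℓ : ℕ} (M : Interactive) (n k : ℕ) (params : List ℝ) (X : Set (E ℓ)) (x₀ : E ℓ)
    (B : ℕ) : Prop :=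
  ∀ D : Fin n → E ℓ, (∀ i, D i ∈ X) → ∀ A : Analyst ℓ, (∀ t h, A.next t h ∈ X) → ∀ ω : Tape,
    M.init.time ω (inputState params x₀ D) ≤ B ∧
    ∀ t < k, M.answer.time ω ((M.session ω A (inputState params x₀ D) t).1.setArray 3
      (pointArray (M.query ω A (inputState params x₀ D) t))) ≤ B

end Interactive

/-! #### The non-interactive setting -/

/-- A non-interactive mechanism: a program that builds a data structure from the database, and a
deterministic program that evaluates queries on the data structure without access to the database. -/
structure NonInteractive where
  /-- construction of the data structure -/
  build : Cmd
  /-- evaluation of a query on the data structure -/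
  answer : Cmd
  deterministic : answer.Deterministic

namespace NonInteractive

/-- The released data structure: its length, left in index register `2`, and its entries, left in
array `4`, continued by zero. -/
noncomputable def synopsis {ℓ n : ℕ} (M : NonInteractive) (params : List ℝ) (x₀ : E ℓ)
    (D : Fin n → E ℓ) (ω : Tape) : ℕ × (ℕ → ℝ) :=
  let s := M.build.exec ω (inputState params x₀ D)
  (s.idx 2, fun i => if i < s.idx 2 then s.mem 4 i else 0)

/-- Input of a query evaluation: the public input, the length of the data structure in index
register `2`, its entries in array `2`, and the query in array `3`. -/
noncomputable def queryState {ℓ : ℕ} (n : ℕ) (params : List ℝ) (x₀ : E ℓ) (z : ℕ × (ℕ → ℝ))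
    (y : E ℓ) : State :=
  (((publicState n params x₀).setIdx 2 z.1).setArray 2 z.2).setArray 3 (pointArray y)

/-- The tape supplied to query evaluations, which do not read it. -/
def blankTape : Tape := fun _ => (0, 0)

/-- The answer to query `y` computed from the data structure `z`. -/
noncomputable def reply {ℓ : ℕ} (M : NonInteractive) (n : ℕ) (params : List ℝ) (x₀ : E ℓ)
    (z : ℕ × (ℕ → ℝ)) (y : E ℓ) : ℝ :=
  (M.answer.exec blankTape (queryState n params x₀ z y)).mem 4 0

/-- `(ε, δ)`-differential privacy of the released data structure. -/
def Private {ℓ : ℕ} (M : NonInteractive) (n : ℕ) (params : List ℝ) (X : Set (E ℓ)) (x₀ : E ℓ)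
    (ε δ : ℝ) : Prop :=
  DiffPrivate X (fun (D : Fin n → E ℓ) ω => M.synopsis params x₀ D ω) ε δ

/-- `(α, β)`-accuracy: for every database, except with probability at most `β` the data structure
answers all queries in `X` simultaneously up to an additive error `α`. -/
def Accurate {ℓ : ℕ} (M : NonInteractive) (n : ℕ) (params : List ℝ) (X : Set (E ℓ)) (x₀ : E ℓ)
    (α β : ℝ) : Prop :=
  ∀ D : Fin n → E ℓ, (∀ i, D i ∈ X) →
    tapeLaw {ω | ¬ ∀ y ∈ X,
      |M.reply n params x₀ (M.synopsis params x₀ D ω) y - avgDist D y| ≤ α} ≤ ENNReal.ofReal β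

/-- Building and writing out the data structure, and each single query evaluation, take at most `B`
steps, whatever the data, the queries and the random choices. -/
def TimeBound {ℓ : ℕ} (M : NonInteractive) (n : ℕ) (params : List ℝ) (X : Set (E ℓ)) (x₀ : E ℓ)
    (B : ℕ) : Prop :=
  ∀ D : Fin n → E ℓ, (∀ i, D i ∈ X) → ∀ ω : Tape,
    M.build.time ω (inputState params x₀ D) + (M.synopsis params x₀ D ω).1 ≤ B ∧
    ∀ y ∈ X, M.answer.time blankTape
      (queryState n params x₀ (M.synopsis params x₀ D ω) y) ≤ B

end NonInteractive

end DistanceRelease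

/-! A single data structure, private with δ = 0, yields all four claims.

Accuracy. For a standard Gaussian vector g the mean of |⟨g, v⟩| is √(2/π)‖v‖. Hence D(y) is √(π/2)
times the mean over g of the one-dimensional average of |⟨g, x_i - x₀⟩ - ⟨g, y - x₀⟩|. For a² random
directions this function of ⟨g, y - x₀⟩ is tabulated at a points of [-r, r], where r = B√ℓ and B is
a logarithmic level at which the Gaussians are truncated. One data point moves an entry by at most
r/n, so the a³ entries get noise of scale a³r/(nε). Sampling, discretization and noise cost about
r/a, r/a and Ba³r/(nε). With a ≈ (nε)^{1/4} this balances to B²(ℓ²/(nε))^{1/4} up to a constant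
(`Typical.abs_answerOf_sub_le`). Answers are clipped to [0, 1], so the error never exceeds 1, and
min(1, x^{1/4}) ≤ x^p for 0 ≤ p ≤ 1/4. Both pairs of exponents in the theorem are weaker than
ℓ^{2p}/(nε)^p for such a p (`Typical.abs_answerOf_sub_le_rate`). All queries are covered at once by
a union bound over a lattice of difference vectors (`tapeLaw_lattice_le`).

Running time. If ε ≤ nℓ², then a ≤ n + ℓ is enough (`resolution_spec`). For larger ε it is accurate
enough to release the data points themselves with noise.

Privacy. The noise is logistic, the log-odds of a uniform sample. Adding s to the log-odds is a
self-map of the unit interval under which preimages grow in measure by at most the factor e^{|s|}. A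
change of one data point is compensated exactly, tape by tape, by such shifts of total size at most
ε (`release_shiftBlock`, `tapeLaw_compensation_le`). Whatever is a function of the release inherits
privacy (`diffPrivate_of_release`), in particular the transcript of an interactive session that
answers from the release alone.

Programs. Loops are handled by invariants (`iter_induction`) together with the sets of registers and
arrays that a program writes. Running times are bounded statically from bounds on the registers
(`Cmd.time_le`). -/

/-! ### The logistic law and its shifts -/

namespace DistanceRelease

open RealRAM

/-- The log-odds of a point of the unit interval. -/
noncomputable def logit (u : ℝ) : ℝ := Real.log u - Real.log (1 - u)

lemma logit_sigmoid (x : ℝ) : logit (Real.sigmoid x) = x := by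
  have h : 1 - Real.sigmoid x = Real.sigmoid x * Real.exp (-x) := by
    rw [Real.sigmoid_mul_rexp_neg, Real.sigmoid_neg]
  rw [logit, h, Real.log_mul (Real.sigmoid_pos x).ne' (Real.exp_pos _).ne', Real.log_exp]
  ring

lemma sigmoid_logit_add {u : ℝ} (h0 : 0 < u) (h1 : u < 1) (s : ℝ) :
    Real.sigmoid (logit u + s) = u / (u + (1 - u) * Real.exp (-s)) := by
  have h2 : 0 < 1 - u := by linarith
  rw [Real.sigmoid_def, show -(logit u + s) = Real.log (1 - u) - Real.log u + -s by
    rw [logit]; ring, Real.exp_add, Real.exp_sub, Real.exp_log h0, Real.exp_log h2]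
  have := Real.exp_pos (-s)
  have h3 : 0 < u + (1 - u) * Real.exp (-s) := by positivity
  field_simp

lemma sigmoid_logit {u : ℝ} (h0 : 0 < u) (h1 : u < 1) : Real.sigmoid (logit u) = u := by
  simpa using sigmoid_logit_add h0 h1 0

/-- Translation by `s` on the log-odds scale. -/
noncomputable def shiftU (s : ℝ) (u : unitInterval) : unitInterval :=
  ⟨Real.sigmoid (logit u + s), Real.sigmoid_nonneg _, Real.sigmoid_le_one _⟩

lemma logit_shiftU (s : ℝ) (u : unitInterval) : logit (shiftU s u) = logit u + s :=
  logit_sigmoid _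

lemma measurable_logit : Measurable logit := by unfold logit; fun_prop

lemma measurable_shiftU : Measurable fun p : ℝ × unitInterval => shiftU p.1 p.2 := by
  refine Measurable.subtype_mk ?_
  exact continuous_sigmoid.measurable.comp
    ((measurable_logit.comp (measurable_subtype_coe.comp measurable_snd)).add measurable_fst)

/-- In the variable u the shift is the Möbius map u / (u + (1 - u)e^{-s}). Its difference quotient
is e^{-s} divided by two convex combinations of 1 and e^{-s}, so it is at most e^{|s|}. -/
lemma lipschitzOnWith_sigmoid_logit (s : ℝ) :
    LipschitzOnWith (Real.exp |s|).toNNReal (fun u => Real.sigmoid (logit u + s)) (Set.Ioo 0 1) := by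
  refine LipschitzOnWith.of_dist_le_mul fun u hu v hv => ?_
  rw [Real.coe_toNNReal _ (Real.exp_pos _).le, sigmoid_logit_add hu.1 hu.2,
    sigmoid_logit_add hv.1 hv.2, Real.dist_eq, Real.dist_eq]
  obtain ⟨t, rfl⟩ : ∃ t, s = -t := ⟨-s, by ring⟩
  rw [neg_neg, abs_neg]
  have hu2 : 0 < 1 - u := by linarith [hu.2]
  have hv2 : 0 < 1 - v := by linarith [hv.2]
  have hu1 := hu.1
  have hv1 := hv.1
  set e := Real.exp t with he
  have hepos : 0 < e := Real.exp_pos t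
  have hU : 0 < u + (1 - u) * e := by positivity
  have hV : 0 < v + (1 - v) * e := by positivity
  have key : u / (u + (1 - u) * e) - v / (v + (1 - v) * e)
      = (u - v) * (e / ((u + (1 - u) * e) * (v + (1 - v) * e))) := by
    field_simp; ring
  rw [key, abs_mul, mul_comm]
  refine mul_le_mul_of_nonneg_right ?_ (abs_nonneg _)
  rw [abs_of_pos (by positivity), div_le_iff₀ (by positivity)]
  rcases le_total 0 t with ht | ht
  · rw [abs_of_nonneg ht, ← he]
    have h1 : 1 ≤ e := Real.one_le_exp ht
    have hU1 : 1 ≤ u + (1 - u) * e := by nlinarith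
    have hV1 : 1 ≤ v + (1 - v) * e := by nlinarith
    have : 1 ≤ (u + (1 - u) * e) * (v + (1 - v) * e) := one_le_mul_of_one_le_of_one_le hU1 hV1
    nlinarith
  · rw [abs_of_nonpos ht, Real.exp_neg, ← he]
    have h1 : e ≤ 1 := Real.exp_le_one_iff.mpr ht
    have hU1 : e ≤ u + (1 - u) * e := by nlinarith
    have hV1 : e ≤ v + (1 - v) * e := by nlinarith
    have : e * e ≤ (u + (1 - u) * e) * (v + (1 - v) * e) := mul_le_mul hU1 hV1 hepos.le hU.le
    rw [inv_mul_eq_div, le_div_iff₀ hepos]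
    exact this

/-- Up to the endpoints, a preimage under the shift by s is an image under the shift by -s, and a
Lipschitz image enlarges one-dimensional Hausdorff measure by at most the Lipschitz constant. -/
lemma volume_shiftU_preimage_le (s : ℝ) (A : Set unitInterval) :
    volume (shiftU s ⁻¹' A) ≤ ENNReal.ofReal (Real.exp |s|) * volume A := by
  rw [unitInterval.volume_apply, unitInterval.volume_apply]
  set A' : Set ℝ := Subtype.val '' A
  have hsub : Subtype.val '' (shiftU s ⁻¹' A) ⊆
      {0, 1} ∪ (fun u => Real.sigmoid (logit u + -s)) '' (A' ∩ Set.Ioo 0 1) := by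
    -- At 0 and 1 the default value log 0 = 0 makes the log-odds vanish, so the inverse shift does
    -- not recover these points. They form a null set.
    rintro _ ⟨u, hu, rfl⟩
    rcases eq_or_lt_of_le u.2.1 with h0 | h0
    · left; left; exact h0.symm
    rcases eq_or_lt_of_le u.2.2 with h1 | h1
    · left; right; exact h1
    refine Or.inr ⟨shiftU s u, ⟨⟨_, hu, rfl⟩, Real.sigmoid_pos _, Real.sigmoid_lt_one _⟩, ?_⟩
    simp only [logit_shiftU, add_neg_cancel_right, sigmoid_logit h0 h1]
  refine (measure_mono hsub).trans ((measure_union_le _ _).trans ?_)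
  have h01 : volume ({0, 1} : Set ℝ) = 0 := (Set.toFinite _).measure_zero _
  rw [h01, zero_add]
  have := (((lipschitzOnWith_sigmoid_logit (-s)).mono Set.inter_subset_right :
    LipschitzOnWith _ _ (A' ∩ Set.Ioo 0 1))).hausdorffMeasure_image_le (d := 1) zero_le_one
  rw [hausdorffMeasure_real, abs_neg, ENNReal.rpow_one] at this
  exact this.trans (mul_le_mul_right (measure_mono Set.inter_subset_left) _)

/-! ### Perturbing the random tape -/

/-- The law of one entry of the tape. -/
noncomputable abbrev entryLaw : Measure (unitInterval × ℝ) :=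
  (volume : Measure unitInterval).prod (gaussianReal 0 1)

instance : IsProbabilityMeasure tapeLaw := by unfold tapeLaw; infer_instance

/-- Resampling one entry independently preserves the law. This lets Fubini isolate entry i while the
rest of the tape is held fixed. -/
lemma map_update_tapeLaw (i : ℕ) :
    (tapeLaw.prod entryLaw).map (fun p : Tape × (unitInterval × ℝ) => Function.update p.1 i p.2)
      = tapeLaw := by
  have hm : Measurable fun p : Tape × (unitInterval × ℝ) => Function.update p.1 i p.2 := by
    rw [measurable_pi_iff]
    intro j
    by_cases h : j = i
    · subst h; simpa using measurable_snd
    · simp only [Function.update_of_ne h]; fun_prop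
  refine Measure.eq_infinitePi _ fun s t ht => ?_
  rw [Measure.map_apply hm (.pi (Finset.countable_toSet _) fun _ _ => ht _)]
  by_cases hi : i ∈ s
  · have : (fun p : Tape × (unitInterval × ℝ) => Function.update p.1 i p.2) ⁻¹'
        Set.pi s t = (Set.pi (s.erase i) t) ×ˢ t i := by
      ext ⟨ω, x⟩
      simp only [Set.mem_preimage, Set.mem_pi, Set.mem_prod, Finset.mem_coe, Finset.mem_erase]
      constructor
      · intro h
        refine ⟨fun j hj => ?_, by simpa using h i hi⟩
        simpa [Function.update_of_ne hj.1] using h j hj.2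
      · rintro ⟨h1, h2⟩ j hj
        by_cases hji : j = i
        · subst hji; simpa using h2
        · simpa [Function.update_of_ne hji] using h1 j ⟨hji, hj⟩
    rw [this, Measure.prod_prod, tapeLaw, Measure.infinitePi_pi _ (fun j _ => ht j),
      mul_comm, Finset.mul_prod_erase s (fun j => entryLaw (t j)) hi]
  · have : (fun p : Tape × (unitInterval × ℝ) => Function.update p.1 i p.2) ⁻¹'
        Set.pi s t = (Set.pi s t) ×ˢ Set.univ := by
      ext ⟨ω, x⟩
      simp only [Set.mem_preimage, Set.mem_pi, Set.mem_prod, Finset.mem_coe, Set.mem_univ,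
        and_true]
      refine forall₂_congr fun j hj => ?_
      rw [Function.update_of_ne (ne_of_mem_of_not_mem hj hi)]
    rw [this, Measure.prod_prod, tapeLaw, Measure.infinitePi_pi _ (fun j _ => ht j),
      measure_univ, mul_one]

/-- Shift the uniform component of entry `i` of the tape by an amount read off the tape. -/
noncomputable def shiftEntry (i : ℕ) (s : Tape → ℝ) (ω : Tape) : Tape :=
  Function.update ω i (shiftU (s ω) (ω i).1, (ω i).2)

lemma measurable_shiftEntry (i : ℕ) {s : Tape → ℝ} (hs : Measurable s) :
    Measurable (shiftEntry i s) := by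
  rw [measurable_pi_iff]
  intro j
  unfold shiftEntry
  by_cases h : j = i
  · subst h
    simp only [Function.update_self]
    exact (measurable_shiftU.comp (hs.prodMk (by fun_prop))).prodMk (by fun_prop)
  · simp only [Function.update_of_ne h]; fun_prop

lemma entryLaw_shift_le {s b : ℝ} (hb : |s| ≤ b) {C : Set (unitInterval × ℝ)}
    (hC : MeasurableSet C) :
    entryLaw ((fun x => (shiftU s x.1, x.2)) ⁻¹' C) ≤ ENNReal.ofReal (Real.exp b) * entryLaw C := by
  have hm : Measurable fun x : unitInterval × ℝ => (shiftU s x.1, x.2) :=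
    (measurable_shiftU.comp (measurable_const.prodMk measurable_fst)).prodMk measurable_snd
  rw [Measure.prod_apply_symm (hm hC), Measure.prod_apply_symm hC,
    ← lintegral_const_mul _ (measurable_measure_prodMk_right hC)]
  refine lintegral_mono fun g => ?_
  refine (volume_shiftU_preimage_le s ((fun u => (u, g)) ⁻¹' C)).trans ?_
  gcongr

/-- The amount of the shift does not depend on entry i, so once the other entries are fixed it is a
constant and the bound for one entry applies. -/
lemma tapeLaw_shiftEntry_preimage_le (i : ℕ) {s : Tape → ℝ} (hs : Measurable s)
    (hi : ∀ ω x, s (Function.update ω i x) = s ω) {b : ℝ} (hb : ∀ ω, |s ω| ≤ b) (A : Set Tape) :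
    tapeLaw (shiftEntry i s ⁻¹' A) ≤ ENNReal.ofReal (Real.exp b) * tapeLaw A := by
  -- The events to which this is applied are preimages under arbitrary programs; passing to a
  -- measurable hull avoids proving them measurable.
  wlog hA : MeasurableSet A generalizing A
  · refine (measure_mono (Set.preimage_mono (subset_toMeasurable tapeLaw A))).trans ?_
    rw [← measure_toMeasurable A]
    exact this _ (measurableSet_toMeasurable _ _)
  have hm : Measurable fun p : Tape × (unitInterval × ℝ) => Function.update p.1 i p.2 := by
    rw [measurable_pi_iff]
    intro j
    by_cases h : j = i
    · subst h; simpa using measurable_snd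
    · simp only [Function.update_of_ne h]; fun_prop
  have hpre := measurable_shiftEntry i hs hA
  conv_lhs => rw [← map_update_tapeLaw i]
  conv_rhs => rw [← map_update_tapeLaw i]
  rw [Measure.map_apply hm hpre, Measure.map_apply hm hA, Measure.prod_apply (hm hpre),
    Measure.prod_apply (hm hA), ← lintegral_const_mul _ (measurable_measure_prodMk_left (hm hA))]
  refine lintegral_mono fun ω => ?_
  have hC : MeasurableSet ((fun x => Function.update ω i x) ⁻¹' A) :=
    (hm.comp measurable_prodMk_left) hA
  refine le_trans (le_of_eq ?_) (entryLaw_shift_le (hb ω) hC)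
  congr 1
  ext x
  simp [shiftEntry, hi]

/-- Shift the uniform components of the entries `o, …, o + K - 1` of the tape. -/
noncomputable def shiftBlock (o K : ℕ) (s : ℕ → Tape → ℝ) (ω : Tape) : Tape := fun i =>
  if o ≤ i ∧ i < o + K then (shiftU (s (i - o) ω) (ω i).1, (ω i).2) else ω i

/-- The amounts are read off the tape before the block, hence are unaffected by shifts inside it.
The block shift is thus a composition of single shifts, and the exponents add up. -/
lemma tapeLaw_shiftBlock_preimage_le (o K : ℕ) {s : ℕ → Tape → ℝ} (hs : ∀ p, Measurable (s p))
    (ho : ∀ p ω ω', (∀ i < o, ω i = ω' i) → s p ω = s p ω') {b : ℕ → ℝ}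
    (hb : ∀ p < K, ∀ ω, |s p ω| ≤ b p) (A : Set Tape) :
    tapeLaw (shiftBlock o K s ⁻¹' A) ≤
      ENNReal.ofReal (Real.exp (∑ p ∈ Finset.range K, b p)) * tapeLaw A := by
  induction K with
  | zero =>
    have : shiftBlock o 0 s = id := by
      funext ω i
      have : ¬ (o ≤ i ∧ i < o + 0) := by omega
      simp only [shiftBlock, this, if_false, id]
    simp [this]
  | succ K ih =>
    have hcomp : shiftBlock o (K + 1) s = shiftBlock o K s ∘ shiftEntry (o + K) (s K) := by
      funext ω i
      simp only [Function.comp, shiftBlock]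
      have hsame : ∀ p, s p (shiftEntry (o + K) (s K) ω) = s p ω := fun p =>
        ho p _ _ fun j hj => by
          rw [shiftEntry, Function.update_of_ne (by omega)]
      rw [hsame]
      rcases eq_or_ne i (o + K) with h | h
      · subst h
        simp [shiftEntry]
      · have h1 : shiftEntry (o + K) (s K) ω i = ω i := by
          rw [shiftEntry, Function.update_of_ne h]
        rw [h1]
        have : (o ≤ i ∧ i < o + (K + 1)) ↔ (o ≤ i ∧ i < o + K) := by omega
        simp only [this]
    rw [hcomp, Set.preimage_comp]
    refine (tapeLaw_shiftEntry_preimage_le (o + K) (hs K) (fun ω x => ho K _ _ fun j hj => ?_)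
      (hb K (by omega)) _).trans ?_
    · rw [Function.update_of_ne (by omega)]
    · rw [Finset.sum_range_succ, add_comm, Real.exp_add,
        ENNReal.ofReal_mul (Real.exp_pos _).le, mul_assoc]
      gcongr
      exact ih fun p hp => hb p (by omega)

end DistanceRelease

namespace DistanceRelease

open RealRAM

/-! ### Absolute values of Gaussians -/

lemma integral_abs_gaussianReal : ∫ x, |x| ∂gaussianReal 0 1 = √(2 / Real.pi) := by
  rw [integral_gaussianReal_eq_integral_smul one_ne_zero]
  have h1 : ∀ x : ℝ, gaussianPDFReal 0 1 x • |x| =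
      (fun y : ℝ => (√(2 * Real.pi))⁻¹ * (y ^ (1 : ℝ) * Real.exp (-(1 / 2) * y ^ (2 : ℝ)))) |x| := by
    intro x
    simp only [gaussianPDFReal, smul_eq_mul, NNReal.coe_one, mul_one, sub_zero, Real.rpow_one,
      Real.rpow_two, sq_abs]
    rw [show -x ^ 2 / 2 = -(1 / 2) * x ^ 2 by ring]
    ring
  simp_rw [h1]
  rw [integral_comp_abs (f := fun y : ℝ => (√(2 * Real.pi))⁻¹ *
    (y ^ (1 : ℝ) * Real.exp (-(1 / 2) * y ^ (2 : ℝ)))), integral_const_mul,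
    integral_rpow_mul_exp_neg_mul_rpow (by norm_num) (by norm_num) (by norm_num)]
  norm_num
  have h2 : √2 * √2 = 2 := Real.mul_self_sqrt (by norm_num)
  have hpi : 0 < √Real.pi := Real.sqrt_pos.mpr Real.pi_pos
  have h3 : 0 < √(2 : ℝ) := by positivity
  field_simp
  rw [sq, h2]

lemma integrable_exp_mul_abs_gaussianReal (t : ℝ) :
    Integrable (fun x : ℝ => Real.exp (t * |x|)) (gaussianReal 0 1) := by
  refine ((integrable_exp_mul_gaussianReal (μ := 0) (v := 1) t).add
    (integrable_exp_mul_gaussianReal (μ := 0) (v := 1) (-t))).mono' (by fun_prop) (ae_of_all _ ?_)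
  intro x
  rw [Real.norm_eq_abs, abs_of_pos (Real.exp_pos _)]
  rcases abs_choice x with h | h <;> rw [h] <;> simp only [Pi.add_apply]
  · linarith [Real.exp_pos (-t * x)]
  · rw [mul_neg, neg_mul]; linarith [Real.exp_pos (t * x)]

lemma integrable_abs_gaussianReal : Integrable (fun x : ℝ => |x|) (gaussianReal 0 1) :=
  ((memLp_id_gaussianReal (μ := 0) (v := 1) 1).integrable (by simp)).abs

/-- Symmetrization: the centred absolute value of a standard Gaussian is sub-Gaussian. -/
lemma hasSubgaussianMGF_abs_gaussianReal :
    HasSubgaussianMGF (fun x : ℝ => |x| - √(2 / Real.pi)) 2 (gaussianReal 0 1) := by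
  set γ := gaussianReal 0 1 with hγ
  set m := √(2 / Real.pi)
  have hexp : ∀ t : ℝ, (fun x : ℝ => Real.exp (t * (|x| - m))) =
      fun x => Real.exp (t * |x|) * Real.exp (-(t * m)) := by
    intro t; funext x; rw [← Real.exp_add]; ring_nf
  refine ⟨fun t => ?_, fun t => ?_⟩
  · rw [hexp]; exact (integrable_exp_mul_abs_gaussianReal t).mul_const _
  -- The mean `m` is replaced by an independent copy of |y|.
  have hjensen : Real.exp (-(t * m)) ≤ ∫ y, Real.exp (-t * |y|) ∂γ := by
    have := (convexOn_exp).map_integral_le (μ := γ) (f := fun y : ℝ => -t * |y|)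
      Real.continuous_exp.continuousOn isClosed_univ (by simp)
      (integrable_abs_gaussianReal.const_mul _) (integrable_exp_mul_abs_gaussianReal (-t))
    rwa [integral_const_mul, integral_abs_gaussianReal, neg_mul] at this
  have hpos : 0 ≤ ∫ x, Real.exp (t * |x|) ∂γ := integral_nonneg fun _ => (Real.exp_pos _).le
  have hprod : (∫ x, Real.exp (t * |x|) ∂γ) * ∫ y, Real.exp (-t * |y|) ∂γ =
      ∫ z, Real.exp (t * |z.1|) * Real.exp (-t * |z.2|) ∂(γ.prod γ) := by
    rw [integral_prod_mul (fun x : ℝ => Real.exp (t * |x|)) (fun y : ℝ => Real.exp (-t * |y|))]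
  have hprod' : (∫ x, Real.exp (-t * |x|) ∂γ) * ∫ y, Real.exp (t * |y|) ∂γ =
      ∫ z, Real.exp (-t * |z.1|) * Real.exp (t * |z.2|) ∂(γ.prod γ) := by
    rw [integral_prod_mul (fun x : ℝ => Real.exp (-t * |x|)) (fun y : ℝ => Real.exp (t * |y|))]
  have hG1 : ∫ z, Real.exp (t * z.1) * Real.exp (-t * z.2) ∂(γ.prod γ) = Real.exp (t ^ 2) := by
    rw [integral_prod_mul (fun x : ℝ => Real.exp (t * x)) (fun y : ℝ => Real.exp (-t * y))]
    have h := congrFun (mgf_fun_id_gaussianReal (μ := 0) (v := 1))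
    have h1 := h t
    have h2 := h (-t)
    simp only [mgf] at h1 h2
    rw [h1, h2, ← Real.exp_add]
    congr 1; simp
  have hG2 : ∫ z, Real.exp (-t * z.1) * Real.exp (t * z.2) ∂(γ.prod γ) = Real.exp (t ^ 2) := by
    rw [integral_prod_mul (fun x : ℝ => Real.exp (-t * x)) (fun y : ℝ => Real.exp (t * y)),
      mul_comm, ← integral_prod_mul (fun x : ℝ => Real.exp (t * x))
        (fun y : ℝ => Real.exp (-t * y)), hG1]
  have hI := fun s => integrable_exp_mul_abs_gaussianReal s
  have hJ : ∀ s : ℝ, Integrable (fun x : ℝ => Real.exp (s * x)) γ := fun s =>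
    integrable_exp_mul_gaussianReal s
  -- For one sign of t there is no pointwise comparison of |x| - |y| with x - y. The sum over both
  -- signs is 2cosh, which increases with the absolute value of its argument, and ||x| - |y|| ≤ |x -
  -- y|. The difference of two independent standard Gaussians has variance 2, whence the proxy 2.
  have hle : ∫ z, (Real.exp (t * |z.1|) * Real.exp (-t * |z.2|) +
        Real.exp (-t * |z.1|) * Real.exp (t * |z.2|)) ∂(γ.prod γ) ≤
      ∫ z, (Real.exp (t * z.1) * Real.exp (-t * z.2) +
        Real.exp (-t * z.1) * Real.exp (t * z.2)) ∂(γ.prod γ) := by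
    refine integral_mono (((hI t).mul_prod (hI (-t))).add ((hI (-t)).mul_prod (hI t)))
      (((hJ t).mul_prod (hJ (-t))).add ((hJ (-t)).mul_prod (hJ t))) fun z => ?_
    simp only [← Real.exp_add]
    have e : ∀ a b : ℝ, Real.exp (t * a + -t * b) + Real.exp (-t * a + t * b) =
        2 * Real.cosh (t * (a - b)) := by
      intro a b
      rw [Real.cosh_eq]; ring_nf
    rw [e, e]
    have : |t * (|z.1| - |z.2|)| ≤ |t * (z.1 - z.2)| := by
      rw [abs_mul, abs_mul]
      exact mul_le_mul_of_nonneg_left (abs_abs_sub_abs_le _ _) (abs_nonneg _)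
    linarith [Real.cosh_le_cosh.mpr this]
  rw [integral_add ((hI t).mul_prod (hI (-t))) ((hI (-t)).mul_prod (hI t)),
    integral_add ((hJ t).mul_prod (hJ (-t))) ((hJ (-t)).mul_prod (hJ t)), hG1, hG2,
    ← hprod, ← hprod'] at hle
  rw [mgf, hexp, integral_mul_const]
  calc (∫ x, Real.exp (t * |x|) ∂γ) * Real.exp (-(t * m))
      ≤ (∫ x, Real.exp (t * |x|) ∂γ) * ∫ y, Real.exp (-t * |y|) ∂γ :=
        mul_le_mul_of_nonneg_left hjensen hpos
    _ ≤ Real.exp (t ^ 2) := by linarith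
    _ = Real.exp ((2 : NNReal) * t ^ 2 / 2) := by congr 1; push_cast; ring

lemma map_const_mul_gaussian (r : ℝ) :
    (gaussianReal 0 1).map (fun x => r * x) = gaussianReal 0 (r ^ 2).toNNReal := by
  rw [gaussianReal_map_const_mul, mul_zero, mul_one, Real.toNNReal_of_nonneg (sq_nonneg r)]

lemma map_sum_mul_gaussian {Ω : Type*} {mΩ : MeasurableSpace Ω} {P : Measure Ω}
    [IsProbabilityMeasure P] {ι : Type*} {f : ι → Ω → ℝ} (hf : ∀ i, Measurable (f i))
    (hi : iIndepFun f P) (hl : ∀ i, P.map (f i) = gaussianReal 0 1) (v : ι → ℝ) (s : Finset ι) :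
    P.map (fun ω => ∑ c ∈ s, f c ω * v c) = gaussianReal 0 (∑ c ∈ s, v c ^ 2).toNNReal := by
  classical
  induction s using Finset.induction_on with
  | empty => simp
  | insert a s ha ih =>
    have hi' : iIndepFun (fun i ω => f i ω * v i) P :=
      hi.comp (fun i x => x * v i) (fun i => by fun_prop)
    have hind := hi'.indepFun_finsetSum_of_notMem (fun i => by fun_prop) ha
    have h1 : P.map (∑ c ∈ s, fun ω => f c ω * v c) =
        gaussianReal 0 (∑ c ∈ s, v c ^ 2).toNNReal := by
      rw [← ih]; congr 1; funext ω; simp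
    have h2 : P.map (fun ω => f a ω * v a) = gaussianReal 0 (v a ^ 2).toNNReal := by
      rw [← map_const_mul_gaussian, ← hl a, Measure.map_map (by fun_prop) (hf a)]
      congr 1; funext ω; simp [mul_comm]
    have := gaussianReal_add_gaussianReal_of_indepFun hind h1 h2
    rw [add_zero, ← Real.toNNReal_add (Finset.sum_nonneg fun _ _ => sq_nonneg _) (sq_nonneg _),
      add_comm, add_comm (∑ c ∈ s, v c ^ 2)] at this
    rw [Finset.sum_insert ha, ← this]
    congr 1; funext ω; simp [Finset.sum_insert ha]

/-- Scaling by r multiplies the variance proxy by r² ≤ 1, so the proxy 2 serves all vectors of the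
unit ball. -/
lemma hasSubgaussianMGF_abs_of_map {Ω : Type*} {mΩ : MeasurableSpace Ω} {P : Measure Ω}
    {Y : Ω → ℝ} (hY : Measurable Y) {r : ℝ} (h0 : 0 ≤ r) (h1 : r ≤ 1)
    (hl : P.map Y = gaussianReal 0 (r ^ 2).toNNReal) :
    HasSubgaussianMGF (fun ω => |Y ω| - √(2 / Real.pi) * r) 2 P := by
  have hid : IdentDistrib (fun x : ℝ => r * x) Y (gaussianReal 0 1) P :=
    ⟨by fun_prop, hY.aemeasurable, by rw [map_const_mul_gaussian, hl]⟩
  have hid2 := hid.comp (u := fun x => |x| - √(2 / Real.pi) * r) (by fun_prop)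
  refine HasSubgaussianMGF.congr_identDistrib ?_ hid2
  have h2 := hasSubgaussianMGF_abs_gaussianReal.const_mul r
  have e : (fun x : ℝ => r * (|x| - √(2 / Real.pi))) =
      (fun x => |x| - √(2 / Real.pi) * r) ∘ fun x => r * x := by
    funext x
    simp only [Function.comp, abs_mul, abs_of_nonneg h0]; ring
  rw [e] at h2
  refine ⟨h2.integrable_exp_mul, fun t => (h2.mgf_le t).trans (Real.exp_le_exp.mpr ?_)⟩
  have : r ^ 2 ≤ 1 := by nlinarith
  have h3 : (((⟨r ^ 2, sq_nonneg r⟩ * 2 : NNReal) : NNReal) : ℝ) = r ^ 2 * 2 := by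
    rfl
  rw [h3]
  push_cast
  nlinarith [mul_le_mul_of_nonneg_right this (sq_nonneg t)]

/-! ### Random projections read off the tape -/

lemma block_index_injective (ℓ : ℕ) :
    Function.Injective fun p : ℕ × Fin ℓ => p.1 * ℓ + p.2 := by
  rintro ⟨j, c⟩ ⟨j', c'⟩ h
  simp only at h
  have hc := c.2
  have hc' := c'.2
  have hpos : 0 < ℓ := by omega
  have h1 : (j * ℓ + c) / ℓ = j := by
    rw [mul_comm, Nat.mul_add_div hpos, Nat.div_eq_of_lt hc, add_zero]
  have h2 : (j' * ℓ + c') / ℓ = j' := by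
    rw [mul_comm, Nat.mul_add_div hpos, Nat.div_eq_of_lt hc', add_zero]
  have h3 : j = j' := by rw [← h1, h, h2]
  subst h3
  simp only [Prod.mk.injEq, true_and]
  exact Fin.ext (by omega)

/-- The projection of `v` to the `j`-th block of `ℓ` Gaussian entries of the tape. -/
noncomputable def proj {ℓ : ℕ} (v : E ℓ) (j : ℕ) (ω : Tape) : ℝ :=
  ∑ c : Fin ℓ, (ω (j * ℓ + c)).2 * v c

lemma measurable_proj {ℓ : ℕ} (v : E ℓ) (j : ℕ) : Measurable (proj v j) := by
  unfold proj; fun_prop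

/-- Different projections read disjoint blocks of the tape. Restricted along the injection (j, c) ↦
jℓ + c, the tape law is a product over pairs, and currying it gives independence of the blocks. -/
lemma iIndepFun_proj {ℓ : ℕ} (v : E ℓ) : iIndepFun (proj v) tapeLaw := by
  have h1 : iIndepFun (fun (j : ℕ) (ω : Tape) (c : Fin ℓ) => ω (j * ℓ + c)) tapeLaw := by
    rw [iIndepFun_iff_map_fun_eq_infinitePi_map (by fun_prop)]
    have h2 : ∀ j : ℕ, tapeLaw.map (fun (ω : Tape) (c : Fin ℓ) => ω (j * ℓ + c)) =
        Measure.infinitePi fun _ => entryLaw := fun j =>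
      Measure.map_infinitePi_infinitePi_of_inj (P := fun _ => entryLaw)
        (f := fun c : Fin ℓ => j * ℓ + (c : ℕ)) fun c c' h => by
          simpa [Fin.ext_iff] using h
    simp_rw [h2]
    rw [← Measure.infinitePi_map_curry (fun _ _ => entryLaw),
      ← Measure.map_infinitePi_infinitePi_of_inj (P := fun _ : ℕ => entryLaw)
        (block_index_injective ℓ), Measure.map_map (by fun_prop) (by fun_prop)]
    rfl
  exact h1.comp (fun _ x => ∑ c : Fin ℓ, (x c).2 * v c) (fun _ => by fun_prop)

lemma map_gauss_tapeLaw (i : ℕ) : tapeLaw.map (fun ω => (ω i).2) = gaussianReal 0 1 := by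
  have h := Measure.infinitePi_map_eval (fun _ : ℕ => entryLaw) i
  have : (fun ω : Tape => (ω i).2) = Prod.snd ∘ fun ω : Tape => ω i := rfl
  rw [this, ← Measure.map_map measurable_snd (by fun_prop), tapeLaw, h]
  simp [entryLaw]

lemma map_uniform_tapeLaw (i : ℕ) : tapeLaw.map (fun ω => (ω i).1) = volume := by
  have h := Measure.infinitePi_map_eval (fun _ : ℕ => entryLaw) i
  have : (fun ω : Tape => (ω i).1) = Prod.fst ∘ fun ω : Tape => ω i := rfl
  rw [this, ← Measure.map_map measurable_fst (by fun_prop), tapeLaw, h]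
  simp [entryLaw]

lemma map_proj {ℓ : ℕ} (v : E ℓ) (j : ℕ) :
    tapeLaw.map (proj v j) = gaussianReal 0 (‖v‖ ^ 2).toNNReal := by
  have hi : iIndepFun (fun (c : Fin ℓ) (ω : Tape) => (ω (j * ℓ + c)).2) tapeLaw := by
    have := iIndepFun_infinitePi (P := fun _ : ℕ => entryLaw) (X := fun _ x => x.2)
      (fun _ => measurable_snd)
    exact this.precomp (g := fun c : Fin ℓ => j * ℓ + (c : ℕ)) fun c c' h => by
      simpa [Fin.ext_iff] using h
  have := map_sum_mul_gaussian (fun c => by fun_prop) hi (fun c => map_gauss_tapeLaw _)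
    (fun c => v c) Finset.univ
  rw [EuclideanSpace.real_norm_sq_eq, ← this]
  rfl

/-- Chernoff's bound on both sides for m independent terms of proxy 2: the exponent is (mx)² / (2 ·
2m). -/
lemma tapeLaw_proj_deviation_le {ℓ : ℕ} (v : E ℓ) (hv : ‖v‖ ≤ 1) {m : ℕ} {x : ℝ} (hx : 0 ≤ x) :
    tapeLaw {ω | m * x < |∑ j ∈ Finset.range m, (|proj v j ω| - √(2 / Real.pi) * ‖v‖)|} ≤
      ENNReal.ofReal (2 * Real.exp (-(m * x ^ 2 / 4))) := by
  rcases Nat.eq_zero_or_pos m with rfl | hm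
  · simp
  have hmR : (0 : ℝ) < m := by exact_mod_cast hm
  have hX : ∀ j < m, HasSubgaussianMGF (fun ω => |proj v j ω| - √(2 / Real.pi) * ‖v‖) 2 tapeLaw :=
    fun j _ => hasSubgaussianMGF_abs_of_map (measurable_proj v j) (norm_nonneg _) hv (map_proj v j)
  have hind : iIndepFun (fun j ω => |proj v j ω| - √(2 / Real.pi) * ‖v‖) tapeLaw :=
    (iIndepFun_proj v).comp (fun _ y => |y| - √(2 / Real.pi) * ‖v‖) (fun _ => by fun_prop)
  have hindn : iIndepFun (fun j ω => -(|proj v j ω| - √(2 / Real.pi) * ‖v‖)) tapeLaw :=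
    hind.comp (fun _ y => -y) (fun _ => by fun_prop)
  have h1 := HasSubgaussianMGF.measure_sum_range_ge_le_of_iIndepFun hind hX
    (ε := m * x) (by positivity)
  have h2 := HasSubgaussianMGF.measure_sum_range_ge_le_of_iIndepFun hindn
    (fun j hj => (hX j hj).neg) (ε := m * x) (by positivity)
  have e : -((m : ℝ) * x) ^ 2 / (2 * m * (2 : NNReal)) = -(m * x ^ 2 / 4) := by
    push_cast; field_simp; ring
  rw [e] at h1 h2
  rw [two_mul, ENNReal.ofReal_add (Real.exp_pos _).le (Real.exp_pos _).le]
  refine (measure_mono ?_).trans ((measure_union_le _ _).trans (add_le_add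
    ((ENNReal.le_ofReal_iff_toReal_le (measure_ne_top _ _) (Real.exp_pos _).le).mpr h1)
    ((ENNReal.le_ofReal_iff_toReal_le (measure_ne_top _ _) (Real.exp_pos _).le).mpr h2)))
  intro ω hω
  rw [Set.mem_ofPred_eq] at hω
  rcases lt_abs.mp hω with h | h
  · exact Or.inl h.le
  · refine Or.inr ?_
    simp only [Set.mem_ofPred_eq, Finset.sum_neg_distrib]
    exact h.le

/-! ### Tails of single entries -/

/-- Chernoff's bound with parameter 1, where the moment generating function is e^{1/2} ≤ 2. An
exponential tail is all that is needed, because the logistic noise, cut at the same level, has no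
better one. -/
lemma tapeLaw_gauss_tail_le (i : ℕ) (b : ℝ) :
    tapeLaw {ω | b < |(ω i).2|} ≤ ENNReal.ofReal (4 * Real.exp (-b)) := by
  have h1 : tapeLaw {ω | b < |(ω i).2|} = gaussianReal 0 1 {x | b < |x|} := by
    rw [← map_gauss_tapeLaw i, Measure.map_apply (by fun_prop)]
    · rfl
    · exact measurableSet_lt measurable_const (by fun_prop)
  have tail : ∀ s : ℝ, s ^ 2 = 1 → gaussianReal 0 1 {x | b ≤ s * x} ≤
      ENNReal.ofReal (2 * Real.exp (-b)) := by
    intro s hs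
    refine (ENNReal.le_ofReal_iff_toReal_le (measure_ne_top _ _) (by positivity)).mpr ?_
    have := measure_ge_le_exp_mul_mgf (μ := gaussianReal 0 1) (X := fun x => s * x) b
      (t := 1) zero_le_one (by simpa using integrable_exp_mul_gaussianReal s)
    refine this.trans ?_
    have h3 : mgf (fun x => s * x) (gaussianReal 0 1) 1 = Real.exp (1 / 2) := by
      have := congrFun (mgf_fun_id_gaussianReal (μ := 0) (v := 1)) s
      simp only [mgf, one_mul] at this ⊢
      rw [this]; simp [hs]
    rw [h3]
    have h4 : Real.exp (1 / 2) ≤ 2 := by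
      rw [← Real.le_log_iff_exp_le (by norm_num)]
      linarith [Real.log_two_gt_d9]
    have := Real.exp_pos (-b)
    rw [neg_one_mul]
    nlinarith
  rw [h1, show (4 : ℝ) * Real.exp (-b) = 2 * Real.exp (-b) + 2 * Real.exp (-b) by ring,
    ENNReal.ofReal_add (by positivity) (by positivity)]
  refine (measure_mono ?_).trans ((measure_union_le _ _).trans
    (add_le_add (tail 1 (by norm_num)) (tail (-1) (by norm_num))))
  intro x hx
  rw [Set.mem_ofPred_eq] at hx
  rcases lt_abs.mp hx with h | h
  · left; simpa using h.le
  · right; simpa using h.le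

lemma sigmoid_neg_le_exp (b : ℝ) : Real.sigmoid (-b) ≤ Real.exp (-b) := by
  rw [← Real.sigmoid_mul_rexp_neg]
  exact mul_le_of_le_one_left (Real.exp_pos _).le (Real.sigmoid_le_one _)

lemma tapeLaw_logit_tail_le (i : ℕ) {b : ℝ} (hb : 0 ≤ b) :
    tapeLaw {ω | b < |logit (ω i).1|} ≤ ENNReal.ofReal (2 * Real.exp (-b)) := by
  have h1 : tapeLaw {ω | b < |logit (ω i).1|} =
      (volume : Measure unitInterval) {u | b < |logit u|} := by
    rw [← map_uniform_tapeLaw i, Measure.map_apply (by fun_prop)]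
    · rfl
    · refine measurableSet_lt measurable_const ?_
      exact (measurable_logit.comp measurable_subtype_coe).norm
  set p : unitInterval := ⟨Real.sigmoid (-b), Real.sigmoid_nonneg _, Real.sigmoid_le_one _⟩
  set q : unitInterval := ⟨Real.sigmoid b, Real.sigmoid_nonneg _, Real.sigmoid_le_one _⟩
  have hsub : {u : unitInterval | b < |logit u|} ⊆ Set.Iio p ∪ Set.Ioi q := by
    intro u hu
    rw [Set.mem_ofPred_eq] at hu
    -- At the endpoints the log-odds have the default value 0, which does not exceed b ≥ 0.
    have h0 : 0 < (u : ℝ) := lt_of_le_of_ne u.2.1 fun h => by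
      rw [← h] at hu; simp [logit] at hu; linarith
    have h1 : (u : ℝ) < 1 := lt_of_le_of_ne u.2.2 fun h => by
      rw [h] at hu; simp [logit] at hu; linarith
    rcases lt_abs.mp hu with h | h
    · right
      change Real.sigmoid b < u
      rw [← sigmoid_logit h0 h1]
      exact Real.sigmoid_strictMono h
    · left
      change (u : ℝ) < Real.sigmoid (-b)
      rw [← sigmoid_logit h0 h1]
      exact Real.sigmoid_strictMono (by linarith)
  rw [h1, two_mul, ENNReal.ofReal_add (by positivity) (by positivity)]
  refine (measure_mono hsub).trans ((measure_union_le _ _).trans (add_le_add ?_ ?_))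
  · rw [unitInterval.volume_Iio]
    exact ENNReal.ofReal_le_ofReal (sigmoid_neg_le_exp b)
  · rw [unitInterval.volume_Ioi]
    refine ENNReal.ofReal_le_ofReal ?_
    change 1 - Real.sigmoid b ≤ _
    rw [← Real.sigmoid_neg]
    exact sigmoid_neg_le_exp b

end DistanceRelease

/-! ### Reasoning about programs -/

namespace RealRAM

@[simp] lemma State.setIdx_idx (s : State) (i v : ℕ) :
    (s.setIdx i v).idx = Function.update s.idx i v := rfl
@[simp] lemma State.setIdx_mem (s : State) (i v : ℕ) : (s.setIdx i v).mem = s.mem := rfl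
@[simp] lemma State.setIdx_pos (s : State) (i v : ℕ) : (s.setIdx i v).pos = s.pos := rfl
@[simp] lemma State.setArray_idx (s : State) (a : ℕ) (v : ℕ → ℝ) :
    (s.setArray a v).idx = s.idx := rfl
@[simp] lemma State.setArray_mem (s : State) (a : ℕ) (v : ℕ → ℝ) :
    (s.setArray a v).mem = Function.update s.mem a v := rfl
@[simp] lemma State.setArray_pos (s : State) (a : ℕ) (v : ℕ → ℝ) :
    (s.setArray a v).pos = s.pos := rfl
@[simp] lemma State.setCell_idx (s : State) (a i : ℕ) (x : ℝ) : (s.setCell a i x).idx = s.idx := rfl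
@[simp] lemma State.setCell_mem (s : State) (a i : ℕ) (x : ℝ) :
    (s.setCell a i x).mem = Function.update s.mem a (Function.update (s.mem a) i x) := rfl
@[simp] lemma State.setCell_pos (s : State) (a i : ℕ) (x : ℝ) : (s.setCell a i x).pos = s.pos := rfl

/-! ### Loop invariants and frame conditions -/

lemma iter_induction {f : State → State} {i : ℕ} {s : State} {N : ℕ} {I : ℕ → State → Prop}
    (h0 : I 0 s) (h : ∀ j < N, ∀ t, I j t → I (j + 1) (f (t.setIdx i j))) : I N (iter f i s N) := by
  induction N with
  | zero => exact h0
  | succ N ih => exact h N (by omega) _ (ih fun j hj => h j (by omega))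

/-- The index registers that a program may write. -/
def Cmd.WritesI : Cmd → ℕ → Prop
  | .setI i _, r => r = i
  | .seq c d, r => c.WritesI r ∨ d.WritesI r
  | .ifI _ _ c d, r => c.WritesI r ∨ d.WritesI r
  | .ifR _ _ c d, r => c.WritesI r ∨ d.WritesI r
  | .loop i _ c, r => r = i ∨ c.WritesI r
  | _, _ => False

/-- The arrays that a program may write. -/
def Cmd.WritesA : Cmd → ℕ → Prop
  | .setR a _ _, r => r = a
  | .uniform a _, r => r = a
  | .gauss a _, r => r = a
  | .seq c d, r => c.WritesA r ∨ d.WritesA r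
  | .ifI _ _ c d, r => c.WritesA r ∨ d.WritesA r
  | .ifR _ _ c d, r => c.WritesA r ∨ d.WritesA r
  | .loop _ _ c, r => c.WritesA r
  | _, _ => False

/-- The frame rule: thanks to it, loop invariants need to mention only what the body really changes.
-/
lemma Cmd.exec_idx (ω : Tape) (c : Cmd) {r : ℕ} (h : ¬ c.WritesI r) (s : State) :
    (c.exec ω s).idx r = s.idx r := by
  induction c generalizing s with
  | seq c d ihc ihd =>
    simp only [WritesI, not_or] at h
    simp only [exec, ihd h.2, ihc h.1]
  | ifI a b c d ihc ihd =>
    simp only [WritesI, not_or] at h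
    simp only [exec]; split_ifs <;> simp [ihc h.1, ihd h.2]
  | ifR a b c d ihc ihd =>
    simp only [WritesI, not_or] at h
    simp only [exec]; split_ifs <;> simp [ihc h.1, ihd h.2]
  | loop i e c ih =>
    simp only [WritesI, not_or] at h
    simp only [exec]
    refine iter_induction (I := fun _ t => t.idx r = s.idx r) rfl fun j _ t ht => ?_
    rw [ih h.2, State.setIdx_idx, Function.update_of_ne h.1, ht]
  | setI i e => simp only [WritesI] at h; simp [exec, Function.update_of_ne h]
  | _ => simp [exec]

lemma Cmd.exec_mem (ω : Tape) (c : Cmd) {a : ℕ} (h : ¬ c.WritesA a) (s : State) :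
    (c.exec ω s).mem a = s.mem a := by
  induction c generalizing s with
  | seq c d ihc ihd =>
    simp only [WritesA, not_or] at h
    simp only [exec, ihd h.2, ihc h.1]
  | ifI _ _ c d ihc ihd =>
    simp only [WritesA, not_or] at h
    simp only [exec]; split_ifs <;> simp [ihc h.1, ihd h.2]
  | ifR _ _ c d ihc ihd =>
    simp only [WritesA, not_or] at h
    simp only [exec]; split_ifs <;> simp [ihc h.1, ihd h.2]
  | loop i e c ih =>
    simp only [WritesA] at h
    simp only [exec]
    refine iter_induction (I := fun _ t => t.mem a = s.mem a) rfl fun j _ t ht => ?_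
    rw [ih h, State.setIdx_mem, ht]
  | setR _ _ _ => simp only [WritesA] at h; simp [exec, Function.update_of_ne h]
  | uniform _ _ => simp only [WritesA] at h; simp [exec, Function.update_of_ne h]
  | gauss _ _ => simp only [WritesA] at h; simp [exec, Function.update_of_ne h]
  | _ => simp [exec]

lemma Cmd.Deterministic.exec_pos {c : Cmd} (h : c.Deterministic) (ω : Tape) (s : State) :
    (c.exec ω s).pos = s.pos := by
  induction c generalizing s with
  | seq c d ihc ihd => simp only [exec, ihd h.2, ihc h.1]
  | ifI _ _ c d ihc ihd => simp only [exec]; split_ifs <;> simp [ihc h.1, ihd h.2]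
  | ifR _ _ c d ihc ihd => simp only [exec]; split_ifs <;> simp [ihc h.1, ihd h.2]
  | loop i e c ih =>
    simp only [exec]
    refine iter_induction (I := fun _ t => t.pos = s.pos) rfl fun j _ t ht => ?_
    rw [ih h, State.setIdx_pos, ht]
  | uniform _ _ => exact h.elim
  | gauss _ _ => exact h.elim
  | _ => simp [exec]

/-- The states `s` and `t` agree outside the registers and arrays that `c` may write. -/
structure Agree (c : Cmd) (s t : State) : Prop where
  idx : ∀ r, ¬ c.WritesI r → t.idx r = s.idx r
  mem : ∀ a, ¬ c.WritesA a → t.mem a = s.mem a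

/-! #### Summation loops -/

/-- Leave in cell `0` of array `A` the sum of the values of `x` over a loop, in which `c` is run
before `x` is evaluated. -/
def sumLoop (A r : ℕ) (e : IExp) (c : Cmd) (x : RExp) : Cmd :=
  .seq (.setR A (.lit 0) (.lit 0))
    (.loop r e (.seq c (.setR A (.lit 0) (.add (.cell A (.lit 0)) x))))

@[simp] lemma writesI_sumLoop {A r : ℕ} {e : IExp} {c : Cmd} {x : RExp} {i : ℕ} :
    (sumLoop A r e c x).WritesI i ↔ i = r ∨ c.WritesI i := by
  simp [sumLoop, Cmd.WritesI]

@[simp] lemma writesA_sumLoop {A r : ℕ} {e : IExp} {c : Cmd} {x : RExp} {a : ℕ} :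
    (sumLoop A r e c x).WritesA a ↔ a = A ∨ c.WritesA a := by
  simp [sumLoop, Cmd.WritesA]; tauto

lemma IExp.eval_congr {s t : State} (h : t.idx = s.idx) (e : IExp) : e.eval t = e.eval s := by
  induction e <;> simp_all [IExp.eval]

/-- Agreement with the initial state outside the written registers and arrays is all that a summand
may rely on. As `c` may itself be a summation loop with another accumulator, double sums follow by
applying the lemma twice. -/
lemma exec_sumLoop (ω : Tape) {A r : ℕ} {e : IExp} {c : Cmd} {x : RExp} (hA : ¬ c.WritesA A)
    (s : State) (f : ℕ → ℝ)
    (h : ∀ j < e.eval s, ∀ t, Agree (sumLoop A r e c x) s t → t.idx r = j →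
      x.eval (c.exec ω t) = f j) :
    ((sumLoop A r e c x).exec ω s).mem A 0 = ∑ j ∈ Finset.range (e.eval s), f j := by
  simp only [sumLoop, Cmd.exec, IExp.eval, RExp.eval]
  rw [IExp.eval_congr (s := s) (by simp)]
  refine (iter_induction (I := fun j t => t.mem A 0 = ∑ i ∈ Finset.range j, f i ∧
    Agree (sumLoop A r e c x) s t) ?_ ?_).1
  · refine ⟨by simp, fun i _ => rfl, fun a ha => ?_⟩
    rw [writesA_sumLoop, not_or] at ha
    simp [Function.update_of_ne ha.1]
  · intro j hj t ⟨ht, hag⟩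
    have hag' : Agree (sumLoop A r e c x) s (t.setIdx r j) :=
      ⟨fun i hi => by
        have hir : i ≠ r := fun h => hi (by simp [h])
        simp [Function.update_of_ne hir, hag.idx i hi], fun a ha => hag.mem a ha⟩
    refine ⟨?_, fun i hi => ?_, fun a ha => ?_⟩
    · simp only [State.setCell_mem, Function.update_self, Finset.sum_range_succ]
      rw [h j hj _ hag' (by simp), c.exec_mem ω hA, State.setIdx_mem, ht]
    · have := hi
      rw [writesI_sumLoop, not_or] at this
      rw [State.setCell_idx, c.exec_idx ω this.2, hag'.idx i hi]
    · have := ha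
      rw [writesA_sumLoop, not_or] at this
      rw [State.setCell_mem, Function.update_of_ne this.1, c.exec_mem ω this.2, hag'.mem a ha]

/-! #### Static bounds on running times -/

/-- Bound on the value of an index expression, from bounds on the registers. -/
def IExp.valueBound (b : ℕ → ℕ) : IExp → ℕ
  | .lit c => c
  | .reg i => b i
  | .add x y => x.valueBound b + y.valueBound b
  | .sub x _ => x.valueBound b
  | .mul x y => x.valueBound b * y.valueBound b

/-- Bound on the cost of an index expression. -/
def IExp.costBound (b : ℕ → ℕ) : IExp → ℕ
  | .lit c => 1 + c
  | .reg i => 1 + b i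
  | .add x y => x.costBound b + y.costBound b + 1 + (x.valueBound b + y.valueBound b)
  | .sub x y => x.costBound b + y.costBound b + 1 + x.valueBound b
  | .mul x y => x.costBound b + y.costBound b + 1 + x.valueBound b * y.valueBound b

/-- Bound on the cost of a real expression. -/
def RExp.costBound (b : ℕ → ℕ) : RExp → ℕ
  | .lit _ => 1
  | .pi => 1
  | .cell _ i => 1 + i.costBound b
  | .ofIdx i => 1 + i.costBound b
  | .add x y => x.costBound b + y.costBound b + 1
  | .sub x y => x.costBound b + y.costBound b + 1
  | .mul x y => x.costBound b + y.costBound b + 1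
  | .div x y => x.costBound b + y.costBound b + 1
  | .exp x => x.costBound b + 1
  | .log x => x.costBound b + 1
  | .sqrt x => x.costBound b + 1

/-- Bound on the running time of a program all of whose register values obey the bounds `b`. -/
def Cmd.timeBound (b : ℕ → ℕ) : Cmd → ℕ
  | .skip => 1
  | .setI _ e => 1 + e.costBound b
  | .setR _ i e => 1 + i.costBound b + e.costBound b
  | .uniform _ i => 1 + i.costBound b
  | .gauss _ i => 1 + i.costBound b
  | .seq c d => c.timeBound b + d.timeBound b
  | .ifI x y c d => 1 + x.costBound b + y.costBound b + (c.timeBound b + d.timeBound b)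
  | .ifR x y c d => 1 + x.costBound b + y.costBound b + (c.timeBound b + d.timeBound b)
  | .loop _ e c => 1 + e.costBound b +
      e.valueBound b * (1 + e.valueBound b + c.timeBound b)

/-- The program respects the bounds `b` on the registers. -/
def Cmd.Respects (b : ℕ → ℕ) : Cmd → Prop
  | .setI i e => e.valueBound b ≤ b i
  | .seq c d => c.Respects b ∧ d.Respects b
  | .ifI _ _ c d => c.Respects b ∧ d.Respects b
  | .ifR _ _ c d => c.Respects b ∧ d.Respects b
  | .loop i e c => e.valueBound b ≤ b i ∧ c.Respects b
  | _ => True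

lemma size_le_self (x : ℕ) : Nat.size x ≤ x := Nat.size_le.mpr Nat.lt_two_pow_self

lemma IExp.eval_le {b : ℕ → ℕ} {s : State} (h : ∀ i, s.idx i ≤ b i) (e : IExp) :
    e.eval s ≤ e.valueBound b := by
  induction e with
  | lit => exact le_rfl
  | reg i => exact h i
  | add x y hx hy => exact Nat.add_le_add hx hy
  | sub x y hx hy => exact (Nat.sub_le _ _).trans hx
  | mul x y hx hy => exact Nat.mul_le_mul hx hy

lemma IExp.cost_le {b : ℕ → ℕ} {s : State} (h : ∀ i, s.idx i ≤ b i) (e : IExp) :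
    e.cost s ≤ e.costBound b := by
  induction e with
  | lit c => exact Nat.add_le_add_left (size_le_self c) 1
  | reg i => exact Nat.add_le_add_left ((size_le_self _).trans (h i)) 1
  | add x y hx hy =>
    exact Nat.add_le_add (Nat.add_le_add (Nat.add_le_add hx hy) le_rfl)
      ((size_le_self _).trans (IExp.eval_le h (.add x y)))
  | sub x y hx hy =>
    exact Nat.add_le_add (Nat.add_le_add (Nat.add_le_add hx hy) le_rfl)
      ((size_le_self _).trans (IExp.eval_le h (.sub x y)))
  | mul x y hx hy =>
    exact Nat.add_le_add (Nat.add_le_add (Nat.add_le_add hx hy) le_rfl)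
      ((size_le_self _).trans (IExp.eval_le h (.mul x y)))

lemma RExp.cost_le {b : ℕ → ℕ} {s : State} (h : ∀ i, s.idx i ≤ b i) (e : RExp) :
    e.cost s ≤ e.costBound b := by
  induction e with
  | cell a i => exact Nat.add_le_add_left (i.cost_le h) 1
  | ofIdx i => exact Nat.add_le_add_left (i.cost_le h) 1
  | _ => simp only [RExp.cost, RExp.costBound]; omega

/-- Running time and register bounds are proved together, since the time of a later command depends
on the registers left by an earlier one. `Respects` makes the bounds stable under every assignment,
hence through all passes of a loop. Bit lengths are estimated crudely by the values themselves. -/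
lemma Cmd.time_le {b : ℕ → ℕ} (ω : Tape) {c : Cmd} (hc : c.Respects b) {s : State}
    (h : ∀ i, s.idx i ≤ b i) :
    c.time ω s ≤ c.timeBound b ∧ ∀ i, (c.exec ω s).idx i ≤ b i := by
  have hset : ∀ {s : State}, (∀ i, s.idx i ≤ b i) → ∀ {i v : ℕ}, v ≤ b i →
      ∀ r, (s.setIdx i v).idx r ≤ b r := by
    intro s h i v hv r
    by_cases hr : r = i
    · subst hr; simpa using hv
    · simpa [Function.update_of_ne hr] using h r
  induction c generalizing s with
  | skip => exact ⟨le_rfl, h⟩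
  | setI i e => exact ⟨Nat.add_le_add_left (e.cost_le h) 1, hset h ((e.eval_le h).trans hc)⟩
  | setR a i e =>
    exact ⟨Nat.add_le_add (Nat.add_le_add_left (i.cost_le h) 1) (e.cost_le h), h⟩
  | uniform a i => exact ⟨Nat.add_le_add_left (i.cost_le h) 1, h⟩
  | gauss a i => exact ⟨Nat.add_le_add_left (i.cost_le h) 1, h⟩
  | seq c d ihc ihd =>
    obtain ⟨h1, h2⟩ := ihc hc.1 h
    obtain ⟨h3, h4⟩ := ihd hc.2 h2
    exact ⟨Nat.add_le_add h1 h3, h4⟩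
  | ifI x y c d ihc ihd =>
    have hx := x.cost_le h
    have hy := y.cost_le h
    obtain ⟨h1, h2⟩ := ihc hc.1 h
    obtain ⟨h3, h4⟩ := ihd hc.2 h
    simp only [Cmd.time, Cmd.exec, Cmd.timeBound]
    split_ifs
    · exact ⟨by omega, h2⟩
    · exact ⟨by omega, h4⟩
  | ifR x y c d ihc ihd =>
    have hx := x.cost_le h
    have hy := y.cost_le h
    obtain ⟨h1, h2⟩ := ihc hc.1 h
    obtain ⟨h3, h4⟩ := ihd hc.2 h
    simp only [Cmd.time, Cmd.exec, Cmd.timeBound]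
    split_ifs
    · exact ⟨by omega, h2⟩
    · exact ⟨by omega, h4⟩
  | loop i e c ih =>
    have hev := e.eval_le h
    have key : ∀ j ≤ e.eval s, ∀ r, (iter (c.exec ω) i s j).idx r ≤ b r := by
      intro j hj
      induction j with
      | zero => exact h
      | succ j ihj =>
        refine (ih hc.2 (hset (ihj (by omega)) ?_)).2
        exact (by omega : j ≤ e.valueBound b).trans hc.1
    refine ⟨Nat.add_le_add (Nat.add_le_add_left (e.cost_le h) 1) ?_, key _ le_rfl⟩
    calc ∑ j ∈ Finset.range (e.eval s),
          (1 + Nat.size j + c.time ω ((iter (c.exec ω) i s j).setIdx i j))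
        ≤ ∑ _j ∈ Finset.range (e.eval s), (1 + e.valueBound b + c.timeBound b) := by
          refine Finset.sum_le_sum fun j hj => ?_
          rw [Finset.mem_range] at hj
          have h1 := size_le_self j
          have h2 := (ih hc.2 (hset (key j hj.le)
            ((by omega : j ≤ e.valueBound b).trans hc.1))).1
          omega
      _ = e.eval s * (1 + e.valueBound b + c.timeBound b) := by simp
      _ ≤ _ := Nat.mul_le_mul_right _ hev

/-- Growth at most polynomial. -/
def PolyBounded (f : ℕ → ℕ) : Prop := ∃ C : ℕ, ∀ S ≥ 1, f S ≤ C * S ^ C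

namespace PolyBounded

lemma const (k : ℕ) : PolyBounded fun _ => k :=
  ⟨k, fun _ hS => Nat.le_mul_of_pos_right _ (Nat.pow_pos hS)⟩

lemma id : PolyBounded fun S => S := ⟨1, fun _ _ => by simp⟩

lemma add {f g : ℕ → ℕ} (hf : PolyBounded f) (hg : PolyBounded g) :
    PolyBounded fun S => f S + g S := by
  obtain ⟨C, hC⟩ := hf
  obtain ⟨D, hD⟩ := hg
  refine ⟨C + D, fun S hS => ?_⟩
  rw [add_mul]
  exact Nat.add_le_add
    ((hC S hS).trans (Nat.mul_le_mul_left _ (Nat.pow_le_pow_right hS (by omega))))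
    ((hD S hS).trans (Nat.mul_le_mul_left _ (Nat.pow_le_pow_right hS (by omega))))

lemma mul {f g : ℕ → ℕ} (hf : PolyBounded f) (hg : PolyBounded g) :
    PolyBounded fun S => f S * g S := by
  obtain ⟨C, hC⟩ := hf
  obtain ⟨D, hD⟩ := hg
  refine ⟨C * D + (C + D), fun S hS => ?_⟩
  calc f S * g S ≤ (C * S ^ C) * (D * S ^ D) := Nat.mul_le_mul (hC S hS) (hD S hS)
    _ = C * D * S ^ (C + D) := by ring
    _ ≤ _ := Nat.mul_le_mul (by omega) (Nat.pow_le_pow_right hS (by omega))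

lemma pow {f : ℕ → ℕ} (hf : PolyBounded f) (k : ℕ) : PolyBounded fun S => f S ^ k := by
  induction k with
  | zero => simpa using const 1
  | succ k ih => simpa only [pow_succ] using ih.mul hf

end PolyBounded

/-- For a fixed program the bound is an expression in the register bounds built from finitely many
sums and products. -/
lemma polyBounded_timeBound {b : ℕ → ℕ → ℕ} (hb : ∀ i, PolyBounded fun S => b S i) (c : Cmd) :
    PolyBounded fun S => c.timeBound (b S) := by
  have hv : ∀ e : IExp, PolyBounded fun S => e.valueBound (b S) := by
    intro e
    induction e with
    | lit k => exact .const k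
    | reg i => exact hb i
    | add x y hx hy => exact hx.add hy
    | sub x y hx hy => exact hx
    | mul x y hx hy => exact hx.mul hy
  have hi : ∀ e : IExp, PolyBounded fun S => e.costBound (b S) := by
    intro e
    induction e with
    | lit k => exact .const (1 + k)
    | reg i => exact (PolyBounded.const 1).add (hb i)
    | add x y hx hy => exact ((hx.add hy).add (.const 1)).add ((hv x).add (hv y))
    | sub x y hx hy => exact ((hx.add hy).add (.const 1)).add (hv x)
    | mul x y hx hy => exact ((hx.add hy).add (.const 1)).add ((hv x).mul (hv y))
  have hr : ∀ e : RExp, PolyBounded fun S => e.costBound (b S) := by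
    intro e
    induction e with
    | lit _ => exact .const 1
    | pi => exact .const 1
    | cell _ i => exact (PolyBounded.const 1).add (hi i)
    | ofIdx i => exact (PolyBounded.const 1).add (hi i)
    | exp _ h => exact h.add (.const 1)
    | log _ h => exact h.add (.const 1)
    | sqrt _ h => exact h.add (.const 1)
    | _ x y hx hy => exact (hx.add hy).add (.const 1)
  induction c with
  | skip => exact .const 1
  | setI _ e => exact (PolyBounded.const 1).add (hi e)
  | setR _ i e => exact ((PolyBounded.const 1).add (hi i)).add (hr e)
  | uniform _ i => exact (PolyBounded.const 1).add (hi i)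
  | gauss _ i => exact (PolyBounded.const 1).add (hi i)
  | seq c d hc hd => exact hc.add hd
  | ifI x y c d hc hd => exact (((PolyBounded.const 1).add (hi x)).add (hi y)).add (hc.add hd)
  | ifR x y c d hc hd => exact (((PolyBounded.const 1).add (hr x)).add (hr y)).add (hc.add hd)
  | loop _ e c hc =>
    exact ((PolyBounded.const 1).add (hi e)).add
      ((hv e).mul (((PolyBounded.const 1).add (hv e)).add hc))

end RealRAM

namespace DistanceRelease

open RealRAM

/-! ### The functions computed by the mechanism -/

/-- Truncation level for Gaussians and for logistic noise. -/
noncomputable def level (n ℓ : ℕ) (β : ℝ) : ℝ := 4 + 4 * Real.log ((n + ℓ : ℕ) : ℝ) - Real.log β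

/-- Bound on truncated projections of unit vectors. -/
noncomputable def radius (n ℓ : ℕ) (β : ℝ) : ℝ := level n ℓ β * √(ℓ : ℝ)

/-- Truncation of `x` to `[-b, b]`. -/
noncomputable def trunc (b x : ℝ) : ℝ := (|x + b| - |x - b|) / 2

/-- Truncation of `x` to `[0, 1]`. -/
noncomputable def truncUnit (x : ℝ) : ℝ := (|x| - |x - 1| + 1) / 2

/-- The resolution found by searching through `0, …, N - 1`. -/
noncomputable def resolutionSearch (x : ℝ) : ℕ → ℕ
  | 0 => 0
  | j + 1 => if ((j * j * (j * j) : ℕ) : ℝ) < x then j + 1 else resolutionSearch x j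

/-- The resolution of the mechanism. -/
noncomputable def resolution (n ℓ : ℕ) (ε : ℝ) : ℕ := resolutionSearch (n * ε) (n + ℓ)

/-- The point number `p` of the grid of `a` points on `[-r, r]`. -/
noncomputable def gridPoint (r : ℝ) (a p : ℕ) : ℝ := p * (2 * r / a) - r

/-- The last of the first `N` grid points that is at most `w`. -/
noncomputable def gridIndex (r : ℝ) (a : ℕ) (w : ℝ) : ℕ → ℕ
  | 0 => 0
  | p + 1 => if w < gridPoint r a p then gridIndex r a w p else p

/-- Inner product of `x - x₀` with block `j` of the array `g`. -/
noncomputable def blockInner (ℓ : ℕ) (g x₀ x : ℕ → ℝ) (j : ℕ) : ℝ :=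
  ∑ c ∈ Finset.range ℓ, g (j * ℓ + c) * (x c - x₀ c)

/-- Average distance of the grid point `p` to the projected data. -/
noncomputable def tableEntry (n ℓ : ℕ) (r : ℝ) (a : ℕ) (g x₀ d : ℕ → ℝ) (j p : ℕ) : ℝ :=
  (∑ i ∈ Finset.range n,
    |blockInner ℓ g x₀ (fun c => d (i * ℓ + c)) j - gridPoint r a p|) / n

/-- The answer computed from noisy data points. -/
noncomputable def directAnswer (n ℓ : ℕ) (z y : ℕ → ℝ) : ℝ :=
  (∑ i ∈ Finset.range n,
    √(∑ c ∈ Finset.range ℓ, (z (i * ℓ + c) - y c) * (z (i * ℓ + c) - y c))) / n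

/-- The answer computed from random projections and noisy tables. -/
noncomputable def tableAnswer (ℓ : ℕ) (r : ℝ) (a : ℕ) (x₀ z y : ℕ → ℝ) : ℝ :=
  √(Real.pi / 2) * (∑ j ∈ Finset.range (a * a),
    z (a * a * ℓ + (j * a + gridIndex r a (blockInner ℓ z x₀ y j) a))) / (a * a : ℕ)

/-- The answer to query `y` computed from the data structure `z`. -/
noncomputable def answerOf (n ℓ : ℕ) (ε β : ℝ) (x₀ z y : ℕ → ℝ) : ℝ :=
  truncUnit (if ((n * (ℓ * ℓ) : ℕ) : ℝ) < ε then directAnswer n ℓ z y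
    else tableAnswer ℓ (radius n ℓ β) (resolution n ℓ ε) x₀ z y)

/-! ### Expressions -/

/-- The privacy parameter. -/
def epsE : RExp := .cell 0 (.lit 0)

/-- The truncation level. -/
def levelE : RExp :=
  .sub (.add (.lit 4) (.mul (.lit 4) (.log (.ofIdx (.add (.reg 0) (.reg 1))))))
    (.log (.cell 0 (.lit 1)))

/-- The radius of the grid. -/
def radiusE : RExp := .mul levelE (.sqrt (.ofIdx (.reg 1)))

/-- Absolute value. -/
def absE (x : RExp) : RExp := .sqrt (.mul x x)

/-- Truncation at the truncation level. -/
def truncE (x : RExp) : RExp := .div (.sub (absE (.add x levelE)) (absE (.sub x levelE))) (.lit 2)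

/-- Truncation to the unit interval. -/
def truncUnitE (x : RExp) : RExp :=
  .div (.add (.sub (absE x) (absE (.sub x (.lit 1)))) (.lit 1)) (.lit 2)

/-- The grid point whose number is in register `5`. -/
def gridPointE : RExp :=
  .sub (.mul (.ofIdx (.reg 5)) (.div (.mul (.lit 2) radiusE) (.ofIdx (.reg 3)))) radiusE

section eval

variable (s : State)

lemma eval_epsE : epsE.eval s = s.mem 0 0 := rfl

lemma eval_levelE : levelE.eval s = level (s.idx 0) (s.idx 1) (s.mem 0 1) := by
  simp [levelE, level, RExp.eval, IExp.eval]

lemma eval_radiusE : radiusE.eval s = radius (s.idx 0) (s.idx 1) (s.mem 0 1) := by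
  simp [radiusE, radius, RExp.eval, IExp.eval, eval_levelE]

lemma eval_absE (x : RExp) : (absE x).eval s = |x.eval s| := by
  simp [absE, RExp.eval, Real.sqrt_mul_self_eq_abs]

lemma eval_truncE (x : RExp) :
    (truncE x).eval s = trunc (level (s.idx 0) (s.idx 1) (s.mem 0 1)) (x.eval s) := by
  simp [truncE, trunc, RExp.eval, eval_absE, eval_levelE]

lemma eval_truncUnitE (x : RExp) : (truncUnitE x).eval s = truncUnit (x.eval s) := by
  simp [truncUnitE, truncUnit, RExp.eval, eval_absE]

lemma eval_gridPointE : gridPointE.eval s =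
    gridPoint (radius (s.idx 0) (s.idx 1) (s.mem 0 1)) (s.idx 3) (s.idx 5) := by
  simp [gridPointE, gridPoint, RExp.eval, IExp.eval, eval_radiusE]

end eval

/-! ### Programs -/

/-- Compute the resolution in register `3`. -/
def searchCmd : Cmd :=
  .seq (.setI 3 (.lit 0)) (.loop 12 (.add (.reg 0) (.reg 1))
    (.ifR (.ofIdx (.mul (.mul (.reg 12) (.reg 12)) (.mul (.reg 12) (.reg 12))))
      (.mul (.ofIdx (.reg 0)) epsE) (.setI 3 (.add (.reg 12) (.lit 1))) .skip))

/-- Project `x - x₀` to the direction number `j` (register `4`), with directions in array `g`. -/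
def innerCmd (g : ℕ) (x : RExp) : Cmd :=
  sumLoop 5 7 (.reg 1) .skip
    (.mul (.cell g (.add (.mul (.reg 4) (.reg 1)) (.reg 7))) (.sub x (.cell 1 (.reg 7))))

/-- Draw the truncated Gaussian directions. -/
def directionsCmd : Cmd :=
  .loop 11 (.mul (.mul (.reg 3) (.reg 3)) (.reg 1))
    (.seq (.gauss 4 (.reg 11)) (.setR 4 (.reg 11) (truncE (.cell 4 (.reg 11)))))

/-- Total distance of the grid point in register `5` to the projected data. -/
def lossCmd : Cmd :=
  sumLoop 6 6 (.reg 0) (innerCmd 4 (.cell 2 (.add (.mul (.reg 6) (.reg 1)) (.reg 7))))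
    (absE (.sub (.cell 5 (.lit 0)) gridPointE))

/-- Compute all tables. -/
def tablesCmd : Cmd :=
  .loop 4 (.mul (.reg 3) (.reg 3)) (.loop 5 (.reg 3) (.seq lossCmd
    (.setR 4 (.add (.mul (.mul (.reg 3) (.reg 3)) (.reg 1)) (.add (.mul (.reg 4) (.reg 3)) (.reg 5)))
      (.div (.cell 6 (.lit 0)) (.ofIdx (.reg 0))))))

/-- Preparation for small `ε`: directions and tables; registers `9` and `8` receive the position
and number of entries that need noise, array `8` the noise scale. -/
def tableRegime : Cmd :=
  .seq searchCmd (.seq directionsCmd (.seq tablesCmd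
    (.seq (.setI 9 (.mul (.mul (.reg 3) (.reg 3)) (.reg 1)))
    (.seq (.setI 8 (.mul (.mul (.reg 3) (.reg 3)) (.reg 3)))
      (.setR 8 (.lit 0) (.div (.mul (.ofIdx (.reg 8)) radiusE) (.mul (.ofIdx (.reg 0)) epsE)))))))

/-- Preparation for large `ε`: the data. -/
def directRegime : Cmd :=
  .seq (.loop 11 (.mul (.reg 0) (.reg 1)) (.setR 4 (.reg 11) (.cell 2 (.reg 11))))
    (.seq (.setI 9 (.lit 0)) (.seq (.setI 8 (.mul (.reg 0) (.reg 1)))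
      (.setR 8 (.lit 0) (.div (.ofIdx (.reg 1)) epsE))))

/-- Add logistic noise. -/
def noiseCmd : Cmd :=
  .loop 11 (.reg 8) (.seq (.uniform 9 (.lit 0))
    (.setR 4 (.add (.reg 9) (.reg 11)) (.add (.cell 4 (.add (.reg 9) (.reg 11)))
      (.mul (.cell 8 (.lit 0))
        (.sub (.log (.cell 9 (.lit 0))) (.log (.sub (.lit 1) (.cell 9 (.lit 0)))))))))

/-- Run one of two programs, depending on whether `ε` is large. -/
def byRegime (c d : Cmd) : Cmd := .ifR (.ofIdx (.mul (.reg 0) (.mul (.reg 1) (.reg 1)))) epsE c d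

/-- Construction of the data structure. -/
def buildCmd : Cmd :=
  .seq (byRegime directRegime tableRegime) (.seq noiseCmd (.setI 2 (.add (.reg 9) (.reg 8))))

/-- Answer from noisy data points. -/
def directAnswerCmd : Cmd :=
  .seq (sumLoop 6 6 (.reg 0)
      (sumLoop 5 7 (.reg 1) .skip
        (.mul (.sub (.cell 2 (.add (.mul (.reg 6) (.reg 1)) (.reg 7))) (.cell 3 (.reg 7)))
          (.sub (.cell 2 (.add (.mul (.reg 6) (.reg 1)) (.reg 7))) (.cell 3 (.reg 7)))))
      (.sqrt (.cell 5 (.lit 0))))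
    (.setR 6 (.lit 0) (.div (.cell 6 (.lit 0)) (.ofIdx (.reg 0))))

/-- Find the grid point below the projected query. -/
def locateCmd : Cmd :=
  .seq (.setI 10 (.lit 0)) (.loop 5 (.reg 3)
    (.ifR (.cell 5 (.lit 0)) gridPointE .skip (.setI 10 (.reg 5))))

/-- Answer from noisy tables. -/
def tableAnswerCmd : Cmd :=
  .seq searchCmd (.seq
    (sumLoop 6 4 (.mul (.reg 3) (.reg 3)) (.seq (innerCmd 2 (.cell 3 (.reg 7))) locateCmd)
      (.cell 2 (.add (.mul (.mul (.reg 3) (.reg 3)) (.reg 1))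
        (.add (.mul (.reg 4) (.reg 3)) (.reg 10)))))
    (.setR 6 (.lit 0) (.div (.mul (.sqrt (.div .pi (.lit 2))) (.cell 6 (.lit 0)))
      (.ofIdx (.mul (.reg 3) (.reg 3))))))

/-- Evaluation of a query on the data structure. -/
def answerCmd : Cmd :=
  .seq (byRegime directAnswerCmd tableAnswerCmd) (.setR 4 (.lit 0) (truncUnitE (.cell 6 (.lit 0))))

/-- Erase the database, and move the data structure to array `2`. -/
def moveCmd : Cmd :=
  .seq (.loop 11 (.mul (.reg 0) (.reg 1)) (.setR 2 (.reg 11) (.lit 0)))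
    (.loop 13 (.reg 2) (.setR 2 (.reg 13) (.cell 4 (.reg 13))))

/-- The non-interactive mechanism. -/
def nonInteractiveMechanism : NonInteractive where
  build := buildCmd
  answer := answerCmd
  deterministic := by
    simp [answerCmd, byRegime, directAnswerCmd, tableAnswerCmd, sumLoop, searchCmd, innerCmd,
      locateCmd, Cmd.Deterministic]

/-- The interactive mechanism. -/
def interactiveMechanism : Interactive where
  init := .seq buildCmd moveCmd
  answer := answerCmd

/-! ### Correctness of the programs -/

@[simp] lemma writesI_searchCmd {i : ℕ} : searchCmd.WritesI i ↔ i = 3 ∨ i = 12 := by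
  simp [searchCmd, Cmd.WritesI]; tauto
@[simp] lemma writesA_searchCmd {a : ℕ} : ¬ searchCmd.WritesA a := by
  simp [searchCmd, Cmd.WritesA]
@[simp] lemma writesI_innerCmd {g : ℕ} {x : RExp} {i : ℕ} : (innerCmd g x).WritesI i ↔ i = 7 := by
  simp [innerCmd, Cmd.WritesI]
@[simp] lemma writesA_innerCmd {g : ℕ} {x : RExp} {a : ℕ} : (innerCmd g x).WritesA a ↔ a = 5 := by
  simp [innerCmd, Cmd.WritesA]
@[simp] lemma writesI_lossCmd {i : ℕ} : lossCmd.WritesI i ↔ i = 6 ∨ i = 7 := by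
  simp [lossCmd]
@[simp] lemma writesA_lossCmd {a : ℕ} : lossCmd.WritesA a ↔ a = 6 ∨ a = 5 := by
  simp [lossCmd]
@[simp] lemma writesI_tablesCmd {i : ℕ} :
    tablesCmd.WritesI i ↔ i = 4 ∨ i = 5 ∨ i = 6 ∨ i = 7 := by
  simp [tablesCmd, Cmd.WritesI]
@[simp] lemma writesA_tablesCmd {a : ℕ} : tablesCmd.WritesA a ↔ a = 4 ∨ a = 5 ∨ a = 6 := by
  simp [tablesCmd, Cmd.WritesA]; tauto
@[simp] lemma writesI_locateCmd {i : ℕ} : locateCmd.WritesI i ↔ i = 5 ∨ i = 10 := by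
  simp [locateCmd, Cmd.WritesI]; tauto
@[simp] lemma writesA_locateCmd {a : ℕ} : ¬ locateCmd.WritesA a := by
  simp [locateCmd, Cmd.WritesA]

variable (ω : Tape)

/-- A real cannot be turned into an index, so the fourth root is found by search. The loop runs to
its end and later successes overwrite earlier ones, which is why `resolutionSearch` looks at the
largest candidate first. -/
lemma exec_searchCmd (s : State) :
    (searchCmd.exec ω s).idx 3 = resolution (s.idx 0) (s.idx 1) (s.mem 0 0) := by
  simp only [searchCmd, Cmd.exec, IExp.eval, State.setIdx_idx, resolution]
  refine (iter_induction (I := fun j t => t.idx 3 = resolutionSearch (s.idx 0 * s.mem 0 0) j ∧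
    t.idx 0 = s.idx 0 ∧ t.mem 0 0 = s.mem 0 0) ⟨by simp [resolutionSearch], by simp, by simp⟩
    fun j _ t ⟨h1, h2, h3⟩ => ?_).1
  simp only [RExp.eval, IExp.eval, eval_epsE, State.setIdx_idx, State.setIdx_mem,
    Function.update_self, ne_eq, OfNat.zero_ne_ofNat, not_false_eq_true, Function.update_of_ne,
    h2, h3, resolutionSearch]
  split_ifs <;> simp [h1, h2, h3, Function.update]

lemma exec_innerCmd {g : ℕ} {x : RExp} (hg : g ≠ 5) (s : State) (v : ℕ → ℝ)
    (hx : ∀ c t, Agree (innerCmd g x) s t → t.idx 7 = c → x.eval t = v c) :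
    ((innerCmd g x).exec ω s).mem 5 0 =
      blockInner (s.idx 1) (s.mem g) (s.mem 1) v (s.idx 4) := by
  refine exec_sumLoop ω (by simp [Cmd.WritesA]) s _ fun c _ t ht hc => ?_
  have ht' : Agree (innerCmd g x) s t := ht
  simp only [Cmd.exec, RExp.eval, IExp.eval]
  rw [hx c t ht' hc, hc, ht'.mem g (by simp [hg]), ht'.mem 1 (by simp), ht'.idx 4 (by simp),
    ht'.idx 1 (by simp)]

lemma exec_lossCmd (s : State) : (lossCmd.exec ω s).mem 6 0 = ∑ i ∈ Finset.range (s.idx 0),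
    |blockInner (s.idx 1) (s.mem 4) (s.mem 1) (fun c => s.mem 2 (i * s.idx 1 + c)) (s.idx 4) -
      gridPoint (radius (s.idx 0) (s.idx 1) (s.mem 0 1)) (s.idx 3) (s.idx 5)| := by
  refine exec_sumLoop ω (by simp) s _ fun i _ t ht hi => ?_
  have ht' : Agree lossCmd s t := ht
  simp only [eval_absE, RExp.eval, eval_gridPointE, IExp.eval]
  rw [exec_innerCmd ω (by norm_num) t (fun c => s.mem 2 (i * s.idx 1 + c))]
  · simp (discharger := simp) only [Cmd.exec_idx, Cmd.exec_mem]
    rw [ht'.idx 1 (by simp), ht'.idx 4 (by simp), ht'.idx 0 (by simp), ht'.idx 3 (by simp),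
      ht'.idx 5 (by simp), ht'.mem 4 (by simp), ht'.mem 1 (by simp), ht'.mem 0 (by simp)]
  · intro c u hu hc
    simp only [RExp.eval, IExp.eval]
    rw [hc, hu.mem 2 (by simp), hu.idx 6 (by simp), hu.idx 1 (by simp), ht'.mem 2 (by simp), hi,
      ht'.idx 1 (by simp)]

lemma exec_locateCmd (s : State) : (locateCmd.exec ω s).idx 10 =
    gridIndex (radius (s.idx 0) (s.idx 1) (s.mem 0 1)) (s.idx 3) (s.mem 5 0) (s.idx 3) := by
  simp only [locateCmd, Cmd.exec, IExp.eval, State.setIdx_idx]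
  have e3 : Function.update s.idx 10 0 3 = s.idx 3 := by simp
  rw [e3]
  refine (iter_induction (I := fun p t => t.idx 10 =
      gridIndex (radius (s.idx 0) (s.idx 1) (s.mem 0 1)) (s.idx 3) (s.mem 5 0) p ∧
    t.idx 0 = s.idx 0 ∧ t.idx 1 = s.idx 1 ∧ t.idx 3 = s.idx 3 ∧ t.mem = s.mem)
    ⟨by simp [gridIndex], by simp, by simp, by simp, by simp⟩ fun p _ t ⟨h1, h2, h3, h4, h5⟩ => ?_).1
  have e : gridPointE.eval (t.setIdx 5 p) =
      gridPoint (radius (s.idx 0) (s.idx 1) (s.mem 0 1)) (s.idx 3) p := by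
    rw [eval_gridPointE]; simp [Function.update, h2, h3, h4, h5]
  simp only [RExp.eval, IExp.eval, e, State.setIdx_mem, h5, gridIndex]
  split_ifs <;> simp [h1, h2, h3, h4, h5, Function.update]

end DistanceRelease

namespace DistanceRelease

open RealRAM

variable (ω : Tape)

@[simp] lemma writesI_answerCmd {i : ℕ} : answerCmd.WritesI i ↔
    i = 3 ∨ i = 4 ∨ i = 5 ∨ i = 6 ∨ i = 7 ∨ i = 10 ∨ i = 12 := by
  simp [answerCmd, byRegime, directAnswerCmd, tableAnswerCmd, Cmd.WritesI]; tauto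
@[simp] lemma writesA_answerCmd {a : ℕ} : answerCmd.WritesA a ↔ a = 4 ∨ a = 5 ∨ a = 6 := by
  simp [answerCmd, byRegime, directAnswerCmd, tableAnswerCmd, Cmd.WritesA]; tauto

lemma exec_directAnswerCmd (s : State) : (directAnswerCmd.exec ω s).mem 6 0 =
    directAnswer (s.idx 0) (s.idx 1) (s.mem 2) (s.mem 3) := by
  simp only [directAnswerCmd, Cmd.exec, RExp.eval, IExp.eval, State.setCell_mem,
    Function.update_self]
  rw [exec_sumLoop ω (by simp [Cmd.WritesA]) s (fun i => √(∑ c ∈ Finset.range (s.idx 1),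
      (s.mem 2 (i * s.idx 1 + c) - s.mem 3 c) * (s.mem 2 (i * s.idx 1 + c) - s.mem 3 c))),
    Cmd.exec_idx ω _ (by simp [Cmd.WritesI])]
  · rfl
  · intro i _ t ht hi
    simp only [RExp.eval, IExp.eval]
    rw [exec_sumLoop ω (by simp [Cmd.WritesA]) t (fun c =>
      (s.mem 2 (i * s.idx 1 + c) - s.mem 3 c) * (s.mem 2 (i * s.idx 1 + c) - s.mem 3 c))]
    · simp only [IExp.eval]; rw [ht.idx 1 (by simp [Cmd.WritesI])]
    · intro c _ u hu hc
      simp only [Cmd.exec, RExp.eval, IExp.eval]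
      rw [hc, hu.mem 2 (by simp [Cmd.WritesA]), hu.idx 6 (by simp [Cmd.WritesI]),
        hu.idx 1 (by simp [Cmd.WritesI]), hu.mem 3 (by simp [Cmd.WritesA]),
        ht.mem 2 (by simp [Cmd.WritesA]), ht.mem 3 (by simp [Cmd.WritesA]),
        ht.idx 1 (by simp [Cmd.WritesI]), hi]

lemma exec_tableAnswerCmd (s : State) : (tableAnswerCmd.exec ω s).mem 6 0 =
    tableAnswer (s.idx 1) (radius (s.idx 0) (s.idx 1) (s.mem 0 1))
      (resolution (s.idx 0) (s.idx 1) (s.mem 0 0)) (s.mem 1) (s.mem 2) (s.mem 3) := by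
  simp only [tableAnswerCmd, Cmd.exec, RExp.eval, IExp.eval, State.setCell_mem,
    Function.update_self]
  set t := searchCmd.exec ω s
  have h3 : t.idx 3 = resolution (s.idx 0) (s.idx 1) (s.mem 0 0) := exec_searchCmd ω s
  have h0 : t.idx 0 = s.idx 0 := Cmd.exec_idx ω _ (by simp) s
  have h1 : t.idx 1 = s.idx 1 := Cmd.exec_idx ω _ (by simp) s
  have hm : t.mem = s.mem := funext fun a => Cmd.exec_mem ω _ (by simp) s
  clear_value t
  rw [← h3, ← hm, ← h0, ← h1]
  rw [exec_sumLoop ω (by simp [Cmd.WritesA]) t (fun j => t.mem 2 (t.idx 3 * t.idx 3 * t.idx 1 +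
      (j * t.idx 3 + gridIndex (radius (t.idx 0) (t.idx 1) (t.mem 0 1)) (t.idx 3)
        (blockInner (t.idx 1) (t.mem 2) (t.mem 1) (t.mem 3) j) (t.idx 3)))),
    Cmd.exec_idx ω _ (by simp [Cmd.WritesI])]
  · simp [tableAnswer, IExp.eval]
  · intro j _ u hu hj
    simp only [Cmd.exec, RExp.eval, IExp.eval, exec_locateCmd]
    rw [exec_innerCmd ω (by norm_num) u (t.mem 3)]
    · simp (discharger := simp) only [Cmd.exec_idx, Cmd.exec_mem]
      rw [hu.idx 0 (by simp [Cmd.WritesI]), hu.idx 1 (by simp [Cmd.WritesI]),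
        hu.idx 3 (by simp [Cmd.WritesI]), hu.mem 0 (by simp [Cmd.WritesA]),
        hu.mem 1 (by simp [Cmd.WritesA]), hu.mem 2 (by simp [Cmd.WritesA]), hj]
    · intro c v hv hc
      simp only [RExp.eval, IExp.eval]
      rw [hc, hv.mem 3 (by simp), hu.mem 3 (by simp [Cmd.WritesA])]

lemma exec_byRegime_of_lt {c d : Cmd} {s : State}
    (h : ((s.idx 0 * (s.idx 1 * s.idx 1) : ℕ) : ℝ) < s.mem 0 0) :
    (byRegime c d).exec ω s = c.exec ω s := if_pos h

lemma exec_byRegime_of_not_lt {c d : Cmd} {s : State}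
    (h : ¬ ((s.idx 0 * (s.idx 1 * s.idx 1) : ℕ) : ℝ) < s.mem 0 0) :
    (byRegime c d).exec ω s = d.exec ω s := if_neg h

/-- The right side involves neither the tape nor the scratch memory: an answer is a function of the
public input, the data structure in array `2` and the query in array `3`. -/
lemma exec_answerCmd (s : State) : (answerCmd.exec ω s).mem 4 0 =
    answerOf (s.idx 0) (s.idx 1) (s.mem 0 0) (s.mem 0 1) (s.mem 1) (s.mem 2) (s.mem 3) := by
  simp only [answerCmd, Cmd.exec, IExp.eval, State.setCell_mem, Function.update_self,
    eval_truncUnitE, answerOf, RExp.eval]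
  split_ifs with h
  · rw [exec_byRegime_of_lt ω h, exec_directAnswerCmd]
  · rw [exec_byRegime_of_not_lt ω h, exec_tableAnswerCmd]

/-! ### The released data structure -/

/-- `ε` is so large that noisy data points are released. -/
def Direct (n ℓ : ℕ) (ε : ℝ) : Prop := ((n * (ℓ * ℓ) : ℕ) : ℝ) < ε

/-- The truncated Gaussians on the tape. -/
noncomputable def directions (b : ℝ) (i : ℕ) : ℝ := trunc b (ω i).2

/-- The table entries one after the other. -/
noncomputable def tables (n ℓ : ℕ) (r : ℝ) (a : ℕ) (g x₀ d : ℕ → ℝ) (q : ℕ) : ℝ :=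
  tableEntry n ℓ r a g x₀ d (q / a) (q % a)

open Classical in
/-- Number of entries of the data structure without noise. -/
noncomputable def offset (n ℓ : ℕ) (ε : ℝ) : ℕ :=
  if Direct n ℓ ε then 0 else resolution n ℓ ε * resolution n ℓ ε * ℓ

open Classical in
/-- Number of entries of the data structure with noise. -/
noncomputable def count (n ℓ : ℕ) (ε : ℝ) : ℕ :=
  if Direct n ℓ ε then n * ℓ else resolution n ℓ ε * resolution n ℓ ε * resolution n ℓ ε

open Classical in
/-- Scale of the noise. -/
noncomputable def noiseScale (n ℓ : ℕ) (ε β : ℝ) : ℝ :=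
  if Direct n ℓ ε then ℓ / ε else count n ℓ ε * radius n ℓ β / (n * ε)

open Classical in
/-- The data structure before noise is added. -/
noncomputable def rawEntry (n ℓ : ℕ) (ε β : ℝ) (x₀ d : ℕ → ℝ) (i : ℕ) : ℝ :=
  if Direct n ℓ ε then d i
  else if i < offset n ℓ ε then directions ω (level n ℓ β) i
  else tables n ℓ (radius n ℓ β) (resolution n ℓ ε) (directions ω (level n ℓ β)) x₀ d
    (i - offset n ℓ ε)

/-- The entries of the data structure. -/
noncomputable def release (n ℓ : ℕ) (ε β : ℝ) (x₀ d : ℕ → ℝ) (i : ℕ) : ℝ :=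
  if i < offset n ℓ ε then rawEntry ω n ℓ ε β x₀ d i
  else if i < offset n ℓ ε + count n ℓ ε then
    rawEntry ω n ℓ ε β x₀ d i + noiseScale n ℓ ε β * logit (ω i).1
  else 0

/-! ### Execution of the construction of the data structure -/

@[simp] lemma writesI_directionsCmd {i : ℕ} : directionsCmd.WritesI i ↔ i = 11 := by
  simp [directionsCmd, Cmd.WritesI]
@[simp] lemma writesA_directionsCmd {a : ℕ} : directionsCmd.WritesA a ↔ a = 4 := by
  simp [directionsCmd, Cmd.WritesA]
@[simp] lemma writesI_noiseCmd {i : ℕ} : noiseCmd.WritesI i ↔ i = 11 := by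
  simp [noiseCmd, Cmd.WritesI]
@[simp] lemma writesA_noiseCmd {a : ℕ} : noiseCmd.WritesA a ↔ a = 9 ∨ a = 4 := by
  simp [noiseCmd, Cmd.WritesA]

/-- The tables are stored behind the directions in the same array, so the array changes while
directions are still read from it. Only its first mℓ cells matter. -/
lemma blockInner_congr {ℓ : ℕ} {g g' : ℕ → ℝ} {m j : ℕ} (hj : j < m)
    (h : ∀ i < m * ℓ, g i = g' i) (x₀ x : ℕ → ℝ) :
    blockInner ℓ g x₀ x j = blockInner ℓ g' x₀ x j := by
  refine Finset.sum_congr rfl fun c hc => ?_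
  rw [Finset.mem_range] at hc
  rw [h]
  nlinarith [Nat.mul_le_mul_right ℓ (Nat.succ_le_of_lt hj)]

lemma tableEntry_congr {n ℓ : ℕ} {g g' : ℕ → ℝ} {m j : ℕ} (hj : j < m)
    (h : ∀ i < m * ℓ, g i = g' i) (r : ℝ) (a : ℕ) (x₀ d : ℕ → ℝ) (p : ℕ) :
    tableEntry n ℓ r a g x₀ d j p = tableEntry n ℓ r a g' x₀ d j p := by
  simp only [tableEntry, blockInner_congr hj h]

/-- The position on the tape runs along with the loop counter, so cell i holds the truncation of
tape entry i. -/
lemma exec_directionsCmd (s : State) (hs : s.pos = 0) :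
    (directionsCmd.exec ω s).pos = s.idx 3 * s.idx 3 * s.idx 1 ∧
    ∀ i < s.idx 3 * s.idx 3 * s.idx 1, (directionsCmd.exec ω s).mem 4 i =
      directions ω (level (s.idx 0) (s.idx 1) (s.mem 0 1)) i := by
  simp only [directionsCmd, Cmd.exec, IExp.eval]
  refine (iter_induction (I := fun j t => (t.pos = j ∧ ∀ i < j, t.mem 4 i =
      directions ω (level (s.idx 0) (s.idx 1) (s.mem 0 1)) i) ∧
    t.idx 0 = s.idx 0 ∧ t.idx 1 = s.idx 1 ∧ t.mem 0 1 = s.mem 0 1)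
    ⟨⟨hs, by simp⟩, by simp, by simp, by simp⟩ fun j _ t ⟨⟨h1, h2⟩, h3, h4, h5⟩ => ?_).1
  refine ⟨⟨by simp [h1], fun i hi => ?_⟩, by simp [h3], by simp [h4], by simp [h5]⟩
  simp only [State.setCell_mem, State.setIdx_idx, State.setIdx_mem, Function.update_self,
    eval_truncE, RExp.eval, IExp.eval, State.setCell_idx, State.setIdx_pos]
  by_cases hij : i = j
  · subst hij
    simp [h1, h3, h4, h5, directions]
  · rw [Function.update_of_ne hij, Function.update_of_ne hij, h2 i (by omega)]

lemma deterministic_tablesCmd : tablesCmd.Deterministic := by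
  simp [tablesCmd, lossCmd, innerCmd, sumLoop, Cmd.Deterministic]

lemma exec_tablesCmd (s : State) :
    (∀ j < s.idx 3 * s.idx 3, ∀ p < s.idx 3,
      (tablesCmd.exec ω s).mem 4 (s.idx 3 * s.idx 3 * s.idx 1 + (j * s.idx 3 + p)) =
        tableEntry (s.idx 0) (s.idx 1) (radius (s.idx 0) (s.idx 1) (s.mem 0 1)) (s.idx 3)
          (s.mem 4) (s.mem 1) (s.mem 2) j p) ∧
    ∀ i < s.idx 3 * s.idx 3 * s.idx 1, (tablesCmd.exec ω s).mem 4 i = s.mem 4 i := by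
  set m := s.idx 3 * s.idx 3 with hm
  set a := s.idx 3 with ha
  set ℓ := s.idx 1 with hℓ
  set T : ℕ → ℕ → ℝ := fun j p => tableEntry (s.idx 0) ℓ (radius (s.idx 0) ℓ (s.mem 0 1)) a
    (s.mem 4) (s.mem 1) (s.mem 2) j p with hT
  -- The part of the state that every pass reads and none changes. Array `4` is preserved only on
  -- the cells of the directions.
  let Fr : State → Prop := fun t => t.idx 0 = s.idx 0 ∧ t.idx 1 = s.idx 1 ∧ t.idx 3 = s.idx 3 ∧
    t.mem 0 = s.mem 0 ∧ t.mem 1 = s.mem 1 ∧ t.mem 2 = s.mem 2 ∧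
    ∀ i < m * ℓ, t.mem 4 i = s.mem 4 i
  have hfin : (∀ j' < m, ∀ p < a, (tablesCmd.exec ω s).mem 4 (m * ℓ + (j' * a + p)) = T j' p) ∧
      Fr (tablesCmd.exec ω s) := by
    simp only [tablesCmd, Cmd.exec, IExp.eval, ← ha, ← hm]
    refine iter_induction (I := fun j t => (∀ j' < j, ∀ p < a,
      t.mem 4 (m * ℓ + (j' * a + p)) = T j' p) ∧ Fr t)
      ⟨by simp, by simp [Fr]⟩ fun j hj t ⟨h1, h2⟩ => ?_
    have ht3 : (t.setIdx 4 j).idx 3 = a := by simp [h2.2.2.1, ha]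
    rw [ht3]
    have hin := iter_induction (f := fun t => ((lossCmd.exec ω t).setCell 4
        ((lossCmd.exec ω t).idx 3 * (lossCmd.exec ω t).idx 3 * (lossCmd.exec ω t).idx 1 +
          ((lossCmd.exec ω t).idx 4 * (lossCmd.exec ω t).idx 3 + (lossCmd.exec ω t).idx 5))
        (RExp.eval (lossCmd.exec ω t) ((RExp.cell 6 (IExp.lit 0)).div (RExp.ofIdx (IExp.reg 0))))))
      (i := 5) (s := t.setIdx 4 j) (N := a)
      (I := fun p u => (∀ j' < j, ∀ p' < a, u.mem 4 (m * ℓ + (j' * a + p')) = T j' p') ∧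
        (∀ p' < p, u.mem 4 (m * ℓ + (j * a + p')) = T j p') ∧ Fr u ∧ u.idx 4 = j)
      ⟨h1, by simp, by simpa [Fr] using h2, by simp⟩ ?_
    · refine ⟨fun j' hj' p hp => ?_, hin.2.2.1⟩
      rcases Nat.lt_succ_iff_lt_or_eq.mp hj' with h | rfl
      · exact hin.1 j' h p hp
      · exact hin.2.1 p hp
    · rintro p hp u ⟨g1, g2, ⟨f0, f1, f3, e0, e1, e2, e4⟩, g4⟩
      have hval : ((lossCmd.exec ω (u.setIdx 5 p)).mem 6 0) / ((s.idx 0 : ℕ) : ℝ) = T j p := by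
        rw [exec_lossCmd, hT]
        have k : ∀ r, r ≠ 5 → (u.setIdx 5 p).idx r = u.idx r := fun r hr => by
          rw [State.setIdx_idx, Function.update_of_ne hr]
        have k5 : (u.setIdx 5 p).idx 5 = p := by simp
        rw [k5, k 0 (by norm_num), k 1 (by norm_num), k 3 (by norm_num), k 4 (by norm_num),
          State.setIdx_mem, f0, f1, f3, e0, e1, e2, g4]
        exact tableEntry_congr hj e4 _ _ _ _ _
      have hidx : ∀ r, r ≠ 5 → r ≠ 6 → r ≠ 7 →
          (lossCmd.exec ω (u.setIdx 5 p)).idx r = u.idx r := fun r h5 h6 h7 => by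
        rw [Cmd.exec_idx ω _ (by simp [h6, h7]), State.setIdx_idx, Function.update_of_ne h5]
      have hmem : ∀ r, r ≠ 5 → r ≠ 6 →
          (lossCmd.exec ω (u.setIdx 5 p)).mem r = u.mem r := fun r h5 h6 => by
        rw [Cmd.exec_mem ω _ (by simp [h5, h6]), State.setIdx_mem]
      have hp5 : (lossCmd.exec ω (u.setIdx 5 p)).idx 5 = p := by
        rw [Cmd.exec_idx ω _ (by simp)]; simp
      simp only [RExp.eval, IExp.eval, hidx 0 (by norm_num) (by norm_num) (by norm_num),
        hidx 1 (by norm_num) (by norm_num) (by norm_num),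
        hidx 3 (by norm_num) (by norm_num) (by norm_num),
        hidx 4 (by norm_num) (by norm_num) (by norm_num), hp5, f0, f1, f3, g4, hval, ← ha, ← hm,
        ← hℓ]
      have hcell : ∀ i, ((lossCmd.exec ω (u.setIdx 5 p)).setCell 4 (m * ℓ + (j * a + p))
          (T j p)).mem 4 i = if i = m * ℓ + (j * a + p) then T j p else u.mem 4 i := by
        intro i
        simp only [State.setCell_mem, Function.update_self]
        rw [Function.update_apply, hmem 4 (by norm_num) (by norm_num)]
      refine ⟨fun j' hj' p' hp' => ?_, fun p' hp' => ?_, ⟨?_, ?_, ?_, ?_, ?_, ?_, ?_⟩, ?_⟩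
      · rw [hcell, if_neg, g1 j' hj' p' hp']
        -- An earlier row ends before row j begins: (j' + 1)a ≤ ja.
        have := Nat.mul_le_mul_right a (Nat.succ_le_of_lt hj')
        rw [Nat.succ_mul] at this
        omega
      · rw [hcell]
        rcases Nat.lt_succ_iff_lt_or_eq.mp hp' with h | rfl
        · rw [if_neg (by omega), g2 p' h]
        · simp
      · rw [State.setCell_idx, hidx 0 (by norm_num) (by norm_num) (by norm_num), f0]
      · rw [State.setCell_idx, hidx 1 (by norm_num) (by norm_num) (by norm_num), f1]
      · rw [State.setCell_idx, hidx 3 (by norm_num) (by norm_num) (by norm_num), f3]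
      · rw [State.setCell_mem, Function.update_of_ne (by norm_num),
          hmem 0 (by norm_num) (by norm_num), e0]
      · rw [State.setCell_mem, Function.update_of_ne (by norm_num),
          hmem 1 (by norm_num) (by norm_num), e1]
      · rw [State.setCell_mem, Function.update_of_ne (by norm_num),
          hmem 2 (by norm_num) (by norm_num), e2]
      · intro i hi
        rw [hcell, if_neg (by omega), e4 i hi]
      · rw [State.setCell_idx, hidx 4 (by norm_num) (by norm_num) (by norm_num), g4]
  exact ⟨hfin.1, hfin.2.2.2.2.2.2.2⟩

end DistanceRelease

namespace DistanceRelease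

open RealRAM

variable (ω : Tape)

/-- The memory contains everything needed to release `n` points in dimension `ℓ`. -/
structure Holds (n ℓ : ℕ) (ε β : ℝ) (x₀ d : ℕ → ℝ) (s : State) : Prop where
  points : s.idx 0 = n
  dim : s.idx 1 = ℓ
  eps : s.mem 0 0 = ε
  beta : s.mem 0 1 = β
  base : s.mem 1 = x₀
  data : s.mem 2 = d
  pos : s.pos = 0

/-- The data structure is complete up to the noise. -/
structure Prepared (n ℓ : ℕ) (ε β : ℝ) (x₀ d : ℕ → ℝ) (s : State) : Prop where
  offset : s.idx 9 = offset n ℓ ε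
  count : s.idx 8 = count n ℓ ε
  scale : s.mem 8 0 = noiseScale n ℓ ε β
  pos : s.pos = DistanceRelease.offset n ℓ ε
  entry : ∀ i < DistanceRelease.offset n ℓ ε + DistanceRelease.count n ℓ ε,
    s.mem 4 i = rawEntry ω n ℓ ε β x₀ d i

variable {n ℓ : ℕ} {ε β : ℝ} {x₀ d : ℕ → ℝ} {s : State}

lemma prepared_directRegime (hs : Holds n ℓ ε β x₀ d s) (hd : Direct n ℓ ε) :
    Prepared ω n ℓ ε β x₀ d (directRegime.exec ω s) := by
  have hl := iter_induction (f := fun t => (t.setCell 4 (t.idx 11) (t.mem 2 (t.idx 11)))) (i := 11)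
    (s := s) (N := n * ℓ) (I := fun j t => (∀ i < j, t.mem 4 i = d i) ∧ t.mem 2 = d ∧ t.idx 0 = n ∧
      t.idx 1 = ℓ ∧ t.mem 0 0 = ε ∧ t.pos = 0)
    ⟨by simp, hs.data, hs.points, hs.dim, hs.eps, hs.pos⟩ ?_
  · obtain ⟨h1, h2, h3, h4, h5, h6⟩ := hl
    simp only [directRegime, Cmd.exec, IExp.eval, RExp.eval, hs.points, hs.dim]
    set t := iter _ 11 s (n * ℓ)
    clear_value t
    refine ⟨by simp [offset, hd], by simp [count, hd, h3, h4],
      by simp [noiseScale, hd, h4, eval_epsE, h5], by simp [offset, hd, h6], fun i hi => ?_⟩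
    simp only [offset, hd, if_true, count, zero_add] at hi
    simp [rawEntry, hd, h1 i hi]
  · rintro j _ t ⟨h1, h2, h3, h4, h5, h6⟩
    refine ⟨fun i hi => ?_, by simp [h2], by simp [h3], by simp [h4], by simp [h5], by simp [h6]⟩
    simp only [State.setCell_mem, State.setIdx_idx, State.setIdx_mem, Function.update_self,
      Function.update_apply, h2]
    split_ifs with hij
    · rw [hij]
    · exact h1 i (by omega)

lemma prepared_tableRegime (hs : Holds n ℓ ε β x₀ d s) (hd : ¬ Direct n ℓ ε) :
    Prepared ω n ℓ ε β x₀ d (tableRegime.exec ω s) := by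
  simp only [tableRegime, Cmd.exec, IExp.eval, RExp.eval]
  have a3 := exec_searchCmd ω s
  have a0 := Cmd.exec_idx ω searchCmd (r := 0) (by simp) s
  have a1 := Cmd.exec_idx ω searchCmd (r := 1) (by simp) s
  have am : ∀ a, (searchCmd.exec ω s).mem a = s.mem a := fun a => Cmd.exec_mem ω _ (by simp) s
  have ap : (searchCmd.exec ω s).pos = s.pos := Cmd.Deterministic.exec_pos
    (by simp [searchCmd, Cmd.Deterministic]) ω s
  set s1 := searchCmd.exec ω s
  clear_value s1
  rw [hs.points, hs.dim, hs.eps] at a3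
  rw [hs.points] at a0
  rw [hs.dim] at a1
  rw [hs.pos] at ap
  obtain ⟨bp, b4⟩ := exec_directionsCmd ω s1 ap
  have b0 := Cmd.exec_idx ω directionsCmd (r := 0) (by simp) s1
  have b1 := Cmd.exec_idx ω directionsCmd (r := 1) (by simp) s1
  have b3 := Cmd.exec_idx ω directionsCmd (r := 3) (by simp) s1
  have bm0 := Cmd.exec_mem ω directionsCmd (a := 0) (by simp) s1
  have bm1 := Cmd.exec_mem ω directionsCmd (a := 1) (by simp) s1
  have bm2 := Cmd.exec_mem ω directionsCmd (a := 2) (by simp) s1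
  set s2 := directionsCmd.exec ω s1
  clear_value s2
  rw [a0, a1, a3, am 0, hs.beta] at b4
  rw [a1, a3] at bp
  rw [a0] at b0
  rw [a1] at b1
  rw [a3] at b3
  rw [am] at bm0 bm1 bm2
  obtain ⟨c4, c4'⟩ := exec_tablesCmd ω s2
  have c0 := Cmd.exec_idx ω tablesCmd (r := 0) (by simp) s2
  have c1 := Cmd.exec_idx ω tablesCmd (r := 1) (by simp) s2
  have c3 := Cmd.exec_idx ω tablesCmd (r := 3) (by simp) s2
  have cm0 := Cmd.exec_mem ω tablesCmd (a := 0) (by simp) s2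
  have cp := deterministic_tablesCmd.exec_pos ω s2
  set s3 := tablesCmd.exec ω s2
  clear_value s3
  rw [b0, b1, b3, bm0, bm1, bm2, hs.base, hs.data, hs.beta] at c4
  rw [b1, b3] at c4'
  rw [b0] at c0
  rw [b1] at c1
  rw [b3] at c3
  rw [bm0] at cm0
  rw [bp] at cp
  set a := resolution n ℓ ε with ha
  have hoff : offset n ℓ ε = a * a * ℓ := by simp [offset, hd, ha]
  have hcount : count n ℓ ε = a * a * a := by simp [count, hd, ha]
  refine ⟨by simp [hoff, c1, c3], by simp [hcount, c3], ?_, by simp [hoff, cp], fun i hi => ?_⟩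
  · simp [noiseScale, hd, eval_radiusE, eval_epsE, c0, c1, c3, cm0, hcount, hs.eps, hs.beta,
      Function.update]
  · simp only [rawEntry, hd, if_false]
    rw [hoff, hcount] at hi
    rw [hoff]
    simp only [State.setCell_mem, State.setIdx_mem]
    rw [Function.update_of_ne (by norm_num)]
    split_ifs with hlt
    · rw [c4' i hlt, b4 i hlt]
    · obtain ⟨q, rfl⟩ := Nat.exists_eq_add_of_le (not_lt.mp hlt)
      have hq : q < a * a * a := by omega
      have hapos : 0 < a := Nat.pos_of_ne_zero fun h => by simp [h] at hq
      have hdiv : q / a < a * a := (Nat.div_lt_iff_lt_mul hapos).mpr hq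
      have h4 := c4 (q / a) hdiv (q % a) (Nat.mod_lt _ hapos)
      rw [Nat.div_add_mod' q a] at h4
      rw [h4, Nat.add_sub_cancel_left, tables]
      exact tableEntry_congr hdiv b4 _ _ _ _ _

@[simp] lemma writesI_byRegime {c e : Cmd} {i : ℕ} :
    (byRegime c e).WritesI i ↔ c.WritesI i ∨ e.WritesI i := by simp [byRegime, Cmd.WritesI]
@[simp] lemma writesA_byRegime {c e : Cmd} {i : ℕ} :
    (byRegime c e).WritesA i ↔ c.WritesA i ∨ e.WritesA i := by simp [byRegime, Cmd.WritesA]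

lemma prepared_byRegime (hs : Holds n ℓ ε β x₀ d s) :
    Prepared ω n ℓ ε β x₀ d ((byRegime directRegime tableRegime).exec ω s) := by
  by_cases hd : Direct n ℓ ε
  · rw [exec_byRegime_of_lt]
    · exact prepared_directRegime ω hs hd
    · rw [hs.points, hs.dim, hs.eps]; exact hd
  · rw [exec_byRegime_of_not_lt]
    · exact prepared_tableRegime ω hs hd
    · rw [hs.points, hs.dim, hs.eps]; exact hd

/-- The Gaussian draws have consumed exactly `offset` entries, so the noise of cell i comes from
tape entry i. In the invariant the first `offset` + j cells are final and the remaining ones still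
raw. -/
lemma exec_noiseCmd (hs : Prepared ω n ℓ ε β x₀ d s) (i : ℕ) (hi : i < offset n ℓ ε + count n ℓ ε) :
    (noiseCmd.exec ω s).mem 4 i = release ω n ℓ ε β x₀ d i := by
  simp only [noiseCmd, Cmd.exec, IExp.eval, hs.count]
  have := iter_induction (s := s) (i := 11) (N := count n ℓ ε)
    (f := (Cmd.seq (.uniform 9 (.lit 0))
    (.setR 4 (.add (.reg 9) (.reg 11)) (.add (.cell 4 (.add (.reg 9) (.reg 11)))
      (.mul (.cell 8 (.lit 0))
        (.sub (.log (.cell 9 (.lit 0)))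
          (.log (.sub (.lit 1) (.cell 9 (.lit 0))))))))).exec ω)
    (I := fun j t => (∀ i < offset n ℓ ε + count n ℓ ε, t.mem 4 i =
      if i < offset n ℓ ε + j then release ω n ℓ ε β x₀ d i else rawEntry ω n ℓ ε β x₀ d i) ∧
      t.idx 9 = offset n ℓ ε ∧ t.mem 8 0 = noiseScale n ℓ ε β ∧ t.pos = offset n ℓ ε + j)
    ⟨fun i hi => ?_, hs.offset, hs.scale, by simp [hs.pos]⟩ ?_
  · have h := this.1 i hi
    rw [if_pos hi] at h
    exact h
  · rw [hs.entry i hi]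
    split_ifs with h
    · have : i < offset n ℓ ε := by omega
      simp [release, this]
    · rfl
  · rintro j hj t ⟨h1, h2, h3, h4⟩
    refine ⟨fun i hi => ?_, by simp [Cmd.exec, h2], by simp [Cmd.exec, h3],
      by simp [Cmd.exec, h4, add_assoc]⟩
    have e9 : (t.setIdx 11 j).idx 9 = offset n ℓ ε := by simp [h2]
    have e11 : (t.setIdx 11 j).idx 11 = j := by simp
    simp only [Cmd.exec, RExp.eval, IExp.eval, State.setCell_mem, State.setCell_idx, e9, e11,
      State.setIdx_mem, Function.update_self, State.setIdx_pos, h4]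
    rw [Function.update_of_ne (by norm_num : (4 : ℕ) ≠ 9),
      Function.update_of_ne (by norm_num : (8 : ℕ) ≠ 9), Function.update_apply, h3]
    by_cases hij : i = offset n ℓ ε + j
    · rw [if_pos hij, if_pos (by omega), ← hij, h1 i hi, if_neg (by omega), release,
        if_neg (by omega), if_pos hi]
      simp [logit]
    · rw [if_neg hij, h1 i hi]
      have : i < offset n ℓ ε + j ↔ i < offset n ℓ ε + (j + 1) := by omega
      simp only [this]

lemma exec_buildCmd (hs : Holds n ℓ ε β x₀ d s) :
    (buildCmd.exec ω s).idx 2 = offset n ℓ ε + count n ℓ ε ∧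
    ∀ i < offset n ℓ ε + count n ℓ ε,
      (buildCmd.exec ω s).mem 4 i = release ω n ℓ ε β x₀ d i := by
  have hp := prepared_byRegime ω hs
  simp only [buildCmd, Cmd.exec, IExp.eval, State.setIdx_idx, State.setIdx_mem,
    Function.update_self]
  rw [Cmd.exec_idx ω noiseCmd (by simp), Cmd.exec_idx ω noiseCmd (by simp), hp.offset, hp.count]
  exact ⟨rfl, exec_noiseCmd ω hp⟩

/-! ### The non-interactive mechanism -/

lemma holds_inputState {n ℓ : ℕ} {params : List ℝ} (x₀ : E ℓ) (D : Fin n → E ℓ) :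
    Holds n ℓ (params.getD 0 0) (params.getD 1 0) (pointArray x₀) (dataArray D)
      (inputState params x₀ D) := by
  constructor <;> simp [inputState, publicState]

section mechanisms

variable {n ℓ : ℕ} {params : List ℝ}

lemma synopsis_eq (x₀ : E ℓ) (D : Fin n → E ℓ) :
    nonInteractiveMechanism.synopsis params x₀ D ω =
      (offset n ℓ (params.getD 0 0) + count n ℓ (params.getD 0 0),
        release ω n ℓ (params.getD 0 0) (params.getD 1 0) (pointArray x₀) (dataArray D)) := by
  obtain ⟨h1, h2⟩ := exec_buildCmd ω (holds_inputState (params := params) x₀ D)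
  simp only [NonInteractive.synopsis, nonInteractiveMechanism, h1, Prod.mk.injEq, true_and]
  funext i
  split_ifs with hi
  · exact h2 i hi
  · rw [release, if_neg (by omega), if_neg hi]

lemma nonInteractive_reply_eq (x₀ : E ℓ) (z : ℕ × (ℕ → ℝ)) (y : E ℓ) :
    nonInteractiveMechanism.reply n params x₀ z y =
      answerOf n ℓ (params.getD 0 0) (params.getD 1 0) (pointArray x₀) z.2 (pointArray y) := by
  simp only [NonInteractive.reply, nonInteractiveMechanism, exec_answerCmd]
  simp [NonInteractive.queryState, publicState]

/-! ### The interactive mechanism -/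

/-- The memory needed to answer queries. -/
structure Serves (n ℓ : ℕ) (ε β : ℝ) (x₀ z : ℕ → ℝ) (s : State) : Prop where
  points : s.idx 0 = n
  dim : s.idx 1 = ℓ
  eps : s.mem 0 0 = ε
  beta : s.mem 0 1 = β
  base : s.mem 1 = x₀
  data : s.mem 2 = z

/-- Erasing the database first makes array `2` equal to the data structure also beyond its length,
where both are zero. No trace of the data remains where queries are answered from. -/
lemma exec_moveCmd {n ℓ L : ℕ} {z : ℕ → ℝ} {s : State} (h0 : s.idx 0 = n) (h1 : s.idx 1 = ℓ)
    (h2 : s.idx 2 = L) (hz : ∀ i < L, s.mem 4 i = z i) (hz' : ∀ i, L ≤ i → z i = 0)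
    (hd : ∀ i, n * ℓ ≤ i → s.mem 2 i = 0) : (moveCmd.exec ω s).mem 2 = z := by
  have hl := iter_induction (f := fun t => (t.setCell 2 (t.idx 11) ((0 : ℚ) : ℝ))) (i := 11)
    (s := s) (N := n * ℓ) (I := fun j t => (∀ i, i < j ∨ n * ℓ ≤ i → t.mem 2 i = 0) ∧
      t.idx 2 = L ∧ t.mem 4 = s.mem 4) ⟨by simpa using hd, h2, rfl⟩ ?_
  · simp only [moveCmd, Cmd.exec, IExp.eval, RExp.eval, h0, h1]
    set t := iter _ 11 s (n * ℓ)
    clear_value t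
    obtain ⟨g1, g2, g3⟩ := hl
    rw [g2]
    have hl2 := iter_induction (f := fun t => (t.setCell 2 (t.idx 13) (t.mem 4 (t.idx 13))))
      (i := 13) (s := t) (N := L) (I := fun j u => (∀ i, u.mem 2 i = if i < j then z i else 0) ∧
        u.mem 4 = s.mem 4) ⟨fun i => by simpa using g1 i (by omega), g3⟩ ?_
    · funext i
      rw [hl2.1 i]
      split_ifs with h
      · rfl
      · exact (hz' i (by omega)).symm
    · rintro j hj u ⟨k1, k2⟩
      refine ⟨fun i => ?_, by simp [k2]⟩
      simp only [State.setCell_mem, State.setIdx_idx, State.setIdx_mem, Function.update_self,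
        Function.update_apply, k2, k1]
      by_cases hij : i = j
      · subst hij
        simp [hz i hj]
      · have : i < j ↔ i < j + 1 := by omega
        simp only [hij, if_false, this]
  · rintro j _ t ⟨g1, g2, g3⟩
    refine ⟨fun i hi => ?_, by simp [g2], by simp [g3]⟩
    simp only [State.setCell_mem, State.setIdx_idx, State.setIdx_mem, Function.update_self,
      Function.update_apply]
    split_ifs with hij
    · simp
    · exact g1 i (by omega)

lemma buildCmd_writesI {i : ℕ} (h : i = 0 ∨ i = 1) : ¬ buildCmd.WritesI i := by
  rcases h with rfl | rfl <;> simp [buildCmd, directRegime, tableRegime, Cmd.WritesI]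

lemma buildCmd_writesA {a : ℕ} (h : a = 0 ∨ a = 1 ∨ a = 2) : ¬ buildCmd.WritesA a := by
  rcases h with rfl | rfl | rfl <;> simp [buildCmd, directRegime, tableRegime, Cmd.WritesA]

lemma moveCmd_writesI {i : ℕ} (h : i = 0 ∨ i = 1) : ¬ moveCmd.WritesI i := by
  rcases h with rfl | rfl <;> simp [moveCmd, Cmd.WritesI]

lemma moveCmd_writesA {a : ℕ} (h : a = 0 ∨ a = 1) : ¬ moveCmd.WritesA a := by
  rcases h with rfl | rfl <;> simp [moveCmd, Cmd.WritesA]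

/-- Answering a query writes neither the public input nor array `2`, so the memory prepared at the
beginning serves all queries. -/
lemma serves_session (x₀ : E ℓ) (D : Fin n → E ℓ) (A : Analyst ℓ) (t : ℕ) :
    Serves n ℓ (params.getD 0 0) (params.getD 1 0) (pointArray x₀)
      (release ω n ℓ (params.getD 0 0) (params.getD 1 0) (pointArray x₀) (dataArray D))
      (interactiveMechanism.session ω A (inputState params x₀ D) t).1 := by
  induction t with
  | zero =>
    have hs := holds_inputState (params := params) x₀ D
    obtain ⟨h1, h2⟩ := exec_buildCmd ω hs
    simp only [Interactive.session, interactiveMechanism, Cmd.exec]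
    have k0 := Cmd.exec_idx ω buildCmd (buildCmd_writesI (Or.inl rfl)) (inputState params x₀ D)
    have k1 := Cmd.exec_idx ω buildCmd (buildCmd_writesI (Or.inr rfl)) (inputState params x₀ D)
    have m0 := Cmd.exec_mem ω buildCmd (buildCmd_writesA (Or.inl rfl)) (inputState params x₀ D)
    have m1 := Cmd.exec_mem ω buildCmd (buildCmd_writesA (Or.inr (Or.inl rfl)))
      (inputState params x₀ D)
    have m2 := Cmd.exec_mem ω buildCmd (buildCmd_writesA (Or.inr (Or.inr rfl)))
      (inputState params x₀ D)
    constructor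
    · rw [Cmd.exec_idx ω moveCmd (moveCmd_writesI (by simp)), k0, hs.points]
    · rw [Cmd.exec_idx ω moveCmd (moveCmd_writesI (by simp)), k1, hs.dim]
    · rw [Cmd.exec_mem ω moveCmd (moveCmd_writesA (by simp)), m0, hs.eps]
    · rw [Cmd.exec_mem ω moveCmd (moveCmd_writesA (by simp)), m0, hs.beta]
    · rw [Cmd.exec_mem ω moveCmd (moveCmd_writesA (by simp)), m1, hs.base]
    · refine exec_moveCmd ω (k0.trans hs.points) (k1.trans hs.dim) h1 h2 (fun i hi => ?_)
        fun i hi => ?_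
      · rw [release, if_neg (by omega), if_neg (by omega)]
      · rw [m2, hs.data, dataArray, dif_neg (by omega)]
  | succ t ih =>
    simp only [Interactive.session]
    constructor
    · exact (Cmd.exec_idx ω answerCmd (by simp) _).trans ih.points
    · exact (Cmd.exec_idx ω answerCmd (by simp) _).trans ih.dim
    · exact (congrFun (Cmd.exec_mem ω answerCmd (a := 0) (by simp) _) 0).trans
        (by simpa using ih.eps)
    · exact (congrFun (Cmd.exec_mem ω answerCmd (a := 0) (by simp) _) 1).trans
        (by simpa using ih.beta)
    · exact (Cmd.exec_mem ω answerCmd (a := 1) (by simp) _).trans (by simpa using ih.base)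
    · exact (Cmd.exec_mem ω answerCmd (a := 2) (by simp) _).trans (by simpa using ih.data)

lemma interactive_session_succ (x₀ : E ℓ) (D : Fin n → E ℓ) (A : Analyst ℓ) (t : ℕ) :
    (interactiveMechanism.session ω A (inputState params x₀ D) (t + 1)).2 =
      Function.update (interactiveMechanism.session ω A (inputState params x₀ D) t).2 t
        (answerOf n ℓ (params.getD 0 0) (params.getD 1 0) (pointArray x₀)
          (release ω n ℓ (params.getD 0 0) (params.getD 1 0) (pointArray x₀) (dataArray D))
          (pointArray (interactiveMechanism.query ω A (inputState params x₀ D) t))) := by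
  have h := serves_session (params := params) ω x₀ D A t
  simp only [Interactive.session, Interactive.query]
  congr 1
  refine (exec_answerCmd ω _).trans ?_
  simp [h.points, h.dim, h.eps, h.beta, h.base, h.data]

lemma interactive_reply_eq (x₀ : E ℓ) (D : Fin n → E ℓ) (A : Analyst ℓ) (t : ℕ) :
    interactiveMechanism.reply ω A (inputState params x₀ D) t =
      answerOf n ℓ (params.getD 0 0) (params.getD 1 0) (pointArray x₀)
        (release ω n ℓ (params.getD 0 0) (params.getD 1 0) (pointArray x₀) (dataArray D))
        (pointArray (interactiveMechanism.query ω A (inputState params x₀ D) t)) := by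
  rw [Interactive.reply, interactive_session_succ, Function.update_self]

/-- Post-processing in pathwise form: equal releases give equal first answers, hence equal next
queries, and so on by induction. -/
lemma session_congr {ω ω' : Tape} {x₀ : E ℓ} {D D' : Fin n → E ℓ}
    (h : release ω n ℓ (params.getD 0 0) (params.getD 1 0) (pointArray x₀) (dataArray D) =
      release ω' n ℓ (params.getD 0 0) (params.getD 1 0) (pointArray x₀) (dataArray D'))
    (A : Analyst ℓ) (t : ℕ) :
    (interactiveMechanism.session ω A (inputState params x₀ D) t).2 =
      (interactiveMechanism.session ω' A (inputState params x₀ D') t).2 := by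
  induction t with
  | zero => simp only [Interactive.session]
  | succ t ih => rw [interactive_session_succ, interactive_session_succ, h, Interactive.query,
      Interactive.query, ih]

lemma transcript_congr {ω ω' : Tape} {x₀ : E ℓ} {D D' : Fin n → E ℓ}
    (h : release ω n ℓ (params.getD 0 0) (params.getD 1 0) (pointArray x₀) (dataArray D) =
      release ω' n ℓ (params.getD 0 0) (params.getD 1 0) (pointArray x₀) (dataArray D'))
    (A : Analyst ℓ) (k : ℕ) :
    interactiveMechanism.transcript k ω A (inputState params x₀ D) =
      interactiveMechanism.transcript k ω' A (inputState params x₀ D') := by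
  funext t
  simp only [Interactive.transcript, Interactive.query, Interactive.reply, session_congr h]

end mechanisms

/-! ### Running time -/

/-- Bounds on the registers, in terms of `S = n + ℓ`. -/
def registerBound (S i : ℕ) : ℕ :=
  if i ≤ 1 then S else if i = 12 then 2 * S else if i = 3 then 2 * S + 1
  else if i = 2 ∨ i = 13 then 2 * (2 * S + 1) ^ 3 else (2 * S + 1) ^ 3

lemma polyBounded_registerBound (i : ℕ) : PolyBounded fun S => registerBound S i := by
  have h2 : PolyBounded fun S => 2 * S := (PolyBounded.const 2).mul .id
  have h3 : PolyBounded fun S => 2 * S + 1 := h2.add (.const 1)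
  unfold registerBound
  split_ifs
  · exact .id
  · exact h2
  · exact h3
  · exact (PolyBounded.const 2).mul (h3.pow 3)
  · exact h3.pow 3

/-- The search loop has bound n + ℓ, statically at most 2S, so the resolution is at most 2S + 1.
Products of three such quantities account for the cube. -/
lemma respects_answerCmd (S : ℕ) : answerCmd.Respects (registerBound S) := by
  have h1 : S ≤ (2 * S + 1) ^ 3 := by
    rw [pow_succ]; nlinarith [Nat.one_le_pow 2 (2 * S + 1) (by omega)]
  have h2 : 2 * S + 1 ≤ (2 * S + 1) ^ 3 := Nat.le_self_pow (by norm_num) _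
  have h3 : (2 * S + 1) * (2 * S + 1) ≤ (2 * S + 1) ^ 3 := by
    rw [← sq]; exact Nat.pow_le_pow_right (by omega) (by norm_num)
  simp [answerCmd, byRegime, directAnswerCmd, tableAnswerCmd, sumLoop, searchCmd, innerCmd,
    locateCmd, Cmd.Respects, IExp.valueBound, registerBound, h1, h2, h3]
  omega

lemma respects_initCmd (S : ℕ) : (Cmd.seq buildCmd moveCmd).Respects (registerBound S) := by
  have h1 : S ≤ (2 * S + 1) ^ 3 := by
    rw [pow_succ]; nlinarith [Nat.one_le_pow 2 (2 * S + 1) (by omega)]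
  have h2 : 2 * S + 1 ≤ (2 * S + 1) ^ 3 := Nat.le_self_pow (by norm_num) _
  have h3 : (2 * S + 1) * (2 * S + 1) ≤ (2 * S + 1) ^ 3 := by
    rw [← sq]; exact Nat.pow_le_pow_right (by omega) (by norm_num)
  have h4 : (2 * S + 1) * (2 * S + 1) * S ≤ (2 * S + 1) ^ 3 := by
    rw [show (2 * S + 1) ^ 3 = (2 * S + 1) * (2 * S + 1) * (2 * S + 1) by ring]
    exact Nat.mul_le_mul_left _ (by omega)
  have h5 : S * S ≤ (2 * S + 1) ^ 3 := (Nat.mul_le_mul (by omega) (by omega)).trans h3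
  have h6 : (2 * S + 1) * (2 * S + 1) * (2 * S + 1) ≤ (2 * S + 1) ^ 3 := by
    rw [show (2 * S + 1) ^ 3 = (2 * S + 1) * (2 * S + 1) * (2 * S + 1) by ring]
  simp [buildCmd, moveCmd, byRegime, directRegime, tableRegime, noiseCmd, directionsCmd, tablesCmd,
    lossCmd, sumLoop, searchCmd, innerCmd, Cmd.Respects, IExp.valueBound, registerBound, h1, h2, h3,
    h4, h5, h6]
  omega

end DistanceRelease

namespace DistanceRelease

open RealRAM

/-! ### Elementary estimates -/

lemma abs_trunc_le {b : ℝ} (hb : 0 ≤ b) (x : ℝ) : |trunc b x| ≤ b := by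
  have h := abs_abs_sub_abs_le (x + b) (x - b)
  rw [show x + b - (x - b) = 2 * b by ring, abs_of_nonneg (by linarith : 0 ≤ 2 * b)] at h
  rw [trunc, abs_div, abs_of_pos (by norm_num : (0 : ℝ) < 2)]
  linarith

lemma trunc_of_abs_le {b x : ℝ} (h : |x| ≤ b) : trunc b x = x := by
  obtain ⟨h1, h2⟩ := abs_le.mp h
  rw [trunc, abs_of_nonneg (by linarith), abs_of_nonpos (by linarith)]
  ring

lemma level_ge {n ℓ : ℕ} {β : ℝ} (h0 : 0 < β) (h1 : β < 1) : 4 ≤ level n ℓ β := by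
  have h2 : 0 ≤ Real.log ((n + ℓ : ℕ) : ℝ) := Real.log_natCast_nonneg _
  have h3 := Real.log_neg h0 h1
  rw [level]; linarith

lemma radius_pos {n ℓ : ℕ} {β : ℝ} (hℓ : 1 ≤ ℓ) (h0 : 0 < β) (h1 : β < 1) :
    0 < radius n ℓ β := by
  have : (0 : ℝ) < ℓ := by exact_mod_cast hℓ
  have := level_ge (n := n) (ℓ := ℓ) h0 h1
  unfold radius
  positivity

lemma sum_abs_le_sqrt_mul_norm {ℓ : ℕ} (v : E ℓ) : ∑ c, |v c| ≤ √(ℓ : ℝ) * ‖v‖ := by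
  rw [EuclideanSpace.norm_eq, ← Real.sqrt_mul (Nat.cast_nonneg _)]
  refine Real.le_sqrt_of_sq_le ?_
  have := sq_sum_le_card_mul_sum_sq (s := Finset.univ) (f := fun c => |v c|)
  simpa using this

lemma abs_sum_mul_le {ℓ : ℕ} {b : ℝ} (hb : 0 ≤ b) {g : Fin ℓ → ℝ} (hg : ∀ c, |g c| ≤ b) (v : E ℓ) :
    |∑ c, g c * v c| ≤ b * √(ℓ : ℝ) * ‖v‖ := by
  calc |∑ c, g c * v c| ≤ ∑ c, |g c * v c| := Finset.abs_sum_le_sum_abs _ _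
    _ ≤ ∑ c, b * |v c| := Finset.sum_le_sum fun c _ => by
        rw [abs_mul]; exact mul_le_mul_of_nonneg_right (hg c) (abs_nonneg _)
    _ = b * ∑ c, |v c| := by rw [Finset.mul_sum]
    _ ≤ b * (√(ℓ : ℝ) * ‖v‖) := mul_le_mul_of_nonneg_left (sum_abs_le_sqrt_mul_norm v) hb
    _ = _ := by ring

lemma dataArray_block {n ℓ : ℕ} (D : Fin n → E ℓ) (i : Fin n) (c : Fin ℓ) :
    dataArray D (i * ℓ + c) = D i c := by
  have h : finProdFinEquiv (i, c) = ⟨i * ℓ + c, by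
      have := Nat.mul_le_mul_right ℓ (Nat.succ_le_of_lt i.2)
      rw [Nat.succ_mul] at this
      omega⟩ := by
    ext; simp [finProdFinEquiv]; ring
  rw [dataArray, dif_pos (by
      have := Nat.mul_le_mul_right ℓ (Nat.succ_le_of_lt i.2)
      rw [Nat.succ_mul] at this
      omega), ← h]
  simp

lemma blockInner_pointArray {ℓ : ℕ} (g : ℕ → ℝ) (x₀ y : E ℓ) (j : ℕ) :
    blockInner ℓ g (pointArray x₀) (pointArray y) j = ∑ c : Fin ℓ, g (j * ℓ + c) * (y - x₀) c := by
  rw [blockInner, Finset.sum_range]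
  simp [pointArray]

lemma blockInner_dataArray {n ℓ : ℕ} (g : ℕ → ℝ) (x₀ : E ℓ) (D : Fin n → E ℓ) (i : Fin n) (j : ℕ) :
    blockInner ℓ g (pointArray x₀) (fun c => dataArray D (i * ℓ + c)) j =
      ∑ c : Fin ℓ, g (j * ℓ + c) * (D i - x₀) c := by
  rw [blockInner, Finset.sum_range]
  simp [pointArray, dataArray_block]

lemma Adjacent.exists_eq_off {ℓ n : ℕ} (hn : 1 ≤ n) {D D' : Fin n → E ℓ} (h : Adjacent D D') :
    ∃ i₀, ∀ i, i ≠ i₀ → D i = D' i := by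
  have : Nonempty (Fin n) := ⟨⟨0, hn⟩⟩
  obtain ⟨i₀, hi⟩ := (Set.ncard_le_one_iff_subset_singleton (Set.toFinite _)).mp h
  refine ⟨i₀, fun i hne => ?_⟩
  by_contra hD
  exact hne (hi hD)

/-! ### Privacy -/

variable {n ℓ : ℕ} {ε β : ℝ}

/-- Only one summand changes, and by at most |⟨g, D i₀ - D' i₀⟩|. Because the Gaussians are
truncated, this sensitivity bound holds on every tape, and no exceptional event has to be charged to
δ. -/
lemma abs_tableEntry_sub_le {b : ℝ} (hb : 0 ≤ b) {g : ℕ → ℝ} (hg : ∀ i, |g i| ≤ b) (x₀ : E ℓ)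
    {D D' : Fin n → E ℓ} (hd : ∀ i, dist (D i) (D' i) ≤ 1) {i₀ : Fin n}
    (h : ∀ i, i ≠ i₀ → D i = D' i) (r : ℝ) (a j p : ℕ) :
    |tableEntry n ℓ r a g (pointArray x₀) (dataArray D) j p -
      tableEntry n ℓ r a g (pointArray x₀) (dataArray D') j p| ≤ b * √(ℓ : ℝ) / n := by
  rw [tableEntry, tableEntry, ← sub_div, abs_div, Nat.abs_cast]
  refine div_le_div_of_nonneg_right ?_ (Nat.cast_nonneg _)
  simp only [Finset.sum_range, blockInner_dataArray]
  rw [← Finset.sum_sub_distrib, Finset.sum_eq_single i₀]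
  · refine (abs_abs_sub_abs_le _ _).trans ?_
    have e : (∑ c : Fin ℓ, g (j * ℓ + c) * (D i₀ - x₀) c) - gridPoint r a p -
        ((∑ c : Fin ℓ, g (j * ℓ + c) * (D' i₀ - x₀) c) - gridPoint r a p) =
        ∑ c : Fin ℓ, g (j * ℓ + c) * (D i₀ - D' i₀) c := by
      rw [sub_sub_sub_cancel_right, ← Finset.sum_sub_distrib]
      refine Finset.sum_congr rfl fun c _ => ?_
      simp only [PiLp.sub_apply]; ring
    rw [e]
    refine (abs_sum_mul_le hb (fun c => hg _) _).trans ?_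
    rw [← dist_eq_norm]
    exact mul_le_of_le_one_right (by positivity) (hd i₀)
  · intro i _ hi
    rw [h i hi, sub_self]
  · simp

lemma measurable_rawEntry (n ℓ : ℕ) (ε β : ℝ) (x₀ d : ℕ → ℝ) (i : ℕ) :
    Measurable fun ω => rawEntry ω n ℓ ε β x₀ d i := by
  have habs : ∀ f : Tape → ℝ, Measurable f → Measurable fun ω => |f ω| := fun f hf => hf.norm
  have hdir : ∀ b i, Measurable fun ω => directions ω b i := by
    intro b i
    unfold directions trunc
    exact ((habs _ (by fun_prop)).sub (habs _ (by fun_prop))).div_const _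
  unfold rawEntry
  split_ifs
  · exact measurable_const
  · exact hdir _ _
  · unfold tables tableEntry blockInner
    refine Measurable.div_const (Finset.measurable_fun_sum _ fun k _ => habs _ ?_) _
    exact (Finset.measurable_fun_sum _ fun c _ => (hdir _ _).mul_const _).sub_const _

/-- Before noise, the data structure depends only on Gaussian components ahead of the noise block.
Hence the compensating shifts may be computed from it. -/
lemma rawEntry_congr {ω ω' : Tape} (h : ∀ i < offset n ℓ ε, (ω i).2 = (ω' i).2) (x₀ d : ℕ → ℝ)
    {i : ℕ} (hi : i < offset n ℓ ε + count n ℓ ε) :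
    rawEntry ω n ℓ ε β x₀ d i = rawEntry ω' n ℓ ε β x₀ d i := by
  unfold rawEntry
  split_ifs with hd hlt
  · rfl
  · rw [directions, directions, h i hlt]
  · simp only [offset, count, hd, if_false] at h hi hlt ⊢
    set a := resolution n ℓ ε
    have hq : i - a * a * ℓ < a * a * a := by omega
    have hapos : 0 < a := Nat.pos_of_ne_zero fun h => by simp [h] at hq
    refine tableEntry_congr ((Nat.div_lt_iff_lt_mul hapos).mpr hq) (fun k hk => ?_) _ _ _ _ _
    rw [directions, directions, h k hk]

/-- The change of the log-odds on the tape that compensates for a change of the database. -/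
noncomputable def compensation (n ℓ : ℕ) (ε β : ℝ) (x₀ d d' : ℕ → ℝ) (p : ℕ) (ω : Tape) : ℝ :=
  if p < count n ℓ ε then
    (rawEntry ω n ℓ ε β x₀ d (offset n ℓ ε + p) - rawEntry ω n ℓ ε β x₀ d' (offset n ℓ ε + p)) /
      noiseScale n ℓ ε β
  else 0

lemma noiseScale_pos (hn : 1 ≤ n) (hℓ : 1 ≤ ℓ) (hε : 0 < ε) (h0 : 0 < β) (h1 : β < 1)
    (hc : 0 < count n ℓ ε) : 0 < noiseScale n ℓ ε β := by
  have hn' : (0 : ℝ) < n := by exact_mod_cast hn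
  have hℓ' : (0 : ℝ) < ℓ := by exact_mod_cast hℓ
  have hc' : (0 : ℝ) < count n ℓ ε := by exact_mod_cast hc
  have := radius_pos (n := n) hℓ h0 h1
  unfold noiseScale
  split_ifs <;> positivity

/-- The shift moves each noise term by exactly the difference of the raw entries, and it does not
touch the Gaussian components, hence not the directions. The identity holds for every tape, even at
uniform samples 0 and 1, because `logit_shiftU` does. -/
lemma release_shiftBlock (hn : 1 ≤ n) (hℓ : 1 ≤ ℓ) (hε : 0 < ε) (h0 : 0 < β) (h1 : β < 1)
    {x₀ d d' : ℕ → ℝ} (ω : Tape) :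
    release ω n ℓ ε β x₀ d = release (shiftBlock (offset n ℓ ε) (count n ℓ ε)
      (compensation n ℓ ε β x₀ d d') ω) n ℓ ε β x₀ d' := by
  set ω' := shiftBlock (offset n ℓ ε) (count n ℓ ε) (compensation n ℓ ε β x₀ d d') ω with hω'
  have hg : ∀ i, (ω i).2 = (ω' i).2 := by
    intro i
    rw [hω', shiftBlock]
    split_ifs <;> rfl
  funext i
  unfold release
  split_ifs with hi hi2
  · have hd : ¬ Direct n ℓ ε := fun h => by simp [offset, h] at hi
    simp only [rawEntry, hd, if_false, hi, if_true, directions, hg i]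
  · obtain ⟨p, rfl⟩ := Nat.exists_eq_add_of_le (not_lt.mp hi)
    have hp : p < count n ℓ ε := by omega
    have hσ := noiseScale_pos hn hℓ hε h0 h1 (by omega)
    have hl : logit (ω' (offset n ℓ ε + p)).1 = logit (ω (offset n ℓ ε + p)).1 +
        compensation n ℓ ε β x₀ d d' p ω := by
      rw [hω', shiftBlock, if_pos ⟨by omega, by omega⟩, Nat.add_sub_cancel_left]
      exact logit_shiftU _ _
    rw [hl, ← rawEntry_congr (fun i _ => hg i) x₀ d' hi2, compensation, if_pos hp]
    field_simp
    ring
  · rfl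

/-- The privacy budget. For noisy points only the ℓ coordinates of one point change, each by at most
1, which costs ε/ℓ apiece at noise scale ℓ/ε. For tables every entry may change by r/n, which costs
ε divided by the number of entries. -/
lemma tapeLaw_compensation_le (hn : 1 ≤ n) (hℓ : 1 ≤ ℓ) (hε : 0 < ε) (h0 : 0 < β) (h1 : β < 1)
    (x₀ : E ℓ) {D D' : Fin n → E ℓ} (hd : ∀ i, dist (D i) (D' i) ≤ 1) (hadj : Adjacent D D')
    (S : Set Tape) :
    tapeLaw (shiftBlock (offset n ℓ ε) (count n ℓ ε)
      (compensation n ℓ ε β (pointArray x₀) (dataArray D) (dataArray D')) ⁻¹' S) ≤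
      ENNReal.ofReal (Real.exp ε) * tapeLaw S := by
  obtain ⟨i₀, hi₀⟩ := hadj.exists_eq_off hn
  have hn' : (0 : ℝ) < n := by exact_mod_cast hn
  have hℓ' : (0 : ℝ) < ℓ := by exact_mod_cast hℓ
  have hR := radius_pos (n := n) hℓ h0 h1
  suffices h : ∃ b : ℕ → ℝ, (∀ p < count n ℓ ε, ∀ ω,
      |compensation n ℓ ε β (pointArray x₀) (dataArray D) (dataArray D') p ω| ≤ b p) ∧
      ∑ p ∈ Finset.range (count n ℓ ε), b p ≤ ε by
    obtain ⟨b, hb, hsum⟩ := h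
    refine (tapeLaw_shiftBlock_preimage_le _ _ (fun p => ?_) (fun p ω ω' h => ?_) hb S).trans
      (mul_le_mul_left (ENNReal.ofReal_le_ofReal (Real.exp_le_exp.mpr hsum)) _)
    · unfold compensation
      split_ifs
      · exact ((measurable_rawEntry ..).sub (measurable_rawEntry ..)).div_const _
      · exact measurable_const
    · unfold compensation
      split_ifs with hp
      · have h' : ∀ i < offset n ℓ ε, (ω i).2 = (ω' i).2 := fun i hi => by rw [h i hi]
        rw [rawEntry_congr h' _ _ (by omega), rawEntry_congr h' _ _ (by omega)]
      · rfl
  by_cases hD : Direct n ℓ ε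
  · refine ⟨fun p => if p ∈ Finset.Ico (i₀ * ℓ) (i₀ * ℓ + ℓ) then ε / ℓ else 0,
      fun p hp ω => ?_, ?_⟩
    · simp only [compensation, hp, if_true, rawEntry, hD, offset, zero_add, noiseScale]
      simp only [count, hD, if_true] at hp
      have hdiv : p / ℓ < n := (Nat.div_lt_iff_lt_mul hℓ).mpr hp
      have hp' : p = ((⟨p / ℓ, hdiv⟩ : Fin n) : ℕ) * ℓ +
          ((⟨p % ℓ, Nat.mod_lt _ hℓ⟩ : Fin ℓ) : ℕ) := (Nat.div_add_mod' p ℓ).symm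
      split_ifs with hmem
      · rw [abs_div, abs_of_pos (by positivity : (0 : ℝ) < ℓ / ε), div_le_iff₀ (by positivity)]
        have : ε / ℓ * (ℓ / ε) = 1 := by field_simp
        rw [this]
        conv_lhs => rw [hp', dataArray_block, dataArray_block]
        refine le_trans ?_ (hd ⟨p / ℓ, hdiv⟩)
        rw [dist_eq_norm, ← Real.norm_eq_abs]
        exact PiLp.norm_apply_le (D ⟨p / ℓ, hdiv⟩ - D' ⟨p / ℓ, hdiv⟩) _
      · have hne : (⟨p / ℓ, hdiv⟩ : Fin n) ≠ i₀ := by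
          rintro rfl
          apply hmem
          rw [Finset.mem_Ico]
          have := Nat.mod_lt p hℓ
          simp only at hp' ⊢
          omega
        conv_lhs => rw [hp', dataArray_block, dataArray_block, hi₀ _ hne]
        simp
    · rw [← Finset.sum_filter]
      simp only [Finset.sum_const, nsmul_eq_mul]
      have hcard : (Finset.filter (fun p => p ∈ Finset.Ico (i₀ * ℓ) (i₀ * ℓ + ℓ))
          (Finset.range (count n ℓ ε))).card ≤ ℓ := by
        calc _ ≤ (Finset.Ico (i₀ * ℓ) (i₀ * ℓ + ℓ)).card :=
              Finset.card_le_card fun p hp => (Finset.mem_filter.mp hp).2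
          _ = ℓ := by simp
      calc _ ≤ (ℓ : ℝ) * (ε / ℓ) := by
            refine mul_le_mul_of_nonneg_right ?_ (by positivity)
            exact_mod_cast hcard
        _ = ε := by field_simp
  · refine ⟨fun _ => ε / count n ℓ ε, fun p hp ω => ?_, ?_⟩
    · have hc' : (0 : ℝ) < count n ℓ ε := by exact_mod_cast (by omega : 0 < count n ℓ ε)
      have hσ := noiseScale_pos hn hℓ hε h0 h1 (by omega)
      rw [compensation, if_pos hp, abs_div, abs_of_pos hσ, div_le_iff₀ hσ]
      have hlev := level_ge (n := n) (ℓ := ℓ) h0 h1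
      have e : ε / count n ℓ ε * noiseScale n ℓ ε β = level n ℓ β * √(ℓ : ℝ) / n := by
        rw [noiseScale, if_neg hD, radius]
        field_simp
      rw [e]
      simp only [rawEntry, hD, if_false, add_lt_iff_neg_left, not_lt_zero, Nat.add_sub_cancel_left,
        tables]
      exact abs_tableEntry_sub_le (by linarith) (fun i => abs_trunc_le (by linarith) _) x₀ hd hi₀
        _ _ _ _
    · rcases Nat.eq_zero_or_pos (count n ℓ ε) with hc | hc
      · simp [hc, hε.le]
      · have hc' : (0 : ℝ) < count n ℓ ε := by exact_mod_cast hc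
        simp only [Finset.sum_const, Finset.card_range, nsmul_eq_mul]
        exact le_of_eq (by field_simp)

/-- The event for D is contained in the preimage, under the compensating shift, of the event for D'.
-/
lemma diffPrivate_of_release (hn : 1 ≤ n) (hℓ : 1 ≤ ℓ) (hε : 0 < ε) (h0 : 0 < β) (h1 : β < 1)
    {X : Set (E ℓ)} (hX : ∀ x ∈ X, ∀ y ∈ X, dist x y ≤ 1) (x₀ : E ℓ) {T : Type*}
    [MeasurableSpace T] {out : (Fin n → E ℓ) → Tape → T}
    (hout : ∀ D D' ω ω', release ω n ℓ ε β (pointArray x₀) (dataArray D) =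
      release ω' n ℓ ε β (pointArray x₀) (dataArray D') → out D ω = out D' ω')
    (δ : ℝ) : DiffPrivate X out ε δ := by
  intro D D' hD hD' hadj S _
  refine le_trans ?_ (le_self_add)
  refine le_trans (measure_mono fun ω hω => ?_) (tapeLaw_compensation_le hn hℓ hε h0 h1 x₀
    (fun i => hX _ (hD i) _ (hD' i)) hadj {ω | out D' ω ∈ S})
  have := hout D D' ω _ (release_shiftBlock hn hℓ hε h0 h1 (d' := dataArray D') ω)
  simp only [Set.mem_preimage, Set.mem_ofPred_eq, ← this]
  exact hω

lemma nonInteractive_private {params : List ℝ} (hn : 1 ≤ n) (hℓ : 1 ≤ ℓ)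
    (hε : 0 < params.getD 0 0) (h0 : 0 < params.getD 1 0) (h1 : params.getD 1 0 < 1)
    {X : Set (E ℓ)} (hX : ∀ x ∈ X, ∀ y ∈ X, dist x y ≤ 1) (x₀ : E ℓ) (δ : ℝ) :
    nonInteractiveMechanism.Private n params X x₀ (params.getD 0 0) δ :=
  diffPrivate_of_release hn hℓ hε h0 h1 hX x₀ (fun D D' ω ω' h => by
    rw [synopsis_eq, synopsis_eq, h]) δ

lemma interactive_private {params : List ℝ} (hn : 1 ≤ n) (hℓ : 1 ≤ ℓ)
    (hε : 0 < params.getD 0 0) (h0 : 0 < params.getD 1 0) (h1 : params.getD 1 0 < 1)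
    {X : Set (E ℓ)} (hX : ∀ x ∈ X, ∀ y ∈ X, dist x y ≤ 1) (x₀ : E ℓ) (k : ℕ) (δ : ℝ) :
    interactiveMechanism.Private n k params X x₀ (params.getD 0 0) δ := fun A _ =>
  diffPrivate_of_release hn hℓ hε h0 h1 hX x₀ (fun _ _ _ _ h => transcript_congr h A k) δ

/-! ### Running time of the mechanisms -/

lemma inputState_le {params : List ℝ} (x₀ : E ℓ) (D : Fin n → E ℓ) (i : ℕ) :
    (inputState params x₀ D).idx i ≤ registerBound (n + ℓ) i := by
  simp only [inputState, publicState, State.setArray_idx, registerBound]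
  split_ifs <;> omega

lemma exists_timeBound : ∃ c : ℕ, ∀ (n ℓ : ℕ) (params : List ℝ) (X : Set (E ℓ)) (x₀ : E ℓ),
    1 ≤ n + ℓ → nonInteractiveMechanism.TimeBound n params X x₀ (c * (n + ℓ) ^ c) ∧
      ∀ k, interactiveMechanism.TimeBound n k params X x₀ (c * (n + ℓ) ^ c) := by
  obtain ⟨c, hc⟩ := ((polyBounded_timeBound polyBounded_registerBound
    (Cmd.seq buildCmd moveCmd)).add (polyBounded_registerBound 2)).add
    (polyBounded_timeBound polyBounded_registerBound answerCmd)
  refine ⟨c, fun n ℓ params X x₀ hpos => ⟨fun D hD ω => ?_, fun k D hD A hA ω => ?_⟩⟩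
  · have hb := hc (n + ℓ) hpos
    beta_reduce at hb
    have hr := respects_initCmd (n + ℓ)
    obtain ⟨t1, t2⟩ := Cmd.time_le ω hr.1 (inputState_le (params := params) x₀ D)
    have hle : buildCmd.timeBound (registerBound (n + ℓ)) ≤
      (Cmd.seq buildCmd moveCmd).timeBound (registerBound (n + ℓ)) := Nat.le_add_right _ _
    have hlen : (nonInteractiveMechanism.synopsis params x₀ D ω).1 ≤ registerBound (n + ℓ) 2 :=
      t2 2
    refine ⟨le_trans (Nat.add_le_add t1 hlen) (by omega), fun y _ => ?_⟩
    refine (Cmd.time_le _ (respects_answerCmd (n + ℓ)) fun i => ?_).1.trans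
      (by omega : answerCmd.timeBound (registerBound (n + ℓ)) ≤ c * (n + ℓ) ^ c)
    simp only [NonInteractive.queryState, State.setArray_idx, State.setIdx_idx,
      Function.update_apply]
    split_ifs with hi
    · rw [hi]; exact hlen
    · exact inputState_le (params := params) x₀ D i
  · have hb := hc (n + ℓ) hpos
    beta_reduce at hb
    obtain ⟨t1, t2⟩ := Cmd.time_le ω (respects_initCmd (n + ℓ))
      (inputState_le (params := params) x₀ D)
    refine ⟨t1.trans (by omega), fun t _ => ?_⟩
    have hans : interactiveMechanism.answer = answerCmd := rfl
    have hreg : ∀ t i, (interactiveMechanism.session ω A (inputState params x₀ D) t).1.idx i ≤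
        registerBound (n + ℓ) i := by
      intro t
      induction t with
      | zero => exact t2
      | succ t ih =>
        simp only [Interactive.session, hans]
        exact (Cmd.time_le ω (respects_answerCmd (n + ℓ))
          (by simpa only [State.setArray_idx] using ih)).2
    rw [hans]
    exact (Cmd.time_le _ (respects_answerCmd (n + ℓ))
      (by simpa only [State.setArray_idx] using hreg t)).1.trans
      (by omega : answerCmd.timeBound (registerBound (n + ℓ)) ≤ c * (n + ℓ) ^ c)

end DistanceRelease

namespace DistanceRelease

open RealRAM

/-! ### Accuracy: deterministic part -/

lemma resolutionSearch_spec (x : ℝ) (N : ℕ) : resolutionSearch x N ≤ N ∧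
    (∀ i < N, resolutionSearch x N ≤ i → x ≤ (i : ℝ) ^ 4) ∧
    (resolutionSearch x N = 0 ∨ ∃ i, resolutionSearch x N = i + 1 ∧ (i : ℝ) ^ 4 < x) := by
  induction N with
  | zero => simp [resolutionSearch]
  | succ N ih =>
    obtain ⟨h1, h2, h3⟩ := ih
    have e : ((N * N * (N * N) : ℕ) : ℝ) = (N : ℝ) ^ 4 := by push_cast; ring
    rw [resolutionSearch, e]
    split_ifs with h
    · exact ⟨le_rfl, fun i hi hle => by omega, Or.inr ⟨N, rfl, h⟩⟩
    · refine ⟨by omega, fun i hi hle => ?_, h3⟩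
      rcases Nat.lt_succ_iff_lt_or_eq.mp hi with h4 | rfl
      · exact h2 i h4 hle
      · exact not_lt.mp h

/-- The search returns the fourth root of nε rounded up, capped at n + ℓ. For ε ≤ nℓ² the cap does
no harm, since nε ≤ (nℓ)² ≤ (n + ℓ)⁴. The factor 16 pays for rounding up: (i + 1)⁴ ≤ (2i)⁴ for i ≥
1. -/
lemma resolution_spec {n ℓ : ℕ} {ε : ℝ} (hn : 1 ≤ n) (hε : 0 < ε)
    (hd : ¬ Direct n ℓ ε) : 1 ≤ resolution n ℓ ε ∧ resolution n ℓ ε ≤ n + ℓ ∧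
      n * ε ≤ (resolution n ℓ ε : ℝ) ^ 4 ∧
      (1 ≤ n * ε → (resolution n ℓ ε : ℝ) ^ 4 ≤ 16 * (n * ε)) := by
  have hn' : (0 : ℝ) < n := by exact_mod_cast hn
  have hN : 0 < n * ε := by positivity
  obtain ⟨h1, h2, h3⟩ := resolutionSearch_spec (n * ε) (n + ℓ)
  change resolution n ℓ ε ≤ _ at h1
  change ∀ i < n + ℓ, resolution n ℓ ε ≤ i → _ at h2
  change resolution n ℓ ε = 0 ∨ ∃ i, resolution n ℓ ε = i + 1 ∧ _ at h3
  set a := resolution n ℓ ε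
  have hapos : 1 ≤ a := by
    rcases h3 with h | ⟨i, h, _⟩
    · have := h2 0 (by omega) (by omega)
      norm_num at this
      linarith
    · omega
  refine ⟨hapos, h1, ?_, fun h1N => ?_⟩
  · rcases Nat.lt_or_ge a (n + ℓ) with h | h
    · exact h2 a h le_rfl
    · have ha : (a : ℝ) = n + ℓ := by exact_mod_cast le_antisymm h1 h
      rw [Direct, not_lt] at hd
      push_cast at hd
      rw [ha]
      have hℓ0 : (0 : ℝ) ≤ ℓ := Nat.cast_nonneg _
      have h5 : (n : ℝ) * ε ≤ (n * ℓ) ^ 2 := by nlinarith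
      have h6 : (n : ℝ) * ℓ ≤ (n + ℓ) ^ 2 := by nlinarith
      calc (n : ℝ) * ε ≤ (n * ℓ) ^ 2 := h5
        _ ≤ ((n + ℓ) ^ 2) ^ 2 := by gcongr
        _ = _ := by ring
  · rcases h3 with h | ⟨i, h, hi⟩
    · omega
    · rw [h]
      push_cast
      rcases Nat.eq_zero_or_pos i with rfl | hi0
      · norm_num; linarith
      · have : (1 : ℝ) ≤ i := by exact_mod_cast hi0
        calc ((i : ℝ) + 1) ^ 4 ≤ (2 * i) ^ 4 := by gcongr; linarith
          _ = 16 * (i : ℝ) ^ 4 := by ring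
          _ ≤ _ := by linarith

lemma gridIndex_spec {r w : ℝ} {a : ℕ} (ha : 1 ≤ a) (h1 : -r ≤ w) (h2 : w ≤ r) :
    gridIndex r a w a < a ∧ |gridPoint r a (gridIndex r a w a) - w| ≤ 2 * r / a := by
  have ha' : (0 : ℝ) < a := by exact_mod_cast ha
  have h0 : gridPoint r a 0 ≤ w := by simpa [gridPoint] using h1
  -- Point number a is r itself; it is not in the table but bounds the last cell.
  have hlast : w ≤ gridPoint r a a := by
    have : gridPoint r a a = r := by rw [gridPoint]; field_simp; ring
    rwa [this]
  have key : ∀ N, 1 ≤ N → gridIndex r a w N < N ∧ gridPoint r a (gridIndex r a w N) ≤ w ∧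
      (gridIndex r a w N + 1 < N → w ≤ gridPoint r a (gridIndex r a w N + 1)) := by
    intro N hN
    induction N with
    | zero => omega
    | succ N ih =>
      rw [gridIndex]
      split_ifs with h
      · have hN0 : N ≠ 0 := by
          rintro rfl
          exact absurd h (not_lt.mpr h0)
        obtain ⟨k1, k2, k3⟩ := ih (by omega)
        refine ⟨by omega, k2, fun h5 => ?_⟩
        rcases Nat.lt_or_ge (gridIndex r a w N + 1) N with h6 | h6
        · exact k3 h6
        · rw [show gridIndex r a w N + 1 = N by omega]
          exact h.le
      · exact ⟨by omega, not_lt.mp h, fun h5 => by omega⟩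
  obtain ⟨k1, k2, k3⟩ := key a ha
  refine ⟨k1, ?_⟩
  have h3 : w ≤ gridPoint r a (gridIndex r a w a + 1) := by
    rcases Nat.lt_or_ge (gridIndex r a w a + 1) a with h6 | h6
    · exact k3 h6
    · rw [show gridIndex r a w a + 1 = a by omega]
      exact hlast
  have h4 : gridPoint r a (gridIndex r a w a + 1) = gridPoint r a (gridIndex r a w a) + 2 * r / a := by
    simp only [gridPoint]; push_cast; ring
  rw [abs_le]
  constructor <;> linarith

lemma truncUnit_mem (x : ℝ) : 0 ≤ truncUnit x ∧ truncUnit x ≤ 1 := by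
  rw [truncUnit]
  have h := abs_abs_sub_abs_le x (x - 1)
  rw [show x - (x - 1) = 1 by ring, abs_one] at h
  obtain ⟨h1, h2⟩ := abs_le.mp h
  constructor <;> linarith

lemma abs_truncUnit_sub_le {f : ℝ} (h0 : 0 ≤ f) (h1 : f ≤ 1) (x : ℝ) :
    |truncUnit x - f| ≤ |x - f| := by
  rw [truncUnit]
  rcases le_total x 0 with h | h
  · rw [abs_of_nonpos h, abs_of_nonpos (by linarith : x - 1 ≤ 0), abs_of_nonpos (by linarith),
      abs_of_nonpos (by linarith)]
    linarith
  · rcases le_total x 1 with h' | h'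
    · rw [abs_of_nonneg h, abs_of_nonpos (by linarith : x - 1 ≤ 0),
        show (x - -(x - 1) + 1) / 2 = x by ring]
    · rw [abs_of_nonneg h, abs_of_nonneg (by linarith : 0 ≤ x - 1), abs_of_nonneg (by linarith),
        abs_of_nonneg (by linarith)]
      linarith

variable {n ℓ : ℕ} {ε β : ℝ}

lemma avgDist_mem (hn : 1 ≤ n) {D : Fin n → E ℓ} {y : E ℓ} (h : ∀ i, dist (D i) y ≤ 1) :
    0 ≤ avgDist D y ∧ avgDist D y ≤ 1 := by
  have hn' : (0 : ℝ) < n := by exact_mod_cast hn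
  refine ⟨by unfold avgDist; positivity, ?_⟩
  rw [avgDist, div_le_one hn']
  calc ∑ i, dist (D i) y ≤ ∑ _i : Fin n, (1 : ℝ) := Finset.sum_le_sum fun i _ => h i
    _ = n := by simp

lemma sqrt_pi_div_two_le : √(Real.pi / 2) ≤ 2 := by
  rw [Real.sqrt_le_left (by norm_num)]
  linarith [Real.pi_le_four]

lemma sqrt_pi_div_two_mul : √(Real.pi / 2) * √(2 / Real.pi) = 1 := by
  rw [← Real.sqrt_mul (by positivity), show Real.pi / 2 * (2 / Real.pi) = 1 by
    field_simp, Real.sqrt_one]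

/-- Three errors add up: η from the noise, 2r/a from rounding the projected query to the grid, and κ
from averaging over finitely many directions. The sampling bound is applied to v = D i - y for every
i. The factor 2 bounds √(π/2). -/
lemma abs_tableAnswer_sub_le (hn : 1 ≤ n) {a : ℕ} (ha : 1 ≤ a) {b η κ : ℝ} (hb : 0 ≤ b)
    {g z : ℕ → ℝ} (hg : ∀ i, |g i| ≤ b) (hz : ∀ i < a * a * ℓ, z i = g i) (x₀ y : E ℓ)
    (D : Fin n → E ℓ) (hy : dist y x₀ ≤ 1) (hD : ∀ i, dist (D i) y ≤ 1)
    (hzt : ∀ q < a * a * a, |z (a * a * ℓ + q) - tables n ℓ (b * √(ℓ : ℝ)) a g (pointArray x₀)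
      (dataArray D) q| ≤ η)
    (hκ : ∀ v : E ℓ, ‖v‖ ≤ 1 → |∑ j ∈ Finset.range (a * a),
      (|∑ c : Fin ℓ, g (j * ℓ + c) * v c| - √(2 / Real.pi) * ‖v‖)| ≤ (a * a : ℕ) * κ) :
    |tableAnswer ℓ (b * √(ℓ : ℝ)) a (pointArray x₀) z (pointArray y) - avgDist D y| ≤
      2 * (η + 2 * (b * √(ℓ : ℝ)) / a + κ) := by
  have hn' : (0 : ℝ) < n := by exact_mod_cast hn
  set m := a * a with hm
  have hm1 : 1 ≤ m := Nat.mul_pos ha ha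
  have hm' : (0 : ℝ) < m := by exact_mod_cast hm1
  set r := b * √(ℓ : ℝ)
  set s := √(2 / Real.pi)
  set F : ℕ → ℝ := fun j => (∑ i : Fin n, |∑ c : Fin ℓ, g (j * ℓ + c) * (D i - y) c|) / n with hF
  set Z : ℕ → ℝ := fun j =>
    z (m * ℓ + (j * a + gridIndex r a (blockInner ℓ z (pointArray x₀) (pointArray y) j) a)) with hZ
  have hZF : ∀ j < m, |Z j - F j| ≤ η + 2 * r / a := by
    intro j hj
    have hw : blockInner ℓ z (pointArray x₀) (pointArray y) j =
        ∑ c : Fin ℓ, g (j * ℓ + c) * (y - x₀) c := by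
      rw [blockInner_congr hj hz, blockInner_pointArray]
    set w := ∑ c : Fin ℓ, g (j * ℓ + c) * (y - x₀) c with hwdef
    have hwr : |w| ≤ r := by
      refine (abs_sum_mul_le hb (fun c => hg _) _).trans ?_
      rw [← dist_eq_norm]
      exact mul_le_of_le_one_right (by positivity) hy
    obtain ⟨p1, p2⟩ := gridIndex_spec (r := r) ha (abs_le.mp hwr).1 (abs_le.mp hwr).2
    set p := gridIndex r a w a
    have hq : j * a + p < m * a := by
      have := Nat.mul_le_mul_right a (Nat.succ_le_of_lt hj)
      rw [Nat.succ_mul] at this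
      omega
    have h1 := hzt (j * a + p) hq
    have hdiv : (j * a + p) / a = j := by
      rw [mul_comm, Nat.mul_add_div ha, Nat.div_eq_of_lt p1, add_zero]
    have hmod : (j * a + p) % a = p := by
      rw [mul_comm, Nat.mul_add_mod, Nat.mod_eq_of_lt p1]
    rw [tables, hdiv, hmod] at h1
    have h2 : |tableEntry n ℓ r a g (pointArray x₀) (dataArray D) j p - F j| ≤ 2 * r / a := by
      rw [tableEntry, hF, ← sub_div, abs_div, Nat.abs_cast, div_le_iff₀ hn']
      simp only [Finset.sum_range, blockInner_dataArray]
      rw [← Finset.sum_sub_distrib]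
      refine (Finset.abs_sum_le_sum_abs _ _).trans ?_
      calc _ ≤ ∑ _i : Fin n, 2 * r / a := Finset.sum_le_sum fun i _ => ?_
        _ = _ := by simp; ring
      refine (abs_abs_sub_abs_le _ _).trans ?_
      -- The base point cancels; it serves only to bring the projections into [-r, r].
      have e : (∑ c : Fin ℓ, g (j * ℓ + c) * (D i - x₀) c) - gridPoint r a p -
          ∑ c : Fin ℓ, g (j * ℓ + c) * (D i - y) c = w - gridPoint r a p := by
        have : ∑ c : Fin ℓ, g (j * ℓ + c) * (D i - x₀) c =
            w + ∑ c : Fin ℓ, g (j * ℓ + c) * (D i - y) c := by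
          rw [hwdef, ← Finset.sum_add_distrib]
          refine Finset.sum_congr rfl fun c _ => ?_
          simp only [PiLp.sub_apply]; ring
        rw [this]; ring
      rw [e, abs_sub_comm]
      exact p2
    have h3 : Z j = z (m * ℓ + (j * a + p)) := by rw [hZ]; simp only [hw]; rfl
    rw [h3]
    calc _ ≤ _ := abs_sub_le _ (tableEntry n ℓ r a g (pointArray x₀) (dataArray D) j p) _
      _ ≤ _ := add_le_add h1 h2
  have hsumF : |∑ j ∈ Finset.range m, F j - m * (s * avgDist D y)| ≤ m * κ := by
    have e : ∑ j ∈ Finset.range m, F j - m * (s * avgDist D y) =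
        (∑ i : Fin n, ∑ j ∈ Finset.range m,
          (|∑ c : Fin ℓ, g (j * ℓ + c) * (D i - y) c| - s * ‖D i - y‖)) / n := by
      simp only [hF, avgDist, Finset.sum_sub_distrib, Finset.sum_const, Finset.card_range,
        nsmul_eq_mul, dist_eq_norm]
      rw [← Finset.sum_div, Finset.sum_comm, ← Finset.mul_sum, ← Finset.mul_sum]
      field_simp
    rw [e, abs_div, Nat.abs_cast, div_le_iff₀ hn']
    refine (Finset.abs_sum_le_sum_abs _ _).trans ?_
    calc _ ≤ ∑ _i : Fin n, m * κ := Finset.sum_le_sum fun i _ =>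
            hκ (D i - y) (by rw [← dist_eq_norm]; exact hD i)
      _ = _ := by simp; ring
  have hsumZ : |∑ j ∈ Finset.range m, Z j - ∑ j ∈ Finset.range m, F j| ≤
      m * (η + 2 * r / a) := by
    rw [← Finset.sum_sub_distrib]
    refine (Finset.abs_sum_le_sum_abs _ _).trans ?_
    calc _ ≤ ∑ _j ∈ Finset.range m, (η + 2 * r / a) :=
            Finset.sum_le_sum fun j hj => hZF j (Finset.mem_range.mp hj)
      _ = _ := by simp; ring
  have htot : |∑ j ∈ Finset.range m, Z j - m * (s * avgDist D y)| ≤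
      m * (η + 2 * r / a + κ) := by
    calc _ ≤ _ := abs_sub_le _ (∑ j ∈ Finset.range m, F j) _
      _ ≤ _ := add_le_add hsumZ hsumF
      _ = _ := by ring
  have hfin : tableAnswer ℓ r a (pointArray x₀) z (pointArray y) - avgDist D y =
      √(Real.pi / 2) * (∑ j ∈ Finset.range m, Z j - m * (s * avgDist D y)) / m := by
    have h1 : √(Real.pi / 2) * (∑ j ∈ Finset.range m, Z j - m * (s * avgDist D y)) / m =
      √(Real.pi / 2) * (∑ j ∈ Finset.range m, Z j) / m - (√(Real.pi / 2) * s) * avgDist D y := by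
      field_simp
    rw [h1, sqrt_pi_div_two_mul, one_mul]
    rfl
  rw [hfin, abs_div, abs_mul, Nat.abs_cast, div_le_iff₀ hm', abs_of_nonneg (Real.sqrt_nonneg _)]
  calc _ ≤ 2 * (m * (η + 2 * r / a + κ)) :=
        mul_le_mul sqrt_pi_div_two_le htot (abs_nonneg _) (by norm_num)
    _ = _ := by ring

lemma norm_le_sum_abs {ℓ : ℕ} (v : E ℓ) : ‖v‖ ≤ ∑ c, |v c| := by
  rw [EuclideanSpace.norm_eq, Real.sqrt_le_left (Finset.sum_nonneg fun _ _ => abs_nonneg _)]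
  simpa using Finset.sum_sq_le_sq_sum_of_nonneg (s := Finset.univ) (f := fun c => |v c|)
    (fun _ _ => abs_nonneg _)

/-- The answer is the exact answer of the noisy database, and each point has moved by at most the
sum of its ℓ coordinate errors. -/
lemma abs_directAnswer_sub_le (hn : 1 ≤ n) {η : ℝ} {z : ℕ → ℝ} (y : E ℓ)
    (D : Fin n → E ℓ) (hz : ∀ p < n * ℓ, |z p - dataArray D p| ≤ η) :
    |directAnswer n ℓ z (pointArray y) - avgDist D y| ≤ ℓ * η := by
  have hn' : (0 : ℝ) < n := by exact_mod_cast hn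
  set D' : Fin n → E ℓ := fun i => WithLp.toLp 2 fun c : Fin ℓ => z (i * ℓ + c) with hD'
  have h1 : directAnswer n ℓ z (pointArray y) = avgDist D' y := by
    rw [directAnswer, avgDist]
    congr 1
    rw [Finset.sum_range]
    refine Finset.sum_congr rfl fun i _ => ?_
    rw [dist_eq_norm, EuclideanSpace.norm_eq, Finset.sum_range]
    congr 1
    refine Finset.sum_congr rfl fun c _ => ?_
    simp [hD', pointArray, sq]
  rw [h1, avgDist, avgDist, ← sub_div, abs_div, Nat.abs_cast, div_le_iff₀ hn',
    ← Finset.sum_sub_distrib]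
  refine (Finset.abs_sum_le_sum_abs _ _).trans ?_
  calc _ ≤ ∑ _i : Fin n, (ℓ : ℝ) * η := Finset.sum_le_sum fun i _ => ?_
    _ = _ := by simp; ring
  refine (abs_dist_sub_le _ _ _).trans ?_
  rw [dist_eq_norm]
  refine (norm_le_sum_abs _).trans ?_
  calc _ ≤ ∑ _c : Fin ℓ, η := Finset.sum_le_sum fun c _ => ?_
    _ = _ := by simp
  have hlt : (i : ℕ) * ℓ + c < n * ℓ := by
    have := Nat.mul_le_mul_right ℓ (Nat.succ_le_of_lt i.2)
    rw [Nat.succ_mul] at this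
    omega
  have := hz _ hlt
  rw [dataArray_block] at this
  simpa [hD'] using this

end DistanceRelease

namespace DistanceRelease

open RealRAM

/-! ### Accuracy: the exceptional event -/

/-- Rounding is toward zero, so that the lattice point next to a vector of the unit ball stays in
the unit ball. -/
lemma exists_int_abs_le (x : ℝ) : ∃ k : ℤ, |(k : ℝ)| ≤ |x| ∧ |x - k| ≤ 1 := by
  rcases le_total 0 x with h | h
  · have h1 := Int.floor_le x
    have h2 := Int.lt_floor_add_one x
    have h3 : (0 : ℝ) ≤ ⌊x⌋ := by exact_mod_cast Int.floor_nonneg.mpr h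
    exact ⟨⌊x⌋, by rwa [abs_of_nonneg h3, abs_of_nonneg h], by rw [abs_le]; constructor <;> linarith⟩
  · have h1 := Int.le_ceil x
    have h2 := Int.ceil_lt_add_one x
    have h3 : (⌈x⌉ : ℝ) ≤ 0 := by exact_mod_cast Int.ceil_le.mpr (by simpa using h)
    exact ⟨⌈x⌉, by rw [abs_of_nonpos h3, abs_of_nonpos h]; linarith,
      by rw [abs_le]; constructor <;> linarith⟩

/-- Point of the lattice of mesh `1 / Q`. -/
noncomputable def latticePoint {ℓ : ℕ} (Q : ℕ) (k : Fin ℓ → ℤ) : E ℓ :=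
  WithLp.toLp 2 fun c => (k c : ℝ) / Q

/-- Coordinates of the lattice points of the cube `[-1, 1]^ℓ`. -/
noncomputable def latticeCube (ℓ Q : ℕ) : Finset (Fin ℓ → ℤ) := Fintype.piFinset fun _ => Finset.Icc (-Q : ℤ) Q

lemma card_latticeCube (ℓ Q : ℕ) : (latticeCube ℓ Q).card = (2 * Q + 1) ^ ℓ := by
  simp only [latticeCube, Fintype.card_piFinset, Int.card_Icc, Finset.prod_const, Finset.card_univ,
    Fintype.card_fin]
  congr 1
  omega

lemma exists_latticePoint {ℓ Q : ℕ} (hQ : 1 ≤ Q) {v : E ℓ} (hv : ‖v‖ ≤ 1) :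
    ∃ k ∈ latticeCube ℓ Q, ‖latticePoint Q k‖ ≤ 1 ∧ ‖v - latticePoint Q k‖ ≤ ℓ / Q := by
  have hQ' : (0 : ℝ) < Q := by exact_mod_cast hQ
  choose k hk1 hk2 using fun c => exists_int_abs_le (Q * v c)
  have hk : ∀ c, |(k c : ℝ)| ≤ Q * |v c| := fun c => by
    simpa [abs_mul] using hk1 c
  have hle : ∀ c, |latticePoint Q k c| ≤ |v c| := fun c => by
    simp only [latticePoint, abs_div, Nat.abs_cast]
    rw [div_le_iff₀ hQ', mul_comm]
    exact hk c
  refine ⟨k, ?_, ?_, ?_⟩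
  · rw [latticeCube, Fintype.mem_piFinset]
    intro c
    have h1 : |(k c : ℝ)| ≤ Q := (hk c).trans (mul_le_of_le_one_right hQ'.le
      ((PiLp.norm_apply_le v c).trans hv))
    rw [Finset.mem_Icc, ← abs_le]
    exact_mod_cast h1
  · refine le_trans ?_ hv
    rw [EuclideanSpace.norm_eq, EuclideanSpace.norm_eq]
    refine Real.sqrt_le_sqrt (Finset.sum_le_sum fun c _ => ?_)
    exact pow_le_pow_left₀ (norm_nonneg _) (hle c) 2
  · refine (norm_le_sum_abs _).trans ?_
    calc _ ≤ ∑ _c : Fin ℓ, 1 / (Q : ℝ) := Finset.sum_le_sum fun c _ => ?_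
      _ = _ := by simp; ring
    rw [le_div_iff₀ hQ']
    have h2 := hk2 c
    calc |(v - latticePoint Q k) c| * Q = |(v - latticePoint Q k) c * Q| := by
          rw [abs_mul, Nat.abs_cast]
      _ = |Q * v c - k c| := by
          congr 1
          simp only [PiLp.sub_apply, latticePoint]
          field_simp
      _ ≤ 1 := h2

/-- The mesh of the lattice is `1 / (n + ℓ) ^ 2`. -/
def fineness (n ℓ : ℕ) : ℕ := (n + ℓ) ^ 2

/-- The random choices do not deviate much from what is expected. -/
structure Typical (ω : Tape) (n ℓ : ℕ) (ε β : ℝ) : Prop where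
  gauss : ∀ i < offset n ℓ ε, |(ω i).2| ≤ level n ℓ β
  noise : ∀ p < count n ℓ ε, |logit (ω (offset n ℓ ε + p)).1| ≤ level n ℓ β
  lattice : ¬ Direct n ℓ ε → ∀ k ∈ latticeCube ℓ (fineness n ℓ),
    ‖latticePoint (fineness n ℓ) k‖ ≤ 1 →
    |∑ j ∈ Finset.range (resolution n ℓ ε * resolution n ℓ ε),
      (|proj (latticePoint (fineness n ℓ) k) j ω| -
        √(2 / Real.pi) * ‖latticePoint (fineness n ℓ) k‖)| ≤
      (resolution n ℓ ε * resolution n ℓ ε : ℕ) * (2 * radius n ℓ β / resolution n ℓ ε)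

variable {n ℓ : ℕ} {ε β : ℝ}

/-- The level is chosen for this bound: the fourth power exceeds both the number of entries, at most
(n + ℓ)³, and up to a factor 3 the number of lattice points per coordinate. The summand 4 supplies
e⁴ ≥ 50. -/
lemma exp_neg_level_le (hn : 1 ≤ n) (h0 : 0 < β) :
    Real.exp (-level n ℓ β) ≤ β / 50 / ((n + ℓ : ℕ) : ℝ) ^ 4 := by
  have hS : (0 : ℝ) < ((n + ℓ : ℕ) : ℝ) := by exact_mod_cast (by omega : 0 < n + ℓ)
  have e : -level n ℓ β = Real.log β - 4 - Real.log (((n + ℓ : ℕ) : ℝ) ^ 4) := by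
    rw [level, Real.log_pow]; push_cast; ring
  rw [e, Real.exp_sub, Real.exp_sub, Real.exp_log h0, Real.exp_log (by positivity)]
  gcongr
  have h2 := Real.exp_one_gt_d9
  have : Real.exp 4 = Real.exp 1 ^ 4 := by rw [← Real.exp_nat_mul]; norm_num
  rw [this]
  calc (50 : ℝ) ≤ 2.7 ^ 4 := by norm_num
    _ ≤ _ := by gcongr; linarith

lemma offset_le (hn : 1 ≤ n) (hε : 0 < ε) : offset n ℓ ε ≤ (n + ℓ) ^ 3 := by
  rw [offset]
  split_ifs with hd
  · exact Nat.zero_le _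
  · have h := (resolution_spec hn hε hd).2.1
    calc _ ≤ (n + ℓ) * (n + ℓ) * (n + ℓ) := by gcongr; omega
      _ = _ := by ring

lemma count_le (hn : 1 ≤ n) (hε : 0 < ε) : count n ℓ ε ≤ (n + ℓ) ^ 3 := by
  rw [count]
  split_ifs with hd
  · have h : 1 ≤ n + ℓ := by omega
    calc n * ℓ = n * ℓ * 1 := by ring
      _ ≤ (n + ℓ) * (n + ℓ) * (n + ℓ) := by gcongr <;> omega
      _ = _ := by ring
  · have h := (resolution_spec hn hε hd).2.1
    calc _ ≤ (n + ℓ) * (n + ℓ) * (n + ℓ) := by gcongr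
      _ = _ := by ring

lemma tapeLaw_exists_lt_le {N : ℕ} {P : ℕ → Tape → Prop} {b : ℝ}
    (h : ∀ i < N, tapeLaw {ω | P i ω} ≤ ENNReal.ofReal b) :
    tapeLaw {ω | ∃ i < N, P i ω} ≤ ENNReal.ofReal (N * b) := by
  have e : {ω | ∃ i < N, P i ω} = ⋃ i ∈ Finset.range N, {ω | P i ω} := by
    ext ω; simp
  rw [e]
  refine (measure_biUnion_finset_le _ _).trans ?_
  refine (Finset.sum_le_sum fun i hi => h i (Finset.mem_range.mp hi)).trans ?_
  rw [Finset.sum_const, Finset.card_range, nsmul_eq_mul, ENNReal.ofReal_mul (by positivity),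
    ENNReal.ofReal_natCast]

/-- A union bound over (2Q + 1)^ℓ lattice points. The deviation 2r/a, with r = B√ℓ and a²
directions, gives the exponent ℓB² ≥ ℓB, so the number of points is beaten coordinate by coordinate.
-/
lemma tapeLaw_lattice_le (hn : 1 ≤ n) (hℓ : 1 ≤ ℓ) (hε : 0 < ε) (h0 : 0 < β) (h1 : β < 1)
    (hd : ¬ Direct n ℓ ε) :
    tapeLaw {ω | ∃ k ∈ latticeCube ℓ (fineness n ℓ), ‖latticePoint (fineness n ℓ) k‖ ≤ 1 ∧
      (resolution n ℓ ε * resolution n ℓ ε : ℕ) * (2 * radius n ℓ β / resolution n ℓ ε) <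
      |∑ j ∈ Finset.range (resolution n ℓ ε * resolution n ℓ ε),
        (|proj (latticePoint (fineness n ℓ) k) j ω| -
          √(2 / Real.pi) * ‖latticePoint (fineness n ℓ) k‖)|} ≤ ENNReal.ofReal (β / 2) := by
  obtain ⟨ha, -, -, -⟩ := resolution_spec hn hε hd
  have hB := level_ge (n := n) (ℓ := ℓ) h0 h1
  have hr := radius_pos (n := n) hℓ h0 h1
  have hexp := exp_neg_level_le (ℓ := ℓ) hn h0
  set a := resolution n ℓ ε
  have ha' : (0 : ℝ) < a := by exact_mod_cast ha
  set B := level n ℓ β with hBdef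
  set Q := fineness n ℓ with hQ
  have hS1 : (1 : ℝ) ≤ ((n + ℓ : ℕ) : ℝ) := by exact_mod_cast (by omega : 1 ≤ n + ℓ)
  set S : ℝ := ((n + ℓ : ℕ) : ℝ) with hS
  have hrad : radius n ℓ β = B * √(ℓ : ℝ) := rfl
  have e : ((a * a : ℕ) : ℝ) * (2 * radius n ℓ β / a) ^ 2 / 4 = ℓ * B ^ 2 := by
    rw [hrad, div_pow, mul_pow, mul_pow, Real.sq_sqrt (Nat.cast_nonneg _)]
    push_cast
    field_simp
    ring
  set T : (Fin ℓ → ℤ) → Set Tape := fun k => {ω | ‖latticePoint Q k‖ ≤ 1 ∧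
      (a * a : ℕ) * (2 * radius n ℓ β / a) < |∑ j ∈ Finset.range (a * a),
        (|proj (latticePoint Q k) j ω| - √(2 / Real.pi) * ‖latticePoint Q k‖)|}
  have hT : ∀ k, tapeLaw (T k) ≤ ENNReal.ofReal (2 * Real.exp (-(ℓ * B ^ 2))) := by
    intro k
    by_cases hk : ‖latticePoint Q k‖ ≤ 1
    · rw [← e]
      refine (measure_mono fun ω hω => ?_).trans
        (tapeLaw_proj_deviation_le (latticePoint Q k) hk (m := a * a) (by positivity))
      exact hω.2
    -- Lattice points outside the unit ball contribute nothing.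
    · have : T k = ∅ := by ext ω; simp [T, hk]
      rw [this, measure_empty]
      exact zero_le
  refine le_trans (measure_mono (t := ⋃ k ∈ latticeCube ℓ Q, T k) fun ω hω => ?_) ?_
  · obtain ⟨k, hk, hk'⟩ := hω
    simp only [Set.mem_iUnion]
    exact ⟨k, hk, hk'⟩
  · refine (measure_biUnion_finset_le _ _).trans ((Finset.sum_le_sum fun k _ => hT k).trans ?_)
    rw [Finset.sum_const, nsmul_eq_mul, card_latticeCube, ← ENNReal.ofReal_natCast,
      ← ENNReal.ofReal_mul (by positivity)]
    refine ENNReal.ofReal_le_ofReal ?_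
    have e2 : Real.exp (-(ℓ * B ^ 2)) ≤ Real.exp (-B) ^ ℓ := by
      rw [← Real.exp_nat_mul]
      refine Real.exp_le_exp.mpr ?_
      have h3 : B ≤ B ^ 2 := by nlinarith
      have := mul_le_mul_of_nonneg_left h3 (Nat.cast_nonneg (α := ℝ) ℓ)
      linarith
    have e3 : (2 * (Q : ℝ) + 1) * Real.exp (-B) ≤ β / 4 := by
      have hQ2 : (Q : ℝ) = S ^ 2 := by rw [hQ, fineness, hS]; push_cast; ring
      have h5 : 2 * (Q : ℝ) + 1 ≤ 3 * S ^ 4 := by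
        rw [hQ2]
        have := one_le_pow₀ hS1 (n := 2)
        nlinarith
      calc (2 * (Q : ℝ) + 1) * Real.exp (-B) ≤ 3 * S ^ 4 * (β / 50 / S ^ 4) := by gcongr
        _ = 3 / 50 * β := by field_simp
        _ ≤ _ := by linarith
    calc (((2 * Q + 1) ^ ℓ : ℕ) : ℝ) * (2 * Real.exp (-(ℓ * B ^ 2)))
        ≤ (((2 * Q + 1) ^ ℓ : ℕ) : ℝ) * (2 * Real.exp (-B) ^ ℓ) := by gcongr
      _ = 2 * ((2 * (Q : ℝ) + 1) * Real.exp (-B)) ^ ℓ := by push_cast; rw [mul_pow]; ring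
      _ ≤ 2 * (β / 4) ^ ℓ := by gcongr
      _ ≤ 2 * (β / 4) := by
          gcongr
          exact pow_le_of_le_one (by positivity) (by linarith) (by omega)
      _ = _ := by ring

lemma tapeLaw_not_typical_le (hn : 1 ≤ n) (hℓ : 1 ≤ ℓ) (hε : 0 < ε) (h0 : 0 < β) (h1 : β < 1) :
    tapeLaw {ω | ¬ Typical ω n ℓ ε β} ≤ ENNReal.ofReal β := by
  have hB := level_ge (n := n) (ℓ := ℓ) h0 h1
  have hexp := exp_neg_level_le (ℓ := ℓ) hn h0
  have hS1 : (1 : ℝ) ≤ ((n + ℓ : ℕ) : ℝ) := by exact_mod_cast (by omega : 1 ≤ n + ℓ)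
  have hsmall : ∀ N : ℕ, N ≤ (n + ℓ) ^ 3 → N * Real.exp (-level n ℓ β) ≤ β / 50 := by
    intro N hN
    have hN' : (N : ℝ) ≤ ((n + ℓ : ℕ) : ℝ) ^ 4 := by
      have : N ≤ (n + ℓ) ^ 4 := hN.trans (Nat.pow_le_pow_right (by omega) (by norm_num))
      exact_mod_cast this
    calc _ ≤ ((n + ℓ : ℕ) : ℝ) ^ 4 * (β / 50 / ((n + ℓ : ℕ) : ℝ) ^ 4) := by gcongr
      _ = _ := by field_simp
  have t1 := tapeLaw_exists_lt_le (N := offset n ℓ ε)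
    (fun i _ => tapeLaw_gauss_tail_le i (level n ℓ β))
  have t2 := tapeLaw_exists_lt_le (N := count n ℓ ε)
    (fun p _ => tapeLaw_logit_tail_le (offset n ℓ ε + p) (b := level n ℓ β) (by linarith))
  set A₁ := {ω : Tape | ∃ i < offset n ℓ ε, level n ℓ β < |(ω i).2|}
  set A₂ := {ω : Tape | ∃ p < count n ℓ ε, level n ℓ β < |logit (ω (offset n ℓ ε + p)).1|}
  set A₃ := {ω : Tape | ¬ Direct n ℓ ε ∧ ∃ k ∈ latticeCube ℓ (fineness n ℓ),
      ‖latticePoint (fineness n ℓ) k‖ ≤ 1 ∧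
      (resolution n ℓ ε * resolution n ℓ ε : ℕ) * (2 * radius n ℓ β / resolution n ℓ ε) <
      |∑ j ∈ Finset.range (resolution n ℓ ε * resolution n ℓ ε),
        (|proj (latticePoint (fineness n ℓ) k) j ω| -
          √(2 / Real.pi) * ‖latticePoint (fineness n ℓ) k‖)|}
  have t3 : tapeLaw A₃ ≤ ENNReal.ofReal (β / 2) := by
    by_cases hd : Direct n ℓ ε
    · have : A₃ = ∅ := by ext ω; simp [A₃, hd]
      rw [this, measure_empty]
      exact zero_le
    · exact (measure_mono fun ω hω => hω.2).trans (tapeLaw_lattice_le hn hℓ hε h0 h1 hd)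
  have hsub : {ω | ¬ Typical ω n ℓ ε β} ⊆ A₁ ∪ A₂ ∪ A₃ := by
    intro ω hω
    by_contra hcon
    simp only [Set.mem_union, not_or] at hcon
    obtain ⟨⟨c1, c2⟩, c3⟩ := hcon
    refine hω ⟨fun i hi => ?_, fun p hp => ?_, fun hd k hk hk' => ?_⟩
    · by_contra h; exact c1 ⟨i, hi, not_le.mp h⟩
    · by_contra h; exact c2 ⟨p, hp, not_le.mp h⟩
    · by_contra h; exact c3 ⟨hd, k, hk, hk', not_le.mp h⟩
  refine (measure_mono hsub).trans ((measure_union_le _ _).trans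
    ((add_le_add ((measure_union_le _ _).trans (add_le_add t1 t2)) t3).trans ?_))
  rw [← ENNReal.ofReal_add (by positivity) (by positivity),
    ← ENNReal.ofReal_add (by positivity) (by positivity)]
  refine ENNReal.ofReal_le_ofReal ?_
  -- The total is at most 4β/50 + 2β/50 + β/2.
  have s1 := hsmall _ (offset_le (ℓ := ℓ) hn hε)
  have s2 := hsmall _ (count_le (ℓ := ℓ) hn hε)
  linarith

/-! ### Accuracy: typical outcomes -/

/-- Passage from the lattice to the whole ball. On a typical tape the truncation is inactive.
Replacing v by a lattice point at distance at most ℓ/(n + ℓ)² ≤ 1/a changes each term by at most (r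
+ 1)/a, to be added to the deviation 2r/a on the lattice. -/
lemma Typical.abs_sum_directions_le {ω : Tape} (hω : Typical ω n ℓ ε β) (hn : 1 ≤ n) (hℓ : 1 ≤ ℓ)
    (hε : 0 < ε) (h0 : 0 < β) (h1 : β < 1) (hd : ¬ Direct n ℓ ε) {v : E ℓ} (hv : ‖v‖ ≤ 1) :
    |∑ j ∈ Finset.range (resolution n ℓ ε * resolution n ℓ ε),
      (|∑ c : Fin ℓ, directions ω (level n ℓ β) (j * ℓ + c) * v c| - √(2 / Real.pi) * ‖v‖)| ≤
      (resolution n ℓ ε * resolution n ℓ ε : ℕ) *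
        ((3 * radius n ℓ β + 1) / resolution n ℓ ε) := by
  obtain ⟨ha, haS, -, -⟩ := resolution_spec hn hε hd
  have hB := level_ge (n := n) (ℓ := ℓ) h0 h1
  have hr := radius_pos (n := n) hℓ h0 h1
  have hoff : offset n ℓ ε = resolution n ℓ ε * resolution n ℓ ε * ℓ := if_neg hd
  have hg := hω.gauss
  rw [hoff] at hg
  have hlat := hω.lattice hd
  have hQ1 : 1 ≤ fineness n ℓ := Nat.one_le_pow _ _ (by omega)
  obtain ⟨k, hk, hk1, hk2⟩ := exists_latticePoint hQ1 hv
  have hlk := hlat k hk hk1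
  set a := resolution n ℓ ε
  have ha' : (0 : ℝ) < a := by exact_mod_cast ha
  set v' := latticePoint (fineness n ℓ) k
  set s := √(2 / Real.pi)
  have hs : s ≤ 1 := by
    rw [Real.sqrt_le_left one_pos.le, one_pow, div_le_one Real.pi_pos]
    linarith [Real.pi_gt_three]
  have hs0 : 0 ≤ s := Real.sqrt_nonneg _
  have hdist : ‖v - v'‖ ≤ 1 / a := by
    refine hk2.trans ?_
    have hS : (0 : ℝ) < ((n + ℓ : ℕ) : ℝ) := by exact_mod_cast (by omega : 0 < n + ℓ)
    rw [fineness, div_le_div_iff₀ (by positivity) ha']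
    have : ℓ * a ≤ 1 * (n + ℓ) ^ 2 := by
      calc ℓ * a ≤ (n + ℓ) * (n + ℓ) := by gcongr; omega
        _ = _ := by ring
    exact_mod_cast this
  have hj : ∀ j ∈ Finset.range (a * a),
      |(|∑ c : Fin ℓ, directions ω (level n ℓ β) (j * ℓ + c) * v c| - s * ‖v‖) -
        (|proj v' j ω| - s * ‖v'‖)| ≤ (radius n ℓ β + 1) / a := by
    intro j hj
    have hproj : proj v' j ω = ∑ c : Fin ℓ, directions ω (level n ℓ β) (j * ℓ + c) * v' c := by
      refine Finset.sum_congr rfl fun c _ => ?_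
      rw [directions, trunc_of_abs_le (hg _ ?_)]
      have := Nat.mul_le_mul_right ℓ (Nat.succ_le_of_lt (Finset.mem_range.mp hj))
      rw [Nat.succ_mul] at this
      omega
    rw [hproj]
    have e1 : |(|∑ c : Fin ℓ, directions ω (level n ℓ β) (j * ℓ + c) * v c|) -
        (|∑ c : Fin ℓ, directions ω (level n ℓ β) (j * ℓ + c) * v' c|)| ≤
        radius n ℓ β * (1 / a) := by
      refine (abs_abs_sub_abs_le _ _).trans ?_
      rw [← Finset.sum_sub_distrib]
      calc _ = |∑ c : Fin ℓ, directions ω (level n ℓ β) (j * ℓ + c) * (v - v') c| := by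
            congr 1
            exact Finset.sum_congr rfl fun c _ => by simp only [PiLp.sub_apply]; ring
        _ ≤ radius n ℓ β * ‖v - v'‖ :=
            abs_sum_mul_le (by linarith) (fun c => abs_trunc_le (by linarith) _) _
        _ ≤ _ := by gcongr
    have e2 : |s * ‖v'‖ - s * ‖v‖| ≤ 1 * (1 / a) := by
      rw [← mul_sub, abs_mul, abs_of_nonneg hs0]
      gcongr
      rw [abs_sub_comm]
      exact (abs_norm_sub_norm_le _ _).trans hdist
    calc _ = |((|∑ c : Fin ℓ, directions ω (level n ℓ β) (j * ℓ + c) * v c|) -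
        |∑ c : Fin ℓ, directions ω (level n ℓ β) (j * ℓ + c) * v' c|) +
          (s * ‖v'‖ - s * ‖v‖)| := by congr 1; ring
      _ ≤ _ := abs_add_le _ _
      _ ≤ _ := add_le_add e1 e2
      _ = _ := by ring
  have hsum : |∑ j ∈ Finset.range (a * a),
      (|∑ c : Fin ℓ, directions ω (level n ℓ β) (j * ℓ + c) * v c| - s * ‖v‖) -
      ∑ j ∈ Finset.range (a * a), (|proj v' j ω| - s * ‖v'‖)| ≤
      (a * a : ℕ) * ((radius n ℓ β + 1) / a) := by
    rw [← Finset.sum_sub_distrib]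
    refine (Finset.abs_sum_le_sum_abs _ _).trans ((Finset.sum_le_sum hj).trans_eq ?_)
    rw [Finset.sum_const, Finset.card_range, nsmul_eq_mul]
  have htri := abs_sub_abs_le_abs_sub (∑ j ∈ Finset.range (a * a),
      (|∑ c : Fin ℓ, directions ω (level n ℓ β) (j * ℓ + c) * v c| - s * ‖v‖))
      (∑ j ∈ Finset.range (a * a), (|proj v' j ω| - s * ‖v'‖))
  calc _ ≤ ((a * a : ℕ) : ℝ) * ((radius n ℓ β + 1) / a) +
        (a * a : ℕ) * (2 * radius n ℓ β / a) := by linarith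
    _ = _ := by ring

lemma abs_answerOf_sub_le_one (hn : 1 ≤ n) {D : Fin n → E ℓ} {y : E ℓ}
    (hD : ∀ i, dist (D i) y ≤ 1) (x₀ z : ℕ → ℝ) :
    |answerOf n ℓ ε β x₀ z (pointArray y) - avgDist D y| ≤ 1 := by
  obtain ⟨f0, f1⟩ := avgDist_mem hn hD
  rw [answerOf]
  generalize (if ((n * (ℓ * ℓ) : ℕ) : ℝ) < ε then directAnswer n ℓ z (pointArray y)
    else tableAnswer ℓ (radius n ℓ β) (resolution n ℓ ε) x₀ z (pointArray y)) = w
  obtain ⟨t0, t1⟩ := truncUnit_mem w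
  rw [abs_le]
  constructor <;> linarith

/-- Here q is the fourth root of nε. For tables q ≤ a, so every error of order 1/a is acceptable;
for noisy points ε is so large that ℓ²/ε ≤ √ℓ/q. -/
lemma Typical.abs_answerOf_sub_le {ω : Tape} (hω : Typical ω n ℓ ε β) (hn : 1 ≤ n) (hℓ : 1 ≤ ℓ)
    (hε : 0 < ε) (h0 : 0 < β) (h1 : β < 1) {x₀ y : E ℓ} {D : Fin n → E ℓ} (hy : dist y x₀ ≤ 1)
    (hD : ∀ i, dist (D i) y ≤ 1) {q : ℝ} (hq : 0 < q) (hq4 : q ^ 4 = n * ε) (hN : 1 ≤ n * ε) :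
    |answerOf n ℓ ε β (pointArray x₀) (release ω n ℓ ε β (pointArray x₀) (dataArray D))
      (pointArray y) - avgDist D y| ≤ 36 * level n ℓ β ^ 2 * (√(ℓ : ℝ) / q) := by
  obtain ⟨f0, f1⟩ := avgDist_mem hn hD
  have hB := level_ge (n := n) (ℓ := ℓ) h0 h1
  have hℓ' : (1 : ℝ) ≤ ℓ := by exact_mod_cast hℓ
  have hn' : (1 : ℝ) ≤ n := by exact_mod_cast hn
  have hsq1 : 1 ≤ √(ℓ : ℝ) := Real.one_le_sqrt.mpr hℓ'
  have hsq : √(ℓ : ℝ) ^ 2 = ℓ := Real.sq_sqrt (by positivity)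
  rw [answerOf]
  refine (abs_truncUnit_sub_le f0 f1 _).trans ?_
  have hnoise := hω.noise
  by_cases hd : Direct n ℓ ε
  · rw [if_pos (show ((n * (ℓ * ℓ) : ℕ) : ℝ) < ε from hd)]
    have hoff : offset n ℓ ε = 0 := if_pos hd
    have hcnt : count n ℓ ε = n * ℓ := if_pos hd
    have hsc : noiseScale n ℓ ε β = ℓ / ε := if_pos hd
    rw [hoff, hcnt] at hnoise
    refine (abs_directAnswer_sub_le (η := ℓ / ε * level n ℓ β) hn y D fun p hp => ?_).trans ?_
    · have hrel : release ω n ℓ ε β (pointArray x₀) (dataArray D) p =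
          dataArray D p + ℓ / ε * logit (ω p).1 := by
        rw [release, hoff, hcnt, if_neg (by omega), if_pos (by omega), hsc, rawEntry, if_pos hd]
      rw [hrel, add_sub_cancel_left, abs_mul, abs_of_nonneg (by positivity)]
      have := hnoise p hp
      rw [zero_add] at this
      gcongr
    · have hdR : (n : ℝ) * ℓ ^ 2 ≤ ε := by
        have : ((n * (ℓ * ℓ) : ℕ) : ℝ) < ε := hd
        push_cast at this
        nlinarith
      -- Compare fourth powers: nεℓ⁶ ≤ ε(nℓ²)³ ≤ ε⁴.
      have hkey : q * (√(ℓ : ℝ) ^ 3) ≤ ε := by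
        have h4 : (q * √(ℓ : ℝ) ^ 3) ^ 4 ≤ ε ^ 4 := by
          have e : (q * √(ℓ : ℝ) ^ 3) ^ 4 = ε * (n * ℓ ^ 6) := by
            calc _ = q ^ 4 * (√(ℓ : ℝ) ^ 2) ^ 6 := by ring
              _ = _ := by rw [hq4, hsq]; ring
          rw [e]
          calc ε * (n * (ℓ : ℝ) ^ 6) ≤ ε * (n ^ 3 * (ℓ : ℝ) ^ 6) := by
                gcongr
                exact le_self_pow₀ hn' (by norm_num)
            _ = ε * (n * (ℓ : ℝ) ^ 2) ^ 3 := by ring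
            _ ≤ ε * ε ^ 3 := by gcongr
            _ = _ := by ring
        exact le_of_pow_le_pow_left₀ (by norm_num) hε.le h4
      have h5 : (ℓ : ℝ) * (ℓ / ε) ≤ √(ℓ : ℝ) / q := by
        rw [← mul_div_assoc, div_le_div_iff₀ hε hq]
        calc (ℓ : ℝ) * ℓ * q = √(ℓ : ℝ) * (q * √(ℓ : ℝ) ^ 3) := by
              conv_lhs => rw [← hsq]
              ring
          _ ≤ _ := by gcongr
      calc (ℓ : ℝ) * (ℓ / ε * level n ℓ β) = level n ℓ β * ((ℓ : ℝ) * (ℓ / ε)) := by ring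
        _ ≤ (36 * level n ℓ β ^ 2) * (√(ℓ : ℝ) / q) := by
            refine mul_le_mul ?_ h5 (by positivity) (by positivity)
            nlinarith
  · rw [if_neg (show ¬ ((n * (ℓ * ℓ) : ℕ) : ℝ) < ε from hd)]
    obtain ⟨ha, -, ha4, ha4'⟩ := resolution_spec hn hε hd
    replace ha4' := ha4' hN
    have hoff : offset n ℓ ε = resolution n ℓ ε * resolution n ℓ ε * ℓ := if_neg hd
    have hcnt : count n ℓ ε = resolution n ℓ ε * resolution n ℓ ε * resolution n ℓ ε := if_neg hd
    have hsc : noiseScale n ℓ ε β = count n ℓ ε * radius n ℓ β / (n * ε) := if_neg hd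
    have hsum := fun v (hv : ‖v‖ ≤ 1) => hω.abs_sum_directions_le hn hℓ hε h0 h1 hd hv
    have hscpos : 0 ≤ noiseScale n ℓ ε β := by
      have := (radius_pos (n := n) hℓ h0 h1).le
      rw [hsc]; positivity
    have hmain := abs_tableAnswer_sub_le (n := n) (ℓ := ℓ) hn ha (b := level n ℓ β)
      (η := noiseScale n ℓ ε β * level n ℓ β)
      (κ := (3 * radius n ℓ β + 1) / resolution n ℓ ε) (by linarith)
      (g := directions ω (level n ℓ β))
      (z := release ω n ℓ ε β (pointArray x₀) (dataArray D))
      (fun i => abs_trunc_le (by linarith) _)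
      (fun i hi => by rw [release, if_pos (by rwa [hoff]), rawEntry, if_neg hd,
        if_pos (by rwa [hoff])])
      x₀ y D hy hD (fun p hp => by
        rw [← hoff]
        have hrel : release ω n ℓ ε β (pointArray x₀) (dataArray D) (offset n ℓ ε + p) =
            tables n ℓ (radius n ℓ β) (resolution n ℓ ε) (directions ω (level n ℓ β))
              (pointArray x₀) (dataArray D) p +
              noiseScale n ℓ ε β * logit (ω (offset n ℓ ε + p)).1 := by
          rw [release, if_neg (by omega), if_pos (by rw [hcnt]; omega), rawEntry, if_neg hd,
            if_neg (by omega), Nat.add_sub_cancel_left]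
        rw [hrel]
        change |tables n ℓ (radius n ℓ β) _ _ _ _ p + _ - tables n ℓ (radius n ℓ β) _ _ _ _ p| ≤ _
        rw [add_sub_cancel_left, abs_mul, abs_of_nonneg hscpos]
        exact mul_le_mul_of_nonneg_left (hnoise p (by rwa [hcnt])) hscpos)
      hsum
    refine hmain.trans ?_
    have hqa : q ≤ resolution n ℓ ε :=
      le_of_pow_le_pow_left₀ (by norm_num) (Nat.cast_nonneg _) (hq4.trans_le ha4)
    rw [hsc, hcnt]
    set a : ℝ := (resolution n ℓ ε : ℝ) with hadef
    set B := level n ℓ β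
    have hrad : radius n ℓ β = B * √(ℓ : ℝ) := rfl
    have ha0 : 0 < a := by rw [hadef]; exact_mod_cast ha
    set w := √(ℓ : ℝ)
    -- The noise term contains a³/(nε), which is at most 16/a because a⁴ ≤ 16nε.
    have p1 : ((resolution n ℓ ε * resolution n ℓ ε * resolution n ℓ ε : ℕ) : ℝ) *
        radius n ℓ β / (n * ε) * B ≤ 16 * B ^ 2 * (w / a) := by
      push_cast
      rw [hrad, ← hadef]
      have : a ^ 4 / (n * ε) ≤ 16 := by rwa [div_le_iff₀ (by positivity)]
      calc a * a * a * (B * w) / (n * ε) * B = (a ^ 4 / (n * ε)) * B ^ 2 * (w / a) := by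
            field_simp
        _ ≤ _ := by gcongr
    have p2 : 2 * (B * w) / a ≤ B ^ 2 * (w / a) := by
      rw [show 2 * (B * w) / a = 2 * B * (w / a) by ring]
      gcongr
      nlinarith
    have p3 : (3 * radius n ℓ β + 1) / a ≤ B ^ 2 * (w / a) := by
      rw [hrad]
      calc (3 * (B * w) + 1) / a ≤ (3 * (B * w) + w) / a := by gcongr
        _ = (3 * B + 1) * (w / a) := by ring
        _ ≤ _ := by
          gcongr
          nlinarith
    -- This is where 36 = 2(16 + 1 + 1) comes from.
    calc _ ≤ 2 * (16 * B ^ 2 * (w / a) + B ^ 2 * (w / a) + B ^ 2 * (w / a)) := by gcongr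
      _ = 36 * B ^ 2 * (w / a) := by ring
      _ ≤ _ := by gcongr

end DistanceRelease

namespace DistanceRelease

open RealRAM

/-! ### Accuracy of the mechanisms -/

section

variable {n ℓ : ℕ} {ε β : ℝ}

/-- Since n + ℓ ≤ 2nℓ, and 4 + 4 log 2 < 7. -/
lemma level_le (hn : 1 ≤ n) (hℓ : 1 ≤ ℓ) :
    level n ℓ β ≤ 7 + 4 * Real.log ℓ + 4 * Real.log n + Real.log (1 / β) := by
  have hn' : (1 : ℝ) ≤ n := by exact_mod_cast hn
  have hℓ' : (1 : ℝ) ≤ ℓ := by exact_mod_cast hℓ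
  have h : Real.log ((n + ℓ : ℕ) : ℝ) ≤ Real.log 2 + Real.log ℓ + Real.log n := by
    rw [← Real.log_mul (by norm_num) (by positivity), ← Real.log_mul (by positivity) (by positivity)]
    refine Real.log_le_log (by positivity) ?_
    push_cast
    nlinarith
  have h2 := Real.log_two_lt_d9
  rw [level, one_div, Real.log_inv]
  linarith

/-- Put x = ℓ²/(nε). If x > 1, the trivial error 1 is at most x^p. If x ≤ 1, the error is of order
x^{1/4} ≤ x^p. The surplus r - 2p in the exponent of ℓ is given away. -/
lemma Typical.abs_answerOf_sub_le_rate {ω : Tape} (hω : Typical ω n ℓ ε β) (hn : 1 ≤ n) (hℓ : 1 ≤ ℓ)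
    (hε : 0 < ε) (h0 : 0 < β) (h1 : β < 1) {x₀ y : E ℓ} {D : Fin n → E ℓ} (hy : dist y x₀ ≤ 1)
    (hD : ∀ i, dist (D i) y ≤ 1) {K p r : ℝ} (hK : 36 * level n ℓ β ^ 2 ≤ K) (hp : 0 ≤ p)
    (hp4 : p ≤ 1 / 4) (hpr : 2 * p ≤ r) :
    |answerOf n ℓ ε β (pointArray x₀) (release ω n ℓ ε β (pointArray x₀) (dataArray D))
      (pointArray y) - avgDist D y| ≤ K * ((ℓ : ℝ) ^ r / ((n : ℝ) ^ p * ε ^ p)) := by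
  have hB := level_ge (n := n) (ℓ := ℓ) h0 h1
  have hK1 : 1 ≤ K := by nlinarith
  have hn' : (0 : ℝ) < n := by exact_mod_cast hn
  have hℓ' : (1 : ℝ) ≤ ℓ := by exact_mod_cast hℓ
  have hℓ0 : (0 : ℝ) ≤ ℓ := by linarith
  have hN : 0 < n * ε := by positivity
  have hx : 0 < (ℓ : ℝ) ^ 2 / (n * ε) := by positivity
  have hrate : ((ℓ : ℝ) ^ 2 / (n * ε)) ^ p ≤ (ℓ : ℝ) ^ r / ((n : ℝ) ^ p * ε ^ p) := by
    rw [Real.div_rpow (by positivity) hN.le, Real.mul_rpow hn'.le hε.le, ← Real.rpow_natCast,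
      ← Real.rpow_mul hℓ0]
    gcongr
    exact_mod_cast hpr
  refine le_trans ?_ (mul_le_mul_of_nonneg_left hrate (by linarith))
  rcases lt_or_ge (n * ε) ((ℓ : ℝ) ^ 2) with h | h
  · refine (abs_answerOf_sub_le_one hn hD _ _).trans ?_
    have : 1 ≤ ((ℓ : ℝ) ^ 2 / (n * ε)) ^ p :=
      Real.one_le_rpow ((one_le_div hN).mpr h.le) hp
    nlinarith
  · have hq : √(ℓ : ℝ) / (n * ε) ^ (1 / 4 : ℝ) = ((ℓ : ℝ) ^ 2 / (n * ε)) ^ (1 / 4 : ℝ) := by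
      rw [Real.div_rpow (by positivity) hN.le, ← Real.rpow_natCast, ← Real.rpow_mul hℓ0,
        Real.sqrt_eq_rpow]
      norm_num
    have h4 : ((n * ε) ^ (1 / 4 : ℝ)) ^ 4 = n * ε := by
      rw [← Real.rpow_natCast, ← Real.rpow_mul hN.le]
      norm_num
    refine (hω.abs_answerOf_sub_le hn hℓ hε h0 h1 hy hD (Real.rpow_pos_of_pos hN _) h4
      ((one_le_pow₀ hℓ').trans h)).trans ?_
    rw [hq]
    refine mul_le_mul hK ?_ (by positivity) (by linarith)
    exact Real.rpow_le_rpow_of_exponent_ge hx ((div_le_one hN).mpr h) hp4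

end

section

variable {n ℓ : ℕ} {params : List ℝ} {X : Set (E ℓ)} {x₀ : E ℓ} {K p r : ℝ}

lemma nonInteractive_accurate (hn : 1 ≤ n) (hℓ : 1 ≤ ℓ) (hε : 0 < params.getD 0 0)
    (h0 : 0 < params.getD 1 0) (h1 : params.getD 1 0 < 1) (hX : ∀ x ∈ X, ∀ y ∈ X, dist x y ≤ 1)
    (hx₀ : x₀ ∈ X) (hK : 36 * level n ℓ (params.getD 1 0) ^ 2 ≤ K) (hp : 0 ≤ p) (hp4 : p ≤ 1 / 4)
    (hpr : 2 * p ≤ r) :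
    nonInteractiveMechanism.Accurate n params X x₀
      (K * ((ℓ : ℝ) ^ r / ((n : ℝ) ^ p * params.getD 0 0 ^ p))) (params.getD 1 0) := by
  intro D hD
  refine (measure_mono fun ω hω => ?_).trans (tapeLaw_not_typical_le hn hℓ hε h0 h1)
  rw [Set.mem_ofPred_eq] at hω ⊢
  refine fun hgood => hω fun y hy => ?_
  rw [nonInteractive_reply_eq, synopsis_eq]
  exact hgood.abs_answerOf_sub_le_rate hn hℓ hε h0 h1 (hX _ hy _ hx₀) (fun i => hX _ (hD i) _ hy)
    hK hp hp4 hpr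

lemma interactive_accurate (hn : 1 ≤ n) (hℓ : 1 ≤ ℓ) (hε : 0 < params.getD 0 0)
    (h0 : 0 < params.getD 1 0) (h1 : params.getD 1 0 < 1) (hX : ∀ x ∈ X, ∀ y ∈ X, dist x y ≤ 1)
    (hx₀ : x₀ ∈ X) (hK : 36 * level n ℓ (params.getD 1 0) ^ 2 ≤ K) (hp : 0 ≤ p) (hp4 : p ≤ 1 / 4)
    (hpr : 2 * p ≤ r) (k : ℕ) :
    interactiveMechanism.Accurate n k params X x₀
      (K * ((ℓ : ℝ) ^ r / ((n : ℝ) ^ p * params.getD 0 0 ^ p))) (params.getD 1 0) := by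
  intro D hD A hA
  refine (measure_mono fun ω hω => ?_).trans (tapeLaw_not_typical_le hn hℓ hε h0 h1)
  rw [Set.mem_ofPred_eq] at hω ⊢
  refine fun hgood => hω fun t _ => ?_
  rw [interactive_reply_eq]
  exact hgood.abs_answerOf_sub_le_rate hn hℓ hε h0 h1 (hX _ (hA _ _) _ hx₀)
    (fun i => hX _ (hD i) _ (hA _ _)) hK hp hp4 hpr

/-- The threshold 2000 covers 36 · 7² = 1764. -/
lemma sq_level_le {n ℓ c : ℕ} {β L : ℝ} (hc : 2000 ≤ c) (h0 : 0 < β) (h1 : β < 1)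
    (hL1 : 1 ≤ L) (hL : level n ℓ β ≤ 7 * L) :
    36 * level n ℓ β ^ 2 ≤ c * L ^ c := by
  have hB := level_ge (n := n) (ℓ := ℓ) h0 h1
  have hc' : (2000 : ℝ) ≤ c := by exact_mod_cast hc
  have h2 : L ^ 2 ≤ L ^ c := pow_le_pow_right₀ hL1 (by omega)
  calc 36 * level n ℓ β ^ 2 ≤ 36 * (7 * L) ^ 2 := by gcongr
    _ ≤ 2000 * L ^ 2 := by nlinarith [sq_nonneg L]
    _ ≤ c * L ^ c := by gcongr

end

lemma exists_uniform_constant : ∃ c : ℕ, 2000 ≤ c ∧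
    ∀ (n ℓ : ℕ) (params : List ℝ) (X : Set (E ℓ)) (x₀ : E ℓ), 1 ≤ n + ℓ →
      nonInteractiveMechanism.TimeBound n params X x₀ (c * (n + ℓ) ^ c) ∧
      ∀ k, interactiveMechanism.TimeBound n k params X x₀ (c * (n + ℓ) ^ c) := by
  obtain ⟨c, hc⟩ := exists_timeBound
  refine ⟨c + 2000, by omega, fun n ℓ params X x₀ h => ?_⟩
  obtain ⟨h1, h2⟩ := hc n ℓ params X x₀ h
  have hle : c * (n + ℓ) ^ c ≤ (c + 2000) * (n + ℓ) ^ (c + 2000) :=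
    Nat.mul_le_mul (by omega) (Nat.pow_le_pow_right h (by omega))
  exact ⟨fun D hD ω => ⟨(h1 D hD ω).1.trans hle, fun y hy => ((h1 D hD ω).2 y hy).trans hle⟩,
    fun k D hD A hA ω => ⟨(h2 k D hD A hA ω).1.trans hle,
      fun t ht => ((h2 k D hD A hA ω).2 t ht).trans hle⟩⟩

end DistanceRelease

/-! ### The four claims -/

open DistanceRelease in
theorem mainTheorem5 :
    -- interactive, `(ε, δ)`-differentially private
    (∃ M : Interactive, ∃ c : ℕ, ∀ (ℓ n k : ℕ) (ε δ β : ℝ), 1 ≤ ℓ → 1 ≤ n → 1 ≤ k →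
      0 < ε → 0 < δ → δ < 1 → 0 < β → β < 1 →
      ∀ X : Set (E ℓ), (∀ x ∈ X, ∀ y ∈ X, dist x y ≤ 1) → ∀ x₀ ∈ X,
        M.Private n k [ε, β, k, δ] X x₀ ε δ ∧
        M.Accurate n k [ε, β, k, δ] X x₀
          (c * (1 + Real.log ℓ + Real.log n + Real.log k + Real.log (1 / β) +
              Real.log (1 / δ)) ^ c *
            ((ℓ : ℝ) ^ (9 / 23 : ℝ) / ((n : ℝ) ^ (4 / 23 : ℝ) * ε ^ (4 / 23 : ℝ)))) β ∧
        M.TimeBound n k [ε, β, k, δ] X x₀ (c * (n + ℓ) ^ c)) ∧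
    -- non-interactive, `(ε, δ)`-differentially private
    (∃ M : NonInteractive, ∃ c : ℕ, ∀ (ℓ n : ℕ) (ε δ β : ℝ), 1 ≤ ℓ → 1 ≤ n →
      0 < ε → 0 < δ → δ < 1 → 0 < β → β < 1 →
      ∀ X : Set (E ℓ), (∀ x ∈ X, ∀ y ∈ X, dist x y ≤ 1) → ∀ x₀ ∈ X,
        M.Private n [ε, β, δ] X x₀ ε δ ∧
        M.Accurate n [ε, β, δ] X x₀
          (c * (1 + Real.log ℓ + Real.log n + Real.log (1 / β) + Real.log (1 / δ)) ^ c *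
            ((ℓ : ℝ) ^ (9 / 23 : ℝ) / ((n : ℝ) ^ (4 / 23 : ℝ) * ε ^ (4 / 23 : ℝ)))) β ∧
        M.TimeBound n [ε, β, δ] X x₀ (c * (n + ℓ) ^ c)) ∧
    -- interactive, `ε`-differentially private
    (∃ M : Interactive, ∃ c : ℕ, ∀ (ℓ n k : ℕ) (ε β : ℝ), 1 ≤ ℓ → 1 ≤ n → 1 ≤ k →
      0 < ε → 0 < β → β < 1 →
      ∀ X : Set (E ℓ), (∀ x ∈ X, ∀ y ∈ X, dist x y ≤ 1) → ∀ x₀ ∈ X,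
        M.Private n k [ε, β, k] X x₀ ε 0 ∧
        M.Accurate n k [ε, β, k] X x₀
          (c * (1 + Real.log ℓ + Real.log n + Real.log k + Real.log (1 / β)) ^ c *
            ((ℓ : ℝ) ^ (7 / 17 : ℝ) / ((n : ℝ) ^ (2 / 17 : ℝ) * ε ^ (2 / 17 : ℝ)))) β ∧
        M.TimeBound n k [ε, β, k] X x₀ (c * (n + ℓ) ^ c)) ∧
    -- non-interactive, `ε`-differentially private
    (∃ M : NonInteractive, ∃ c : ℕ, ∀ (ℓ n : ℕ) (ε β : ℝ), 1 ≤ ℓ → 1 ≤ n →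
      0 < ε → 0 < β → β < 1 →
      ∀ X : Set (E ℓ), (∀ x ∈ X, ∀ y ∈ X, dist x y ≤ 1) → ∀ x₀ ∈ X,
        M.Private n [ε, β] X x₀ ε 0 ∧
        M.Accurate n [ε, β] X x₀
          (c * (1 + Real.log ℓ + Real.log n + Real.log (1 / β)) ^ c *
            ((ℓ : ℝ) ^ (7 / 17 : ℝ) / ((n : ℝ) ^ (2 / 17 : ℝ) * ε ^ (2 / 17 : ℝ)))) β ∧
        M.TimeBound n [ε, β] X x₀ (c * (n + ℓ) ^ c)) := by
  obtain ⟨c, hc, hT⟩ := exists_uniform_constant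
  have hnat : ∀ {m : ℕ}, 1 ≤ m → 0 ≤ Real.log m := fun {m} hm =>
    Real.log_nonneg (by exact_mod_cast hm)
  have hinv : ∀ {x : ℝ}, 0 < x → x < 1 → 0 ≤ Real.log (1 / x) := fun hx hx1 =>
    Real.log_nonneg ((one_le_div hx).mpr hx1.le)
  -- In each case the three `norm_num` goals are 0 ≤ p, p ≤ 1/4 and 2p ≤ r, with (p, r) = (4/23,
  -- 9/23) or (2/17, 7/17). The summands log k and log(1/δ) enter only through being nonnegative.
  refine ⟨⟨interactiveMechanism, c, ?_⟩, ⟨nonInteractiveMechanism, c, ?_⟩,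
    ⟨interactiveMechanism, c, ?_⟩, ⟨nonInteractiveMechanism, c, ?_⟩⟩
  · intro ℓ n k ε δ β hℓ hn hk hε hδ hδ1 h0 h1 X hX x₀ hx₀
    have hlev := level_le (β := β) hn hℓ
    have i1 := hnat hℓ
    have i2 := hnat hn
    have i3 := hnat hk
    have i4 := hinv h0 h1
    have i5 := hinv hδ hδ1
    exact ⟨interactive_private (params := [ε, β, k, δ]) hn hℓ hε h0 h1 hX x₀ k δ,
      interactive_accurate (params := [ε, β, k, δ]) hn hℓ hε h0 h1 hX hx₀
        (sq_level_le hc h0 h1 (by linarith) (hlev.trans (by linarith)))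
        (by norm_num) (by norm_num) (by norm_num) k,
      (hT n ℓ _ X x₀ (by omega)).2 k⟩
  · intro ℓ n ε δ β hℓ hn hε hδ hδ1 h0 h1 X hX x₀ hx₀
    have hlev := level_le (β := β) hn hℓ
    have i1 := hnat hℓ
    have i2 := hnat hn
    have i4 := hinv h0 h1
    have i5 := hinv hδ hδ1
    exact ⟨nonInteractive_private (params := [ε, β, δ]) hn hℓ hε h0 h1 hX x₀ δ,
      nonInteractive_accurate (params := [ε, β, δ]) hn hℓ hε h0 h1 hX hx₀
        (sq_level_le hc h0 h1 (by linarith) (hlev.trans (by linarith)))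
        (by norm_num) (by norm_num) (by norm_num),
      (hT n ℓ _ X x₀ (by omega)).1⟩
  · intro ℓ n k ε β hℓ hn hk hε h0 h1 X hX x₀ hx₀
    have hlev := level_le (β := β) hn hℓ
    have i1 := hnat hℓ
    have i2 := hnat hn
    have i3 := hnat hk
    have i4 := hinv h0 h1
    exact ⟨interactive_private (params := [ε, β, k]) hn hℓ hε h0 h1 hX x₀ k 0,
      interactive_accurate (params := [ε, β, k]) hn hℓ hε h0 h1 hX hx₀
        (sq_level_le hc h0 h1 (by linarith) (hlev.trans (by linarith)))
        (by norm_num) (by norm_num) (by norm_num) k,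
      (hT n ℓ _ X x₀ (by omega)).2 k⟩
  · intro ℓ n ε β hℓ hn hε h0 h1 X hX x₀ hx₀
    have hlev := level_le (β := β) hn hℓ
    have i1 := hnat hℓ
    have i2 := hnat hn
    have i4 := hinv h0 h1
    exact ⟨nonInteractive_private (params := [ε, β]) hn hℓ hε h0 h1 hX x₀ 0,
      nonInteractive_accurate (params := [ε, β]) hn hℓ hε h0 h1 hX hx₀
        (sq_level_le hc h0 h1 (by linarith) (hlev.trans (by linarith)))
        (by norm_num) (by norm_num) (by norm_num),
      (hT n ℓ _ X x₀ (by omega)).1⟩
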